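/- **Model.** A planar biped on an incline of inclination $\lambda$ consists of a torso of length $l$ and two kneeless legs of length $r$; each leg has a mass $m$ at its midpoint, the hip a mass $M_H$, and the far end of the torso a mass $M_T$ (all of these, and $g$, positive). The angles $q=(q_1,q_2,q_3)\in\mathbb{R}^3$ of the stance leg, the swing leg and the torso are measured from the normal to the incline. During the swing phase $$\mathbb{I}(q)\ddot q+\Gamma(q,\dot q)\dot q=G(q)+Bu,\qquad u\in\mathbb{R}^2,\qquad B=\begin{bmatrix}-1&0\\0&-1\\1&1\end{bmatrix},$$ where $$\mathbb{I}=\begin{bmatrix}\tfrac{(4M_H+4M_T+5m)r^2}{4}&-\tfrac{mr^2}{2}\cos(q_1-q_2)&M_Tlr\cos(q_1-q_3)\\-\tfrac{mr^2}{2}\cos(q_1-q_2)&\tfrac{mr^2}{4}&0\\M_Tlr\cos(q_1-q_3)&0&M_Tl^2\end{bmatrix},\qquad G=\begin{bmatrix}\tfrac{gr(2M_H+2M_T+3m)}{2}\sin(q_1-\lambda)\\-\tfrac{gmr}{2}\sin(q_2-\lambda)\\M_Tgl\sin(q_3-\lambda)\end{bmatrix},$$ and $\Gamma$ is the connection matrix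 of the Levi-Civita connection of $\mathbb{I}$ (so that $\Gamma(q,\dot q)\dot q$ is the vector of Coriolis and centrifugal forces). The switching surface is $\mathcal S=\{q_1=q_{1ref}\}$ with $q_{1ref}>0$. When $\mathcal S$ is reached the state is reset by $x^+=\Delta(x^-)$: the swing foot hits the ground in a perfectly plastic impact without slip and without impulsive torques, the former stance foot is released, and then the two legs are interchanged. **Controller.** Put $q_e=(q_3-q_{3ref},\,q_1+q_2)$, $\omega_e=\dot q_e$, $\alpha=2(q_1-q_3)$, $\beta=2(q_1-q_2)$, $D=4M_H+2M_T(1-\cos\alpha)+m(3-2\cos\beta)$, $\mathbb{I}_e=\operatorname{diag}(l^2D,r^2D)$, and $$\Gamma_e=\mathbb{I}_e^{-1}\begin{bmatrix}M_Tl^2\dot\alpha\sin\alpha+ml^2\dot\beta\sin\beta&ml^2\dot\alpha\sin\beta-M_Tr^2\dot\beta\sin\alpha\\-ml^2\dot\alpha\sin\beta+M_Tr^2\dot\beta\sin\alpha&M_Tr^2\dot\alpha\sin\alpha+mr^2\dot\beta\sin\beta\end{bmatrix},\qquad \mathbb{I}_e\eta_e=\begin{bmatrix}\sin(q_3-q_{3ref})\\\sin(q_1+q_2)\end{bmatrix}.$$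 The swing dynamics imply $\mathbb{I}_e\dot\omega_e+\tau_e+\tau_g^e=B_eu$, where, with $Y=\begin{bmatrix}0&0&1\\1&1&0\end{bmatrix}$, $B_e=\mathbb{I}_eY\mathbb{I}^{-1}B$, $\tau_e=\mathbb{I}_eY\mathbb{I}^{-1}\Gamma\dot q$ and $\tau_g^e=-\mathbb{I}_eY\mathbb{I}^{-1}G$. The feedback-regularization plus geometric PID controller with gains $k_p,k_d,k_I>0$ is $$u=B_e^{-1}\bigl(\tau_e+\hat\tau^e_g-\mathbb{I}_e\Gamma_e\omega_e-\mathbb{I}_e(k_p\eta_e+k_d\omega_e+k_I\omega_I)\bigr),\qquad \dot\omega_I+\Gamma_e\omega_I=\eta_e,$$ where $\hat\tau_g^e$ is $\tau_g^e$ computed with an inclination $\hat\lambda$ that need not equal $\lambda$. The integral state $\omega_I$ starts at $0$ and is continuous at impacts. For $\delta>0$ let $$\mathcal Z_\delta=\Bigl\{(q,\dot q):\ |q_{e,1}|,|q_{e,2}|<\tfrac{\pi}{2},\ \sqrt{\|\eta_e\|^2+\|\dot q_e\|^2}\le\delta\Bigr\},$$ a neighbourhood of the zero dynamics manifold $\mathcal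 Z=\{q_e=0,\ \dot q_e=0\}$. **Hybrid zero dynamics.** For $a\in\mathbb{R}$ apply $\Delta$ to the state of $\mathcal Z\cap\mathcal S$ with $\dot q_1=a$; apply the impulsive hip torque that brings the velocity back to $\dot q_e=0$; then let the robot move with $q_e\equiv0$ (some torques $u$ enforcing this) from $q_1=-q_{1ref}$. If $q_1$ increases with positive velocity, up to and including the moment it reaches $q_{1ref}$, and $b$ is the value of $\dot q_1$ at that moment, we write $a\rightsquigarrow b$. **Theorem.** Suppose that $B_e$ is invertible at every configuration with $q_e=0$ and $|q_1|\le q_{1ref}$, and that the hybrid zero dynamics can walk in the sense that there is a compact set $V\subset(0,\infty)$ of speeds such that for every $a\in V$ there is a $b$ in the interior of $V$ with $a\rightsquigarrow b$. Then for all sufficiently small $\delta>0$ there exist PID gains such that, for every initial pre-impact state $x_0\in\mathcal Z_\delta\cap\mathcal S$ with $\dot q_1\in V$, there are impact times $t_0<t_1<\cdots$ with $t_k\to\infty$ and a trajectory $x$ of the closed-loop hybrid system with $x(t_0^-)=x_0$ and with impacts exactly at these times; and for every trajectory of the closed-loop hybrid system with infinitely many impacts, at times $t_0<t_1<\cdots$,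 and with $x(t_0^-)=x_0$, one has $$x(t_k^-)\in\mathcal Z_\delta\qquad\text{for all }k\ge0 .$$ -/

import Mathlib

open Real Set Filter Topology Matrix

noncomputable section

namespace Biped

/-- Data of the three-link planar biped on an incline, with the constants of the gait.
Angles are real coordinates, measured from the normal to the incline: `q 0` is the angle of the
stance leg, `q 1` that of the swing leg, `q 2` that of the torso. -/
structure Params where
  /-- mass of each leg, lumped at its midpoint -/
  m : ℝ
  /-- mass at the hip -/
  MH : ℝ
  /-- mass at the far end of the torso -/
  MT : ℝ
  /-- length of the torso -/
  l : ℝ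
  /-- length of each leg -/
  r : ℝ
  /-- gravitational acceleration -/
  g : ℝ
  /-- inclination of the plane -/
  lam : ℝ
  /-- stance leg angle at which the switching surface is placed -/
  q1ref : ℝ
  /-- desired torso angle -/
  q3ref : ℝ
  m_pos : 0 < m
  MH_pos : 0 < MH
  MT_pos : 0 < MT
  l_pos : 0 < l
  r_pos : 0 < r
  g_pos : 0 < g
  q1ref_pos : 0 < q1ref

/-- PID gains. -/
structure Gains where
  kp : ℝ
  kd : ℝ
  kI : ℝ
  kp_pos : 0 < kp
  kd_pos : 0 < kd
  kI_pos : 0 < kI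

variable (p : Params)

/-! ### Swing phase -/

/-- The mass-inertia tensor. -/
def inertia (q : Fin 3 → ℝ) : Matrix (Fin 3) (Fin 3) ℝ :=
  !![(4 * p.MH * p.r ^ 2 + 4 * p.MT * p.r ^ 2 + 5 * p.m * p.r ^ 2) / 4,
      -(p.m * p.r ^ 2 * cos (q 0 - q 1)) / 2, p.MT * p.l * p.r * cos (q 0 - q 2);
    -(p.m * p.r ^ 2 * cos (q 0 - q 1)) / 2, p.m * p.r ^ 2 / 4, 0;
    p.MT * p.l * p.r * cos (q 0 - q 2), 0, p.MT * p.l ^ 2]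

/-- The matrix `Γ(q, q̇)` of the Levi-Civita connection of `inertia`:
`𝕀 ∇_q̇ q̇ = 𝕀 q̈ + Γ(q, q̇) q̇`. -/
def connection (q v : Fin 3 → ℝ) : Matrix (Fin 3) (Fin 3) ℝ :=
  !![0, -(p.m * p.r ^ 2 * sin (q 0 - q 1) * v 1) / 2,
      p.MT * p.l * p.r * sin (q 0 - q 2) * v 2;
    p.m * p.r ^ 2 * sin (q 0 - q 1) * v 0 / 2, 0, 0;
    -(p.MT * p.l * p.r * sin (q 0 - q 2) * v 0), 0, 0]

/-- The gravitational forces for a plane of inclination `a`. -/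
def gravity (a : ℝ) (q : Fin 3 → ℝ) : Fin 3 → ℝ :=
  ![p.g * p.r * (2 * p.MH + 2 * p.MT + 3 * p.m) * sin (q 0 - a) / 2,
    -(p.g * p.m * p.r * sin (q 1 - a)) / 2,
    p.MT * p.g * p.l * sin (q 2 - a)]

/-- The input matrix. -/
def inputMatrix : Matrix (Fin 3) (Fin 2) ℝ :=
  !![-1, 0; 0, -1; 1, 1]

/-- The acceleration `q̈` given by the Euler-Lagrange equations
`𝕀 q̈ + Γ(q, q̇) q̇ = G + B u` of the swing phase. -/
def swingAcc (q v : Fin 3 → ℝ) (u : Fin 2 → ℝ) : Fin 3 → ℝ :=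
  (inertia p q)⁻¹ *ᵥ (gravity p p.lam q - connection p q v *ᵥ v + inputMatrix *ᵥ u)

/-! ### Impact phase

Generalized coordinates of the double stance model: the three angles and the two Cartesian
coordinates of the hip. The stance foot is at `hip - r (sin q₁, cos q₁)`, the swing foot at
`hip - r (sin q₂, cos q₂)` and the far end of the torso at `hip + l (sin q₃, cos q₃)`. -/

/-- Inertia matrix of the unpinned biped. -/
def inertiaDS (q : Fin 3 → ℝ) : Matrix (Fin 5) (Fin 5) ℝ :=
  !![p.m * p.r ^ 2 / 4, 0, 0, -(p.m * p.r * cos (q 0)) / 2, p.m * p.r * sin (q 0) / 2;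
    0, p.m * p.r ^ 2 / 4, 0, -(p.m * p.r * cos (q 1)) / 2, p.m * p.r * sin (q 1) / 2;
    0, 0, p.MT * p.l ^ 2, p.MT * p.l * cos (q 2), -(p.MT * p.l * sin (q 2));
    -(p.m * p.r * cos (q 0)) / 2, -(p.m * p.r * cos (q 1)) / 2, p.MT * p.l * cos (q 2),
      2 * p.m + p.MH + p.MT, 0;
    p.m * p.r * sin (q 0) / 2, p.m * p.r * sin (q 1) / 2, -(p.MT * p.l * sin (q 2)),
      0, 2 * p.m + p.MH + p.MT]

/-- Jacobian of `q ↦ (q, γ(q))`, where `γ(q) = r (sin q₁, cos q₁)` is the position of the hip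
when the stance foot is at the origin. -/
def pinnedJacobian (q : Fin 3 → ℝ) : Matrix (Fin 5) (Fin 3) ℝ :=
  !![1, 0, 0;
    0, 1, 0;
    0, 0, 1;
    p.r * cos (q 0), 0, 0;
    -(p.r * sin (q 0)), 0, 0]

/-- Jacobian of the position of the swing foot. -/
def swingFootJacobian (q : Fin 3 → ℝ) : Matrix (Fin 2) (Fin 5) ℝ :=
  !![0, -(p.r * cos (q 1)), 0, 1, 0;
    0, p.r * sin (q 1), 0, 0, 1]

/-- The impulse at the swing foot, as a linear function of the velocity before the impact. -/
def impulseMatrix (q : Fin 3 → ℝ) : Matrix (Fin 2) (Fin 3) ℝ :=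
  -((swingFootJacobian p q * (inertiaDS p q)⁻¹ * (swingFootJacobian p q)ᵀ)⁻¹ *
    (swingFootJacobian p q * pinnedJacobian p q))

/-- The velocity of the unpinned biped after the impact, before the legs are relabelled. -/
def impactMatrix (q : Fin 3 → ℝ) : Matrix (Fin 5) (Fin 3) ℝ :=
  (inertiaDS p q)⁻¹ * (swingFootJacobian p q)ᵀ * impulseMatrix p q + pinnedJacobian p q

/-- Interchange of the two legs. -/
def relabel : Matrix (Fin 3) (Fin 3) ℝ :=
  !![0, 1, 0; 1, 0, 0; 0, 0, 1]

/-- The matrix `[R 0]`: drop the hip velocity and interchange the two legs. -/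
def relabelDS : Matrix (Fin 3) (Fin 5) ℝ :=
  !![0, 1, 0, 0, 0; 1, 0, 0, 0, 0; 0, 0, 1, 0, 0]

/-- The reset map `Δ`. -/
def reset (x : (Fin 3 → ℝ) × (Fin 3 → ℝ)) : (Fin 3 → ℝ) × (Fin 3 → ℝ) :=
  (relabel *ᵥ x.1, (relabelDS * impactMatrix p x.1) *ᵥ x.2)

/-- The switching surface `q₁ = q₁ref`. -/
def switchingSurface : Set ((Fin 3 → ℝ) × (Fin 3 → ℝ)) :=
  {x | x.1 0 = p.q1ref}

/-! ### Outputs and controller -/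

/-- The output `q_e = (q₃ - q₃ref, q₁ + q₂)`. -/
def output (q : Fin 3 → ℝ) : Fin 2 → ℝ :=
  ![q 2 - p.q3ref, q 0 + q 1]

/-- The (constant) Jacobian of the output. -/
def outputJacobian : Matrix (Fin 2) (Fin 3) ℝ :=
  !![0, 0, 1; 1, 1, 0]

/-- The angle `α = 2 (q₁ - q₃)`; equally `2 (q₁ - q₃ref - (q_e)₁)`. -/
def alpha (q : Fin 3 → ℝ) : ℝ := 2 * (q 0 - q 2)

/-- The angle `β = 2 (q₁ - q₂)`; equally `2 (2 q₁ - (q_e)₂)`. -/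
def beta (q : Fin 3 → ℝ) : ℝ := 2 * (q 0 - q 1)

/-- The common factor of the two diagonal entries of the error inertia tensor. -/
def errorFactor (q : Fin 3 → ℝ) : ℝ :=
  4 * p.MH + 2 * p.MT * (1 - cos (alpha q)) + p.m * (3 - 2 * cos (beta q))

/-- The inertia tensor `𝕀_e` of the error dynamics. -/
def errorInertia (q : Fin 3 → ℝ) : Matrix (Fin 2) (Fin 2) ℝ :=
  !![p.l ^ 2 * errorFactor p q, 0; 0, p.r ^ 2 * errorFactor p q]

/-- The connection matrix of `𝕀_e`, evaluated along `(α̇, β̇)`. -/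
def errorConnection (q v : Fin 3 → ℝ) : Matrix (Fin 2) (Fin 2) ℝ :=
  (errorInertia p q)⁻¹ *
    !![p.MT * p.l ^ 2 * sin (alpha q) * alpha v + p.m * p.l ^ 2 * sin (beta q) * beta v,
        p.m * p.l ^ 2 * sin (beta q) * alpha v - p.MT * p.r ^ 2 * sin (alpha q) * beta v;
      -(p.m * p.l ^ 2 * sin (beta q) * alpha v) + p.MT * p.r ^ 2 * sin (alpha q) * beta v,
        p.MT * p.r ^ 2 * sin (alpha q) * alpha v + p.m * p.r ^ 2 * sin (beta q) * beta v]

/-- Multiplication of the swing-phase forces by this matrix gives the forces of the error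
dynamics `𝕀_e ω̇_e + τ_e + τ_g = B_e u`. -/
def forceToError (q : Fin 3 → ℝ) : Matrix (Fin 2) (Fin 3) ℝ :=
  errorInertia p q * outputJacobian * (inertia p q)⁻¹

/-- The input matrix `B_e` of the error dynamics. -/
def errorInput (q : Fin 3 → ℝ) : Matrix (Fin 2) (Fin 2) ℝ :=
  forceToError p q * inputMatrix

/-- The quadratic velocity forces `τ_e` of the error dynamics. -/
def errorVelocityForce (q v : Fin 3 → ℝ) : Fin 2 → ℝ :=
  forceToError p q *ᵥ (connection p q v *ᵥ v)

/-- The gravitational term `τ_g` of the error dynamics for a plane of inclination `a`. -/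
def errorGravity (a : ℝ) (q : Fin 3 → ℝ) : Fin 2 → ℝ :=
  -(forceToError p q *ᵥ gravity p a q)

/-- The error one-form, raised by `𝕀_e`: `𝕀_e η_e = (sin (q₃ - q₃ref), sin (q₁ + q₂))`. -/
def eta (q : Fin 3 → ℝ) : Fin 2 → ℝ :=
  (errorInertia p q)⁻¹ *ᵥ ![sin (q 2 - p.q3ref), sin (q 0 + q 1)]

/-- The velocity `ω_e = q̇_e` of the output. -/
def omegaE (v : Fin 3 → ℝ) : Fin 2 → ℝ := outputJacobian *ᵥ v

/-- The hip torques of the feedback-regularization plus PID controller, solved from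
`B_e u = τ_e + τ_g - 𝕀_e Γ ω_e - 𝕀_e (k_p η_e + k_d ω_e + k_I ω_I)`.
Here `lamC` is the inclination the controller is set to. -/
def control (K : Gains) (lamC : ℝ) (q v : Fin 3 → ℝ) (w : Fin 2 → ℝ) : Fin 2 → ℝ :=
  (errorInput p q)⁻¹ *ᵥ
    (errorVelocityForce p q v + errorGravity p lamC q
      - errorInertia p q *ᵥ (errorConnection p q v *ᵥ omegaE v)
      - errorInertia p q *ᵥ (K.kp • eta p q + K.kd • omegaE v + K.kI • w))

/-- Right-hand side of the integral term `ω̇_I + Γ ω_I = η_e`. -/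
def integralRate (q v : Fin 3 → ℝ) (w : Fin 2 → ℝ) : Fin 2 → ℝ :=
  eta p q - errorConnection p q v *ᵥ w

/-- The `δ`-neighbourhood of the zero dynamics manifold. The bound `π / 2` on the output errors
leaves out the other zeros of the sines in `eta`. -/
def Zdelta (δ : ℝ) : Set ((Fin 3 → ℝ) × (Fin 3 → ℝ)) :=
  {x | (∀ i, |output p x.1 i| < π / 2) ∧
    √((∑ i, eta p x.1 i ^ 2) + ∑ i, omegaE x.2 i ^ 2) ≤ δ}

/-! ### The closed-loop hybrid system -/

/-- `(q, v, w)` is a trajectory of the closed-loop hybrid system with impacts exactly at the times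
`t 0 < t 1 < …` of `[t 0, sup t)`. The functions are left-continuous at the impacts, so that
`(q (t k), v (t k))` is the state just before the `k`-th impact. The integral state `w` is zero
initially and is not reset. -/
structure IsHybridTrajectory (K : Gains) (lamC : ℝ) (t : ℕ → ℝ)
    (q v : ℝ → Fin 3 → ℝ) (w : ℝ → Fin 2 → ℝ) : Prop where
  strictMono : StrictMono t
  impact : ∀ k, (q (t k), v (t k)) ∈ switchingSurface p
  no_impact : ∀ k, ∀ s ∈ Ioo (t k) (t (k + 1)), (q s, v s) ∉ switchingSurface p
  jump : ∀ k, Tendsto (fun s => (q s, v s)) (𝓝[>] (t k)) (𝓝 (reset p (q (t k), v (t k))))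
  integral_start : w (t 0) = 0
  integral_right : ∀ k, Tendsto w (𝓝[>] (t k)) (𝓝 (w (t k)))
  left_q : ∀ k, ContinuousOn q (Ioc (t k) (t (k + 1)))
  left_v : ∀ k, ContinuousOn v (Ioc (t k) (t (k + 1)))
  left_w : ∀ k, ContinuousOn w (Ioc (t k) (t (k + 1)))
  deriv_q : ∀ k, ∀ s ∈ Ioo (t k) (t (k + 1)), HasDerivAt q (v s) s
  deriv_v : ∀ k, ∀ s ∈ Ioo (t k) (t (k + 1)),
    HasDerivAt v (swingAcc p (q s) (v s) (control p K lamC (q s) (v s) (w s))) s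
  deriv_w : ∀ k, ∀ s ∈ Ioo (t k) (t (k + 1)), HasDerivAt w (integralRate p (q s) (v s) (w s)) s

/-! ### The hybrid zero dynamics -/

/-- The configuration with zero output and stance leg angle `a`. -/
def zeroConfig (a : ℝ) : Fin 3 → ℝ := ![a, -a, p.q3ref]

/-- The velocity with zero output velocity and stance leg velocity `a`. -/
def zeroVel (a : ℝ) : Fin 3 → ℝ := ![a, -a, 0]

/-- One step of the hybrid zero dynamics, from the stance leg velocity `a` just before an impact to
the velocity `b` just before the next one. The reset is followed by the impulse of the hip torques
that brings the velocity back to zero output velocity; then the swing phase runs with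
the output kept at zero, and the stance leg angle `φ` increases from `-q₁ref` to `q₁ref` with
positive velocity `ψ`. -/
def ZeroDynStep (a b : ℝ) : Prop :=
  ∃ (T : ℝ) (φ ψ χ : ℝ → ℝ) (u : ℝ → Fin 2 → ℝ) (μ : Fin 2 → ℝ), 0 < T ∧
    inertia p (zeroConfig p (-p.q1ref)) *ᵥ
        (zeroVel (ψ 0) - (reset p (zeroConfig p p.q1ref, zeroVel a)).2) = inputMatrix *ᵥ μ ∧
    φ 0 = -p.q1ref ∧ φ T = p.q1ref ∧ ψ T = b ∧
    ∀ s ∈ Icc 0 T, 0 < ψ s ∧ HasDerivWithinAt φ (ψ s) (Icc 0 T) s ∧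
      HasDerivWithinAt ψ (χ s) (Icc 0 T) s ∧
      swingAcc p (zeroConfig p (φ s)) (zeroVel (ψ s)) (u s) = zeroVel (χ s)

end Biped

end

/-! The hip torques are internal: they do not enter the rate of change of the angular momentum about
the stance foot, which is the moment of gravity alone (`hasDerivWithinAt_momentum`). On the zero
dynamics manifold this momentum is `gain` times the stance leg velocity, so if H' is the product of
`gain` and the moment of gravity, then momentum²/2 - H(q₁) is conserved there
(`ZeroDynStep.conservation`). A step of the hybrid zero dynamics thus becomes an algebraic relation:
the impact determines the momentum, the impulsive hip torque does not alter it, and conservation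
gives the speed at the next impact. The same `gain` also governs the controller: B_e is invertible
exactly where it is nonzero (`det_errorInput_ne_zero_iff`).

In closed loop the output consists of two PID controlled double integrators, coupled through the
connection and disturbed by a bounded term from the wrong inclination. With k_p = 2k², k_d = ak, k_I
= ck³ one quadratic function Q of the scaled state (a k q_e + q̇_e, q̇_e, k² ω_I) decays at a rate
proportional to k, up to a forcing of order 1/k (`exists_outputEnergy_decay`).

An impact leaves an output velocity that is bounded but not small in δ, so √Q starts with size at
most of order kδ, provided kδ ≥ 1. This peak lasts only for a time of order 1/k, hence the integral
of √Q over a swing is O(δ) uniformly in k. The quantity momentum²/2 - H(q₁) changes at a rate O(√Q)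
along the true motion (`exists_tube_derivatives`), therefore by O(δ) in all. This traps the swing
phase in a tube (`tube_estimates`, `mem_tube`), bounds its duration from both sides, and makes the
speed at the next impact nearly that of the zero dynamics, which lies inside V with a uniform margin
(`exists_return_margin`). So δ is chosen first, to make the drift small, and k afterwards, to make
the output at the end of the swing smaller than δ (`exists_swing`).

The tube is compact and avoids the zeros of `gain`, so the closed loop field can be cut off outside
it; this gives solutions, which are concatenated into a walk. Since the estimates hold for any curve
that solves the equations, they also show by induction that every trajectory meets the switching
surface inside the neighbourhood. -/

/-! ### Solutions of smooth fields near a compact set -/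

/-- A vector field that is `C¹` near a compact set has, for every initial value and every duration,
a curve which solves it as long as it stays in the compact set. -/
theorem exists_solution_while_mem {X : Type*} [NormedAddCommGroup X] [NormedSpace ℝ X]
    [FiniteDimensional ℝ X] {f : X → X} {U S : Set X} (hU : IsOpen U) (hS : IsCompact S)
    (hSU : S ⊆ U) (hf : ContDiffOn ℝ 1 f U) (x₀ : X) {T : ℝ} (hT : 0 ≤ T) :
    ∃ x : ℝ → X, x 0 = x₀ ∧ ContinuousOn x (Icc 0 T) ∧
      ∀ t ∈ Ioo 0 T, x t ∈ S → HasDerivAt x (f (x t)) t := by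
  -- The field is multiplied by a bump function equal to 1 near `S` and 0 off the compact `L`; the
  -- product is bounded and globally Lipschitz.
  obtain ⟨L, hL, hSL, hLU⟩ := exists_compact_between hS hU hSU
  obtain ⟨χ, hχ1, hχ0, -⟩ := exists_contMDiffMap_one_nhds_of_subset_interior (n := 1)
    (modelWithCornersSelf ℝ X) hS.isClosed hSL
  have hχ : ContDiff ℝ 1 χ := χ.contMDiff.contDiff
  have hcs : HasCompactSupport (fun y => χ y • f y) := by
    refine HasCompactSupport.intro hL fun y hy => ?_
    simp [hχ0 y hy]
  have hsm : ContDiff ℝ 1 (fun y => χ y • f y) := by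
    rw [contDiff_iff_contDiffAt]
    intro y
    by_cases hy : y ∈ U
    · exact hχ.contDiffAt.smul ((hf y hy).contDiffAt (hU.mem_nhds hy))
    · have : (fun y => χ y • f y) =ᶠ[𝓝 y] fun _ => 0 := by
        filter_upwards [hL.isClosed.isOpen_compl.mem_nhds (fun h => hy (hLU h))] with z hz
        simp [hχ0 z hz]
      exact contDiffAt_const.congr_of_eventuallyEq this
  obtain ⟨K, hK⟩ := hsm.lipschitzWith_of_hasCompactSupport hcs one_ne_zero
  obtain ⟨B, hB⟩ := hcs.exists_bound_of_continuous hsm.continuous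
  -- The speed bound `B` holds everywhere, so the ball of radius `B * T` about `x₀` serves for the
  -- whole duration.
  have hpl : IsPicardLindelof (fun _ y => χ y • f y) (tmin := 0) (tmax := T)
      ⟨0, left_mem_Icc.2 hT⟩ x₀ (B.toNNReal * T.toNNReal) 0 B.toNNReal K := by
    refine IsPicardLindelof.of_time_independent (fun y _ => (hB y).trans (Real.le_coe_toNNReal B))
      hK.lipschitzOnWith ?_
    simp [Real.coe_toNNReal T hT, hT]
  obtain ⟨x, hx0, hx⟩ := hpl.exists_eq_forall_mem_Icc_hasDerivWithinAt₀
  refine ⟨x, hx0, fun t ht => (hx t ht).continuousWithinAt, fun t ht hxt => ?_⟩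
  have h := (hx t (Ioo_subset_Icc_self ht)).hasDerivAt (Icc_mem_nhds ht.1 ht.2)
  have h1 : χ (x t) = 1 := hχ1.self_of_nhdsSet _ hxt
  simpa [h1] using h

theorem Matrix.inv_mulVec_mulVec_self {n : Type*} [Fintype n] [DecidableEq n] {A : Matrix n n ℝ}
    (hA : IsUnit A.det) (x : n → ℝ) : A⁻¹ *ᵥ (A *ᵥ x) = x := by
  rw [mulVec_mulVec, nonsing_inv_mul _ hA, one_mulVec]

theorem Matrix.mulVec_inv_mulVec_self {n : Type*} [Fintype n] [DecidableEq n] {A : Matrix n n ℝ}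
    (hA : IsUnit A.det) (x : n → ℝ) : A *ᵥ (A⁻¹ *ᵥ x) = x := by
  rw [mulVec_mulVec, mul_nonsing_inv _ hA, one_mulVec]

/-! ### Angular momentum, invertibility of B_e and the closed-loop output dynamics -/

namespace Biped

variable (p : Params)

/-- The coefficient of `q̇₁` in the angular momentum about the stance foot when the output velocity
is split off. -/
noncomputable def gain (q : Fin 3 → ℝ) : ℝ :=
  (p.MH + p.MT + p.m) * p.r ^ 2 + p.MT * p.l * p.r * cos (q 0 - q 2)

/-- The angular momentum about the stance foot. -/
noncomputable def momentum (q v : Fin 3 → ℝ) : ℝ := ∑ i, (inertia p q *ᵥ v) i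

/-- The moment of gravity about the stance foot. -/
noncomputable def gravityMoment (q : Fin 3 → ℝ) : ℝ := ∑ i, gravity p p.lam q i

/-- The acceleration of the output caused by a wrong inclination in the controller. -/
noncomputable def disturbance (lamC : ℝ) (q : Fin 3 → ℝ) : Fin 2 → ℝ :=
  outputJacobian *ᵥ ((inertia p q)⁻¹ *ᵥ (gravity p p.lam q - gravity p lamC q))

/-- Writing v₁ as (v₀ + v₁) - v₀ separates the output velocities; in what is left as coefficient of
v₀ the cosine of q₀ - q₁ cancels. -/
theorem momentum_eq (q v : Fin 3 → ℝ) :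
    momentum p q v = gain p q * v 0
      + (p.m * p.r ^ 2 / 4 - p.m * p.r ^ 2 / 2 * cos (q 0 - q 1)) * (v 0 + v 1)
      + (p.MT * p.l * p.r * cos (q 0 - q 2) + p.MT * p.l ^ 2) * v 2 := by
  simp [momentum, gain, inertia, Matrix.mulVec, dotProduct, Fin.sum_univ_three]
  ring

theorem le_errorFactor (q : Fin 3 → ℝ) : 4 * p.MH + p.m ≤ errorFactor p q := by
  have h1 := cos_le_one (alpha q)
  have h2 := cos_le_one (beta q)
  have := p.MT_pos
  have := p.m_pos
  unfold errorFactor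
  nlinarith

theorem errorFactor_le (q : Fin 3 → ℝ) : errorFactor p q ≤ 4 * p.MH + 4 * p.MT + 5 * p.m := by
  have h1 := neg_one_le_cos (alpha q)
  have h2 := neg_one_le_cos (beta q)
  have := p.MT_pos
  have := p.m_pos
  unfold errorFactor
  nlinarith

theorem errorFactor_pos (q : Fin 3 → ℝ) : 0 < errorFactor p q := by
  have := le_errorFactor p q
  have := p.MH_pos
  have := p.m_pos
  linarith

/-- The factor D of the error inertia is the determinant of the swing-phase inertia up to a positive
constant, so one lower bound of D makes both tensors invertible. -/
theorem det_inertia (q : Fin 3 → ℝ) :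
    (inertia p q).det = p.MT * p.l ^ 2 * p.m * p.r ^ 4 / 16 * errorFactor p q := by
  have h1 : cos (alpha q) = 2 * cos (q 0 - q 2) ^ 2 - 1 := cos_two_mul _
  have h2 : cos (beta q) = 2 * cos (q 0 - q 1) ^ 2 - 1 := cos_two_mul _
  simp [inertia, Matrix.det_fin_three, errorFactor, h1, h2]
  ring

theorem det_inertia_pos (q : Fin 3 → ℝ) : 0 < (inertia p q).det := by
  rw [det_inertia]
  have := errorFactor_pos p q
  have := p.MT_pos
  have := p.l_pos
  have := p.m_pos
  have := p.r_pos
  positivity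

theorem isUnit_det_inertia (q : Fin 3 → ℝ) : IsUnit (inertia p q).det :=
  (det_inertia_pos p q).ne'.isUnit

theorem isUnit_det_errorInertia (q : Fin 3 → ℝ) : IsUnit (errorInertia p q).det := by
  have := errorFactor_pos p q
  have := p.l_pos
  have := p.r_pos
  rw [isUnit_iff_ne_zero]
  simp only [errorInertia, Matrix.det_fin_two_of, mul_zero, sub_zero]
  positivity

theorem inertia_mulVec_swingAcc (q v : Fin 3 → ℝ) (u : Fin 2 → ℝ) :
    inertia p q *ᵥ swingAcc p q v u
      = gravity p p.lam q - connection p q v *ᵥ v + inputMatrix *ᵥ u := by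
  rw [swingAcc, mulVec_mulVec, mul_nonsing_inv _ (isUnit_det_inertia p q), one_mulVec]

/-- A hip torque acts on the torso and on a leg with opposite signs. This is why the angular
momentum about the stance foot does not see the control. -/
theorem sum_inputMatrix_mulVec (u : Fin 2 → ℝ) : ∑ i, (inputMatrix *ᵥ u) i = 0 := by
  simp [inputMatrix, Matrix.mulVec, dotProduct, Fin.sum_univ_three]
  ring

theorem exists_inputMatrix_mulVec {y : Fin 3 → ℝ} (hy : ∑ i, y i = 0) :
    ∃ u, inputMatrix *ᵥ u = y := by
  refine ⟨![-y 0, -y 1], ?_⟩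
  rw [Fin.sum_univ_three] at hy
  ext i
  fin_cases i <;> simp [inputMatrix, Matrix.mulVec, dotProduct]
  linarith

theorem errorInput_mulVec (q : Fin 3 → ℝ) (u : Fin 2 → ℝ) :
    errorInput p q *ᵥ u
      = errorInertia p q *ᵥ (outputJacobian *ᵥ ((inertia p q)⁻¹ *ᵥ (inputMatrix *ᵥ u))) := by
  simp only [errorInput, forceToError, mulVec_mulVec, Matrix.mul_assoc]

theorem outputJacobian_mulVec (v : Fin 3 → ℝ) : outputJacobian *ᵥ v = ![v 2, v 0 + v 1] := by
  ext i
  fin_cases i <;> simp [outputJacobian, Matrix.mulVec, dotProduct, Fin.sum_univ_three]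

/-- The controller is defined exactly where the angular momentum sees the stance leg velocity. -/
theorem det_errorInput_ne_zero_iff (q : Fin 3 → ℝ) :
    (errorInput p q).det ≠ 0 ↔ gain p q ≠ 0 := by
  have hI := isUnit_det_inertia p q
  rw [not_iff_not, ← Matrix.exists_mulVec_eq_zero_iff]
  constructor
  · rintro ⟨x, hx0, hx⟩
    by_contra hg
    -- A torque in the kernel accelerates no output and, being internal, produces no momentum; where
    -- `gain` is nonzero the acceleration `z` it causes must vanish.
    rw [errorInput_mulVec] at hx
    have hy : outputJacobian *ᵥ ((inertia p q)⁻¹ *ᵥ (inputMatrix *ᵥ x)) = 0 := by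
      rw [← inv_mulVec_mulVec_self (isUnit_det_errorInertia p q) (outputJacobian *ᵥ _), hx,
        mulVec_zero]
    set z := (inertia p q)⁻¹ *ᵥ (inputMatrix *ᵥ x) with hz
    have hIz : inertia p q *ᵥ z = inputMatrix *ᵥ x := by
      rw [hz, mulVec_inv_mulVec_self hI]
    rw [outputJacobian_mulVec] at hy
    have h2 : z 2 = 0 := by simpa using congrFun hy 0
    have h01 : z 0 + z 1 = 0 := by simpa using congrFun hy 1
    have hm : momentum p q z = 0 := by rw [momentum, hIz, sum_inputMatrix_mulVec]
    rw [momentum_eq, h2, h01] at hm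
    have h0 : z 0 = 0 := by simpa [hg] using hm
    have hz0 : z = 0 := by
      ext i
      fin_cases i
      · exact h0
      · simpa [h0] using h01
      · exact h2
    rw [hz0, mulVec_zero] at hIz
    refine hx0 ?_
    ext i
    fin_cases i
    · simpa [inputMatrix, Matrix.mulVec, dotProduct] using (congrFun hIz 0).symm
    · simpa [inputMatrix, Matrix.mulVec, dotProduct] using (congrFun hIz 1).symm
  · intro hg
    -- The vector (1, -1, 0) spans the kernel of the output Jacobian. When `gain` is zero it carries
    -- no momentum, hence is the acceleration caused by some torque.
    have hm : ∑ i, (inertia p q *ᵥ ![1, -1, 0]) i = 0 := by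
      have := momentum_eq p q ![1, -1, 0]
      simpa [momentum, hg] using this
    obtain ⟨x, hx⟩ := exists_inputMatrix_mulVec hm
    have hinv : (inertia p q)⁻¹ *ᵥ (inputMatrix *ᵥ x) = ![1, -1, 0] := by
      rw [hx, inv_mulVec_mulVec_self hI]
    refine ⟨x, ?_, ?_⟩
    · rintro rfl
      have := congrFun hinv 0
      simp at this
    · rw [errorInput_mulVec, hinv, outputJacobian_mulVec]
      ext i
      fin_cases i <;> simp [Matrix.mulVec, dotProduct]

/-- The closed-loop dynamics of the output. -/
theorem outputJacobian_mulVec_swingAcc (K : Gains) (lamC : ℝ) {q : Fin 3 → ℝ} (v : Fin 3 → ℝ)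
    (w : Fin 2 → ℝ) (hq : gain p q ≠ 0) :
    outputJacobian *ᵥ swingAcc p q v (control p K lamC q v w)
      = disturbance p lamC q - errorConnection p q v *ᵥ omegaE v
        - (K.kp • eta p q + K.kd • omegaE v + K.kI • w) := by
  have hB : IsUnit (errorInput p q).det :=
    isUnit_iff_ne_zero.2 ((det_errorInput_ne_zero_iff p q).2 hq)
  have hE := isUnit_det_errorInertia p q
  have h1 : errorInput p q *ᵥ control p K lamC q v w
      = errorInertia p q *ᵥ (outputJacobian *ᵥ ((inertia p q)⁻¹ *ᵥ (connection p q v *ᵥ v))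
        - outputJacobian *ᵥ ((inertia p q)⁻¹ *ᵥ gravity p lamC q)
        - errorConnection p q v *ᵥ omegaE v
        - (K.kp • eta p q + K.kd • omegaE v + K.kI • w)) := by
    rw [control, mulVec_inv_mulVec_self hB, mulVec_sub, mulVec_sub, mulVec_sub]
    simp only [errorVelocityForce, errorGravity, forceToError, mulVec_mulVec,
      Matrix.mul_assoc, sub_eq_add_neg]
  rw [errorInput_mulVec] at h1
  have h2 := congrArg ((errorInertia p q)⁻¹ *ᵥ ·) h1
  simp only [inv_mulVec_mulVec_self hE] at h2
  rw [swingAcc, mulVec_add, mulVec_add, h2, disturbance]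
  simp only [mulVec_sub]
  abel

/-- The angular momentum changes by the moment of gravity only. -/
theorem hasDerivWithinAt_momentum {q v : ℝ → Fin 3 → ℝ} {a : Fin 3 → ℝ} {u : Fin 2 → ℝ} {s : Set ℝ}
    {t : ℝ} (hq : HasDerivWithinAt q (v t) s t) (hv : HasDerivWithinAt v a s t)
    (ha : a = swingAcc p (q t) (v t) u) :
    HasDerivWithinAt (fun t => momentum p (q t) (v t)) (gravityMoment p (q t)) s t := by
  have h := inertia_mulVec_swingAcc p (q t) (v t) u
  rw [← ha] at h
  have h3 : ∑ i, (inertia p (q t) *ᵥ a) i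
      = gravityMoment p (q t) - ∑ i, (connection p (q t) (v t) *ᵥ v t) i := by
    rw [h]
    simp only [Pi.add_apply, Pi.sub_apply, Finset.sum_add_distrib, Finset.sum_sub_distrib,
      sum_inputMatrix_mulVec, gravityMoment, add_zero]
  have hq' := hasDerivWithinAt_pi.1 hq
  have hv' := hasDerivWithinAt_pi.1 hv
  have hf : HasDerivWithinAt (fun t => gain p (q t) * v t 0
      + (p.m * p.r ^ 2 / 4 - p.m * p.r ^ 2 / 2 * cos (q t 0 - q t 1)) * (v t 0 + v t 1)
      + (p.MT * p.l * p.r * cos (q t 0 - q t 2) + p.MT * p.l ^ 2) * v t 2) _ s t :=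
    ((((((((hq' 0).sub (hq' 2)).cos).const_mul (p.MT * p.l * p.r)).const_add
      ((p.MH + p.MT + p.m) * p.r ^ 2)).mul (hv' 0)).add
    ((((((hq' 0).sub (hq' 1)).cos).const_mul (p.m * p.r ^ 2 / 2)).const_sub
      (p.m * p.r ^ 2 / 4)).mul ((hv' 0).add (hv' 1)))).add
    ((((((hq' 0).sub (hq' 2)).cos).const_mul (p.MT * p.l * p.r)).add_const
      (p.MT * p.l ^ 2)).mul (hv' 2)))
  simp only [momentum_eq]
  refine hf.congr_deriv ?_
  have h4 := momentum_eq p (q t) a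
  rw [momentum, h3] at h4
  -- These velocity forces cancel the derivatives of the cosines in `momentum_eq`.
  have h5 : ∑ i, (connection p (q t) (v t) *ᵥ v t) i
      = p.m * p.r ^ 2 / 2 * sin (q t 0 - q t 1) * (v t 0 ^ 2 - v t 1 ^ 2)
        - p.MT * p.l * p.r * sin (q t 0 - q t 2) * (v t 0 ^ 2 - v t 2 ^ 2) := by
    simp [connection, Matrix.mulVec, dotProduct, Fin.sum_univ_three]
    ring
  rw [h5] at h4
  simp only [gain, Pi.sub_apply, Pi.add_apply] at h4 ⊢
  linear_combination -h4

theorem eta_eq (q : Fin 3 → ℝ) :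
    eta p q = ![sin (q 2 - p.q3ref) / (p.l ^ 2 * errorFactor p q),
      sin (q 0 + q 1) / (p.r ^ 2 * errorFactor p q)] := by
  have h := isUnit_det_errorInertia p q
  have h0 := (errorFactor_pos p q).ne'
  have hl := p.l_pos.ne'
  have hr := p.r_pos.ne'
  have : errorInertia p q *ᵥ ![sin (q 2 - p.q3ref) / (p.l ^ 2 * errorFactor p q),
      sin (q 0 + q 1) / (p.r ^ 2 * errorFactor p q)]
      = ![sin (q 2 - p.q3ref), sin (q 0 + q 1)] := by
    ext i
    fin_cases i <;> simp [errorInertia, Matrix.mulVec, dotProduct] <;> field_simp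
  rw [eta, ← this, inv_mulVec_mulVec_self h]

theorem errorConnection_eq (q v : Fin 3 → ℝ) :
    errorConnection p q v = !![
      (p.MT * sin (alpha q) * alpha v + p.m * sin (beta q) * beta v) / errorFactor p q,
      (p.m * p.l ^ 2 * sin (beta q) * alpha v - p.MT * p.r ^ 2 * sin (alpha q) * beta v)
        / (p.l ^ 2 * errorFactor p q);
      (-(p.m * p.l ^ 2 * sin (beta q) * alpha v) + p.MT * p.r ^ 2 * sin (alpha q) * beta v)
        / (p.r ^ 2 * errorFactor p q),
      (p.MT * sin (alpha q) * alpha v + p.m * sin (beta q) * beta v) / errorFactor p q] := by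
  have h := isUnit_det_errorInertia p q
  have h0 := (errorFactor_pos p q).ne'
  have hl := p.l_pos.ne'
  have hr := p.r_pos.ne'
  have hinv : (errorInertia p q)⁻¹
      = !![(p.l ^ 2 * errorFactor p q)⁻¹, 0; 0, (p.r ^ 2 * errorFactor p q)⁻¹] := by
    refine inv_eq_left_inv ?_
    ext i j
    fin_cases i <;> fin_cases j <;> simp [errorInertia, Matrix.mul_apply] <;> field_simp
  rw [errorConnection, hinv]
  ext i j
  fin_cases i <;> fin_cases j <;> simp [Matrix.mul_apply] <;> field_simp

end Biped

/-! ### Comparison estimates for the slow variables and the tube -/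

/-- The difference `f - B` is antitone. The derivative of `f` is asked for only in the open interval
because curves of a swing phase are merely continuous at its ends. -/
theorem sub_le_sub_of_hasDerivAt_le {f B B' : ℝ → ℝ} {T : ℝ} (hf : ContinuousOn f (Icc 0 T))
    (hB : ∀ t, HasDerivAt B (B' t) t)
    (hf' : ∀ t ∈ Ioo 0 T, ∃ f', HasDerivAt f f' t ∧ f' ≤ B' t) {t : ℝ} (ht : t ∈ Icc 0 T) :
    f t - f 0 ≤ B t - B 0 := by
  have hBc : Continuous B := continuous_iff_continuousAt.2 fun t => (hB t).continuousAt
  have hanti : AntitoneOn (fun t => f t - B t) (Icc 0 T) := by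
    refine antitoneOn_of_deriv_nonpos (convex_Icc 0 T) (hf.sub hBc.continuousOn) ?_ ?_
    · rw [interior_Icc]
      intro t ht
      obtain ⟨f', h, -⟩ := hf' t ht
      exact (h.sub (hB t)).differentiableAt.differentiableWithinAt
    · rw [interior_Icc]
      intro t ht
      obtain ⟨f', h, hle⟩ := hf' t ht
      have : deriv (fun t => f t - B t) t = f' - B' t := (h.sub (hB t)).deriv
      linarith
  have := hanti (left_mem_Icc.2 (ht.1.trans ht.2)) ht ht.1
  simp only at this
  linarith

/-- Grönwall's argument: (Q - b/a) exp(at) does not increase. -/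
theorem le_mul_exp_add_of_hasDerivAt_le {Q : ℝ → ℝ} {a b T : ℝ} (ha : 0 < a)
    (hQ : ContinuousOn Q (Icc 0 T)) (hb : 0 ≤ b)
    (hQ' : ∀ t ∈ Ioo 0 T, ∃ Q', HasDerivAt Q Q' t ∧ Q' ≤ -a * Q t + b) {t : ℝ}
    (ht : t ∈ Icc 0 T) : Q t ≤ Q 0 * exp (-(a * t)) + b / a := by
  have hE : ∀ t, HasDerivAt (fun t => exp (a * t)) (exp (a * t) * a) t := fun t => by
    simpa using ((hasDerivAt_id t).const_mul a).exp
  have hEc : Continuous fun t => exp (a * t) := by fun_prop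
  have h := sub_le_sub_of_hasDerivAt_le (f := fun t => (Q t - b / a) * exp (a * t))
    (B := fun _ => (0 : ℝ)) (B' := fun _ => 0) (T := T)
    ((hQ.sub continuousOn_const).mul hEc.continuousOn)
    (fun t => hasDerivAt_const t 0)
    (fun t ht => by
      obtain ⟨Q', h, hle⟩ := hQ' t ht
      refine ⟨_, (h.sub_const (b / a)).mul (hE t), ?_⟩
      have h1 : Q' * exp (a * t) + (Q t - b / a) * (exp (a * t) * a)
          = (Q' + a * Q t - b) * exp (a * t) := by
        field_simp
        ring
      rw [h1]
      exact mul_nonpos_of_nonpos_of_nonneg (by linarith) (exp_pos _).le) ht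
  simp only [mul_zero, exp_zero, mul_one, sub_self, sub_nonpos] at h
  have h2 : (Q t - b / a) * exp (a * t) * exp (-(a * t)) ≤ (Q 0 - b / a) * exp (-(a * t)) :=
    mul_le_mul_of_nonneg_right h (exp_pos _).le
  rw [mul_assoc, ← exp_add, add_neg_cancel, exp_zero, mul_one] at h2
  have h3 : 0 ≤ b / a * exp (-(a * t)) := by positivity
  linarith

theorem sqrt_le_add_of_le_sq_add_sq {Q a b : ℝ} (ha : 0 ≤ a) (hb : 0 ≤ b)
    (h : Q ≤ a ^ 2 + b ^ 2) : √Q ≤ a + b := by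
  refine Real.sqrt_le_iff.2 ⟨by positivity, ?_⟩
  nlinarith [mul_nonneg ha hb]

/-- Estimates of a one degree of freedom system, with position `x`, momentum `s` and
potential `-H`, perturbed by a fast exponentially stable transversal dynamics of size `√Q`, as long
as they stay in the tube `xlo ≤ x`, `Q ≤ (R k θ)²`, `slo ≤ s ≤ shi`. -/
theorem tube_estimates {k θ μ C R W T Tm xlo xhi slo shi vlo vhi : ℝ} {x s Q H : ℝ → ℝ}
    (hk : 0 < k) (hkθ : 1 ≤ k * θ) (hμ : 0 < μ) (hC : 0 ≤ C) (hR : 0 < R)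
    (hW : W = C * (R / (2 * μ) + √(C / (2 * μ)) * Tm))
    (hTm : T ≤ Tm)
    (hx : ContinuousOn x (Icc 0 T)) (hs : ContinuousOn s (Icc 0 T)) (hQ : ContinuousOn Q (Icc 0 T))
    (hH : Continuous H) (hQ0 : Q 0 ≤ (R / 2 * (k * θ)) ^ 2)
    (hderiv : ∀ t ∈ Ioo 0 T, xlo ≤ x t → x t ≤ xhi → Q t ≤ (R * (k * θ)) ^ 2 → slo ≤ s t →
      s t ≤ shi → ∃ x' E' Q', HasDerivAt x x' t ∧ HasDerivAt (fun t => s t ^ 2 / 2 - H (x t)) E' t ∧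
        HasDerivAt Q Q' t ∧ Q' ≤ -(2 * μ * k) * Q t + C / k ∧ |E'| ≤ C * √(Q t) ∧
        vlo - C * √(Q t) ≤ x' ∧ x' ≤ vhi + C * √(Q t))
    (htube : ∀ t ∈ Icc 0 T, xlo ≤ x t ∧ x t ≤ xhi ∧ Q t ≤ (R * (k * θ)) ^ 2 ∧ slo ≤ s t ∧ s t ≤ shi)
    {t : ℝ} (ht : t ∈ Icc 0 T) :
    √(Q t) ≤ R / 2 * (k * θ) * exp (-(μ * k * t)) + √(C / (2 * μ)) / k ∧
    Q t ≤ (R / 2 * (k * θ)) ^ 2 + C / (2 * μ) / k ^ 2 ∧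
    |s t ^ 2 / 2 - H (x t) - (s 0 ^ 2 / 2 - H (x 0))| ≤ W * θ ∧
    x 0 + vlo * t - W * θ ≤ x t ∧ x t ≤ x 0 + vhi * t + W * θ := by
  have hθ : 0 < θ := pos_of_mul_pos_right (lt_of_lt_of_le one_pos hkθ) hk.le
  have hd := fun t (ht : t ∈ Ioo 0 T) =>
    let h := htube t (Ioo_subset_Icc_self ht)
    hderiv t ht h.1 h.2.1 h.2.2.1 h.2.2.2.1 h.2.2.2.2
  have hQexp : ∀ t ∈ Icc 0 T,
      Q t ≤ (R / 2 * (k * θ)) ^ 2 * exp (-(2 * μ * k * t)) + C / (2 * μ) / k ^ 2 := by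
    intro t ht
    have h := le_mul_exp_add_of_hasDerivAt_le (Q := Q) (a := 2 * μ * k) (b := C / k)
      (by positivity) hQ (by positivity) (fun t ht => by
        obtain ⟨x', E', Q', -, -, h, h1, -⟩ := hd t ht
        exact ⟨Q', h, h1⟩) ht
    have h1 : C / k / (2 * μ * k) = C / (2 * μ) / k ^ 2 := by field_simp
    rw [h1] at h
    refine h.trans ?_
    gcongr
  have hsqrt : ∀ t ∈ Icc 0 T,
      √(Q t) ≤ R / 2 * (k * θ) * exp (-(μ * k * t)) + √(C / (2 * μ)) / k := by
    intro t ht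
    refine sqrt_le_add_of_le_sq_add_sq (by positivity) (by positivity) ?_
    refine (hQexp t ht).trans (le_of_eq ?_)
    rw [mul_pow _ (exp _), ← exp_nat_mul, div_pow, Real.sq_sqrt (by positivity)]
    congr 3
    push_cast
    ring
  set b := √(C / (2 * μ)) with hb
  have hb0 : 0 ≤ b := Real.sqrt_nonneg _
  -- an antiderivative of the bound of `√Q`
  have hB : ∀ (v : ℝ) (t : ℝ), HasDerivAt
      (fun t => v * t + C * (-(R / (2 * μ) * θ) * exp (-(μ * k * t)) + b / k * t))
      (v + C * (R / 2 * (k * θ) * exp (-(μ * k * t)) + b / k)) t := by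
    intro v t
    have h1 : HasDerivAt (fun t => exp (-(μ * k * t))) (exp (-(μ * k * t)) * -(μ * k)) t := by
      simpa using (((hasDerivAt_id t).const_mul (μ * k)).neg).exp
    have h2 := ((hasDerivAt_id t).const_mul v).add
      (((h1.const_mul (-(R / (2 * μ) * θ))).add ((hasDerivAt_id t).const_mul (b / k))).const_mul C)
    refine h2.congr_deriv ?_
    field_simp
  -- Integration turns the peak kθ with decay rate μk into θ/μ, and the steady part b/k is absorbed
  -- by 1/k ≤ θ. Hence `W` does not depend on k.
  have hBle : ∀ v, ∀ t ∈ Icc 0 T,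
      v * t + C * (-(R / (2 * μ) * θ) * exp (-(μ * k * t)) + b / k * t)
        - (v * 0 + C * (-(R / (2 * μ) * θ) * exp (-(μ * k * 0)) + b / k * 0))
        ≤ v * t + W * θ := by
    intro v t ht
    have h1 : 1 / k ≤ θ := by rw [div_le_iff₀ hk]; linarith
    have h2 : b / k * t ≤ b * Tm * θ := by
      have : b / k * t = b * t * (1 / k) := by ring
      rw [this]
      have hTm0 : 0 ≤ Tm := ht.1.trans (ht.2.trans hTm)
      exact mul_le_mul (mul_le_mul_of_nonneg_left (ht.2.trans hTm) hb0) h1 (by positivity)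
        (by positivity)
    have h3 : 0 ≤ R / (2 * μ) * θ * exp (-(μ * k * t)) := by positivity
    have h4 : C * (R / (2 * μ) * θ + b / k * t - R / (2 * μ) * θ * exp (-(μ * k * t)))
        ≤ C * (R / (2 * μ) * θ + b * Tm * θ) := mul_le_mul_of_nonneg_left (by linarith) hC
    simp only [mul_zero, neg_zero, exp_zero]
    rw [hW]
    linarith
  have hEc : ContinuousOn (fun t => s t ^ 2 / 2 - H (x t)) (Icc 0 T) :=
    ((hs.pow 2).div_const 2).sub (hH.comp_continuousOn hx)
  refine ⟨hsqrt t ht, ?_, ?_, ?_, ?_⟩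
  · refine (hQexp t ht).trans ?_
    have : exp (-(2 * μ * k * t)) ≤ 1 := by
      rw [exp_le_one_iff]
      have := ht.1
      have : 0 ≤ 2 * μ * k * t := by positivity
      linarith
    have h0 : 0 ≤ (R / 2 * (k * θ)) ^ 2 := by positivity
    nlinarith
  · have hup := sub_le_sub_of_hasDerivAt_le hEc (hB 0) (fun t ht => by
      obtain ⟨x', E', Q', -, h, -, -, h1, -⟩ := hd t ht
      refine ⟨E', h, ?_⟩
      have := mul_le_mul_of_nonneg_left (hsqrt t (Ioo_subset_Icc_self ht)) hC
      have := (abs_le.1 h1).2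
      linarith) ht
    have hlo := sub_le_sub_of_hasDerivAt_le hEc.neg (hB 0) (fun t ht => by
      obtain ⟨x', E', Q', -, h, -, -, h1, -⟩ := hd t ht
      refine ⟨-E', h.neg, ?_⟩
      have := mul_le_mul_of_nonneg_left (hsqrt t (Ioo_subset_Icc_self ht)) hC
      have := (abs_le.1 h1).1
      linarith) ht
    have := hBle 0 t ht
    simp only [Pi.neg_apply] at hlo
    rw [abs_le]
    constructor <;> linarith
  · have hlo := sub_le_sub_of_hasDerivAt_le hx.neg (hB (-vlo)) (fun t ht => by
      obtain ⟨x', E', Q', h, -, -, -, -, h1, -⟩ := hd t ht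
      refine ⟨-x', h.neg, ?_⟩
      have := mul_le_mul_of_nonneg_left (hsqrt t (Ioo_subset_Icc_self ht)) hC
      linarith) ht
    have := hBle (-vlo) t ht
    simp only [Pi.neg_apply] at hlo
    linarith
  · have hup := sub_le_sub_of_hasDerivAt_le hx (hB vhi) (fun t ht => by
      obtain ⟨x', E', Q', h, -, -, -, -, -, h1⟩ := hd t ht
      refine ⟨x', h, ?_⟩
      have := mul_le_mul_of_nonneg_left (hsqrt t (Ioo_subset_Icc_self ht)) hC
      linarith) ht
    have := hBle vhi t ht
    linarith

/-- The estimates of `tube_estimates` keep the system in the tube. -/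
theorem mem_tube {k θ μ C R W T Tm xlo xhi slo shi vlo vhi : ℝ} {x s Q H : ℝ → ℝ}
    (hk1 : 1 ≤ k) (hkθ : 1 ≤ k * θ) (hμ : 0 < μ) (hC : 0 ≤ C) (hR : 0 < R)
    (hRC : C / (2 * μ) ≤ R ^ 2 / 2) (hW : W = C * (R / (2 * μ) + √(C / (2 * μ)) * Tm))
    (hTm : T ≤ Tm) (hvlo : 0 ≤ vlo) (hslo : 0 < slo) (hshi : 0 < shi)
    (hx : ContinuousOn x (Icc 0 T)) (hs : ContinuousOn s (Icc 0 T)) (hQ : ContinuousOn Q (Icc 0 T))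
    (hH : Continuous H) (hQ0 : Q 0 ≤ (R / 2 * (k * θ)) ^ 2) (hs0 : slo ≤ s 0)
    (hxhi : ∀ t ∈ Icc 0 T, x t ≤ xhi)
    (henergy : ∀ y ∈ Icc xlo xhi, 2 * slo ^ 2 ≤ s 0 ^ 2 / 2 - H (x 0) + H y ∧
      s 0 ^ 2 / 2 - H (x 0) + H y ≤ shi ^ 2 / 4)
    (hsmall : W * θ ≤ slo ^ 2) (hx0 : xlo + W * θ < x 0)
    (hderiv : ∀ t ∈ Ioo 0 T, xlo ≤ x t → x t ≤ xhi → Q t ≤ (R * (k * θ)) ^ 2 → slo ≤ s t →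
      s t ≤ shi → ∃ x' E' Q', HasDerivAt x x' t ∧ HasDerivAt (fun t => s t ^ 2 / 2 - H (x t)) E' t ∧
        HasDerivAt Q Q' t ∧ Q' ≤ -(2 * μ * k) * Q t + C / k ∧ |E'| ≤ C * √(Q t) ∧
        vlo - C * √(Q t) ≤ x' ∧ x' ≤ vhi + C * √(Q t)) :
    ∀ t ∈ Icc 0 T, xlo ≤ x t ∧ x t ≤ xhi ∧ Q t ≤ (R * (k * θ)) ^ 2 ∧ slo ≤ s t ∧ s t ≤ shi := by
  have hk : 0 < k := one_pos.trans_le hk1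
  rcases lt_or_ge T 0 with hT | hT
  · intro t ht
    exact absurd (ht.1.trans ht.2) (not_le.2 hT)
  have hθ : 0 < θ := pos_of_mul_pos_right (lt_of_lt_of_le one_pos hkθ) hk.le
  have hW0 : 0 ≤ W * θ := by
    have := hT.trans hTm
    rw [hW]
    positivity
  -- Continuous induction along [0, T]: the estimates valid up to time t improve the closed
  -- conditions of the tube to strict ones, which persist a little longer. The bound x ≤ xhi is a
  -- hypothesis and needs no improvement.
  set S : Set (ℝ × ℝ × ℝ) := Ici xlo ×ˢ Iic ((R * (k * θ)) ^ 2) ×ˢ Icc slo shi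
  have hcont : ContinuousOn (fun t => (x t, Q t, s t)) (Icc 0 T) := hx.prodMk (hQ.prodMk hs)
  have hxt0 : x 0 ∈ Icc xlo xhi := ⟨by linarith, hxhi 0 (left_mem_Icc.2 hT)⟩
  have hmem : Icc 0 T ⊆ (fun t => (x t, Q t, s t)) ⁻¹' S := by
    refine IsClosed.Icc_subset_of_forall_mem_nhdsGT_of_Icc_subset ?_ ?_ ?_
    · rw [inter_comm]
      exact hcont.preimage_isClosed_of_isClosed isClosed_Icc
        (isClosed_Ici.prod (isClosed_Iic.prod isClosed_Icc))
    · refine ⟨by simp only [mem_Ici]; linarith, ?_, hs0, ?_⟩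
      · simp only [mem_Iic]
        refine hQ0.trans (pow_le_pow_left₀ (by positivity) ?_ 2)
        gcongr
        linarith
      · have := (henergy _ hxt0).2
        refine abs_le_of_sq_le_sq' ?_ hshi.le |>.2
        have : 0 ≤ shi ^ 2 := by positivity
        linarith
    · intro t ht hsub
      have htT : t ≤ T := ht.2.le
      have hIcc : Icc 0 t ⊆ Icc 0 T := Icc_subset_Icc_right htT
      have htube : ∀ r ∈ Icc 0 t, xlo ≤ x r ∧ x r ≤ xhi ∧ Q r ≤ (R * (k * θ)) ^ 2 ∧
          slo ≤ s r ∧ s r ≤ shi := fun r hr =>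
        ⟨(hsub hr).1, hxhi r (hIcc hr), (hsub hr).2.1, (hsub hr).2.2.1, (hsub hr).2.2.2⟩
      obtain ⟨-, h1, h2, h3, -⟩ := tube_estimates hk hkθ hμ hC hR hW (htT.trans hTm)
        (hx.mono hIcc) (hs.mono hIcc) (hQ.mono hIcc) hH hQ0
        (fun r hr => hderiv r ⟨hr.1, hr.2.trans_le htT⟩) htube (right_mem_Icc.2 ht.1)
      have htt := htube t (right_mem_Icc.2 ht.1)
      obtain ⟨h4, h5⟩ := henergy (x t) ⟨htt.1, htt.2.1⟩
      rw [abs_le] at h2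
      have hxs : xlo < x t := by
        have := mul_nonneg hvlo ht.1
        linarith
      have hQs : Q t < (R * (k * θ)) ^ 2 := by
        refine h1.trans_lt ?_
        -- The transient takes R²/4 and the steady part at most R²/2 of the available R², in units
        -- of (kθ)².
        have h6 : C / (2 * μ) / k ^ 2 ≤ R ^ 2 / 2 * (k * θ) ^ 2 := by
          have h7 : C / (2 * μ) / k ^ 2 ≤ C / (2 * μ) :=
            div_le_self (by positivity) (one_le_pow₀ hk1)
          have h8 : 1 ≤ (k * θ) ^ 2 := one_le_pow₀ hkθ
          have h9 : R ^ 2 / 2 ≤ R ^ 2 / 2 * (k * θ) ^ 2 := le_mul_of_one_le_right (by positivity) h8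
          linarith
        have : 0 < R ^ 2 * (k * θ) ^ 2 := by positivity
        rw [mul_pow] at h1
        linarith [mul_pow R (k * θ) 2, div_pow R 2 2]
      -- Up to the drift `W * θ ≤ slo ^ 2`, the kinetic term s²/2 lies between 2 slo² and shi²/4;
      -- the factors 2 and 1/4 leave room for that drift at either end.
      have hss : slo < s t := by
        refine lt_of_pow_lt_pow_left₀ 2 (hslo.le.trans htt.2.2.2.1) ?_
        have : 0 < slo ^ 2 := by positivity
        linarith
      have hss' : s t < shi := by
        refine lt_of_pow_lt_pow_left₀ 2 hshi.le ?_
        have : 0 < slo ^ 2 := by positivity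
        linarith
      have hmemS : Ioi xlo ×ˢ Iio ((R * (k * θ)) ^ 2) ×ˢ Ioo slo shi ∈ 𝓝 (x t, Q t, s t) :=
        (isOpen_Ioi.prod (isOpen_Iio.prod isOpen_Ioo)).mem_nhds ⟨hxs, hQs, hss, hss'⟩
      have hev := (hcont t ⟨ht.1, htT⟩).preimage_mem_nhdsWithin hmemS
      have hle : 𝓝[>] t ≤ 𝓝[Icc 0 T] t := by
        rw [← nhdsWithin_Ioc_eq_nhdsGT ht.2]
        exact nhdsWithin_mono _ fun r hr => ⟨ht.1.trans hr.1.le, hr.2⟩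
      filter_upwards [hle hev] with r hr
      exact ⟨mem_Ici.2 (mem_Ioi.1 hr.1).le, mem_Iic.2 (mem_Iio.1 hr.2.1).le, hr.2.2.1.le, hr.2.2.2.le⟩
  exact fun t ht => ⟨(hmem ht).1, hxhi t ht, (hmem ht).2.1, (hmem ht).2.2.1, (hmem ht).2.2.2⟩

/-! ### Smoothness of matrix operations -/

theorem contDiffAt_det {E n : Type*} [NormedAddCommGroup E] [NormedSpace ℝ E] [Fintype n]
    [DecidableEq n] {A : E → Matrix n n ℝ} {x : E}
    (hA : ∀ i j, ContDiffAt ℝ 1 (fun x => A x i j) x) : ContDiffAt ℝ 1 (fun x => (A x).det) x := by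
  simp only [Matrix.det_apply']
  exact ContDiffAt.sum fun σ _ => contDiffAt_const.mul (contDiffAt_prod fun i _ => hA _ _)

/-- Cramer's rule: the inverse is the adjugate divided by the determinant, and every entry of the
adjugate is itself a determinant. -/
theorem contDiffAt_matrix_inv_apply {E n : Type*} [NormedAddCommGroup E] [NormedSpace ℝ E]
    [Fintype n] [DecidableEq n] {A : E → Matrix n n ℝ} {x : E}
    (hA : ∀ i j, ContDiffAt ℝ 1 (fun x => A x i j) x) (hx : (A x).det ≠ 0) (i j : n) :
    ContDiffAt ℝ 1 (fun x => (A x)⁻¹ i j) x := by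
  simp only [Matrix.inv_def, Ring.inverse_eq_inv', Matrix.smul_apply, smul_eq_mul,
    Matrix.adjugate_apply]
  refine ((contDiffAt_det hA).inv hx).mul (contDiffAt_det fun k l => ?_)
  by_cases hk : k = j
  · subst hk
    simpa using contDiffAt_const
  · simpa [Matrix.updateRow_ne hk] using hA k l

theorem contDiffAt_matrix_mul_apply {E l m n : Type*} [NormedAddCommGroup E] [NormedSpace ℝ E]
    [Fintype m] {A : E → Matrix l m ℝ} {B : E → Matrix m n ℝ} {x : E}
    (hA : ∀ i j, ContDiffAt ℝ 1 (fun x => A x i j) x)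
    (hB : ∀ i j, ContDiffAt ℝ 1 (fun x => B x i j) x) (i : l) (j : n) :
    ContDiffAt ℝ 1 (fun x => (A x * B x) i j) x := by
  simp only [Matrix.mul_apply]
  exact ContDiffAt.sum fun k _ => (hA i k).mul (hB k j)

theorem contDiffAt_mulVec_apply {E m n : Type*} [NormedAddCommGroup E] [NormedSpace ℝ E]
    [Fintype n] {A : E → Matrix m n ℝ} {y : E → n → ℝ} {x : E}
    (hA : ∀ i j, ContDiffAt ℝ 1 (fun x => A x i j) x)
    (hy : ∀ i, ContDiffAt ℝ 1 (fun x => y x i) x) (i : m) :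
    ContDiffAt ℝ 1 (fun x => (A x *ᵥ y x) i) x := by
  simp only [Matrix.mulVec, dotProduct]
  exact ContDiffAt.sum fun k _ => (hA i k).mul (hy k)

/-! ### The Lyapunov function of a high-gain PID loop -/

/-- A quadratic Lyapunov function of a PID controlled double integrator with gains `a k`, `2 k²`
and `c k³`. -/
noncomputable def pidEnergy (a k e o w : ℝ) : ℝ :=
  (a * k * e + o) ^ 2 / 2 + o ^ 2 / 2 + (k ^ 2 * w) ^ 2 + (a * k * e + o) * (k ^ 2 * w)

/-- With P = ake + o and z = k²w, the factor 6 leaves 2P² + 6Pz + 5z² + 2o², which is positive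
definite because 36 < 40. -/
theorem sq_add_sq_add_sq_le_pidEnergy (a k e o w : ℝ) :
    (a * k * e + o) ^ 2 + o ^ 2 + (k ^ 2 * w) ^ 2 ≤ 6 * pidEnergy a k e o w := by
  unfold pidEnergy
  nlinarith [sq_nonneg (3 * (k ^ 2 * w) + 2 * (a * k * e + o)), sq_nonneg (a * k * e + o),
    sq_nonneg o, sq_nonneg (k ^ 2 * w), sq_nonneg (4 * (k ^ 2 * w) + 3 * (a * k * e + o))]

theorem pidEnergy_le (a k e o w : ℝ) :
    pidEnergy a k e o w ≤ 2 * ((a * k * e + o) ^ 2 + o ^ 2 + (k ^ 2 * w) ^ 2) := by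
  unfold pidEnergy
  nlinarith [sq_nonneg (k ^ 2 * w - (a * k * e + o)), sq_nonneg (a * k * e + o),
    sq_nonneg o, sq_nonneg (k ^ 2 * w)]

theorem pidEnergy_nonneg (a k e o w : ℝ) : 0 ≤ pidEnergy a k e o w := by
  have := sq_add_sq_add_sq_le_pidEnergy a k e o w
  have : 0 ≤ (a * k * e + o) ^ 2 + o ^ 2 + (k ^ 2 * w) ^ 2 := by positivity
  linarith

theorem hasDerivAt_pidEnergy {a k : ℝ} {e o w : ℝ → ℝ} {e' o' w' t : ℝ} (he : HasDerivAt e e' t)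
    (ho : HasDerivAt o o' t) (hw : HasDerivAt w w' t) :
    HasDerivAt (fun t => pidEnergy a k (e t) (o t) (w t))
      ((a * k * e t + o t + k ^ 2 * w t) * (a * k * e' + o') + o t * o'
        + (2 * (k ^ 2 * w t) + (a * k * e t + o t)) * (k ^ 2 * w')) t := by
  have hP := (he.const_mul (a * k)).add ho
  have hz := hw.const_mul (k ^ 2)
  have h := ((((hP.pow 2).div_const 2).add ((ho.pow 2).div_const 2)).add (hz.pow 2)).add
    (hP.mul hz)
  refine h.congr_deriv ?_
  simp only [Pi.add_apply]
  ring

/-- Decay of `pidEnergy` along `ė = o`, `ȯ = f - a k o - 2 k² Λ e - c k³ w`, `ẇ = Λ e + g`. -/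
theorem pidEnergy_deriv_le {a c k lam0 lam1 L e o w f g : ℝ} (hk : 0 < k) (h0 : 0 < lam0)
    (hL0 : lam0 ≤ L) (hL1 : L ≤ lam1) (ha : a = 1 + 4 * lam1) (hc : c = lam0 / a) :
    (a * k * e + o + k ^ 2 * w) * (a * k * o + (f - a * k * o - 2 * k ^ 2 * (L * e) - c * k ^ 3 * w))
      + o * (f - a * k * o - 2 * k ^ 2 * (L * e) - c * k ^ 3 * w)
      + (2 * (k ^ 2 * w) + (a * k * e + o)) * (k ^ 2 * (L * e + g))
    ≤ -(k * (c / 4)) * ((a * k * e + o) ^ 2 + o ^ 2 + (k ^ 2 * w) ^ 2)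
      + (a * k * e + o + o + k ^ 2 * w) * f
      + (2 * (k ^ 2 * w) + (a * k * e + o)) * (k ^ 2 * g) := by
  have ha1 : 1 ≤ a := by linarith
  have ha0 : 0 < a := by linarith
  set P := a * k * e + o with hP
  set z := k ^ 2 * w with hz
  set M := L / a with hM
  have hMc : c ≤ M := by rw [hc, hM]; gcongr
  have hM1 : M ≤ lam1 := (div_le_self (by linarith) ha1).trans hL1
  have hc0 : 0 < c := by rw [hc]; positivity
  -- In the variables P, o, z every term of the unperturbed derivative carries one factor k, and the
  -- damping term has disappeared from the derivative of P.
  have hke : k ^ 2 * (L * e) = k * (M * (P - o)) := by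
    rw [hM, hP]
    field_simp
    ring
  have hkz : c * k ^ 3 * w = k * (c * z) := by rw [hz]; ring
  have hc4 : c ≤ 1 / 4 := by
    rw [hc, div_le_iff₀ ha0]
    linarith
  -- The squares of P + z, z + 2o and P + 2o absorb the three cross terms. The choice a = 1 + 4 lam1
  -- leaves enough damping for the o² they cost, and c = lam0 / a ensures c ≤ M for the P².
  have hmain : c / 4 * (P ^ 2 + o ^ 2 + z ^ 2)
      ≤ (a - 2 * M) * o ^ 2 + M * (o * P) + c * (o * z) + M * P ^ 2 + c * z ^ 2 + c * (P * z) := by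
    have h1 : 0 ≤ c / 2 * (P + z) ^ 2 := by positivity
    have h2 : 0 ≤ c / 4 * (z + 2 * o) ^ 2 := by positivity
    have hM0 : 0 < M := hc0.trans_le hMc
    have h3 : 0 ≤ M / 4 * (P + 2 * o) ^ 2 := by positivity
    have h4 : 0 ≤ (M - c) * P ^ 2 := mul_nonneg (by linarith) (sq_nonneg _)
    have h5 : 0 ≤ (a - 3 * M - c - c / 4) * o ^ 2 := mul_nonneg (by linarith) (sq_nonneg _)
    have h6 : 0 ≤ M * P ^ 2 := by positivity
    have h7 : 0 ≤ c * z ^ 2 := by positivity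
    linarith
  have := mul_le_mul_of_nonneg_left hmain hk.le
  have h2ke : 2 * k ^ 2 * (L * e) = 2 * (k * (M * (P - o))) := by rw [← hke]; ring
  rw [mul_add (k ^ 2), hke, hkz, h2ke]
  linarith

namespace Biped

variable (p : Params)

/-! ### Bounds of the coefficients -/

theorem exists_abs_gain_le : ∃ B, ∀ q, |gain p q| ≤ B := by
  have := p.MT_pos
  have := p.l_pos
  have := p.r_pos
  refine ⟨|(p.MH + p.MT + p.m) * p.r ^ 2| + p.MT * p.l * p.r, fun q => ?_⟩
  refine (abs_add_le _ _).trans (add_le_add_right ?_ _)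
  rw [abs_mul, abs_of_pos (by positivity : 0 < p.MT * p.l * p.r)]
  exact mul_le_of_le_one_right (by positivity) (abs_cos_le_one _)

theorem exists_abs_momentum_sub_le :
    ∃ B, ∀ q v, |momentum p q v - gain p q * v 0| ≤ B * (|v 2| + |v 0 + v 1|) := by
  have := p.MT_pos
  have := p.m_pos
  have := p.l_pos
  have := p.r_pos
  refine ⟨p.m * p.r ^ 2 + (p.MT * p.l * p.r + p.MT * p.l ^ 2), fun q v => ?_⟩
  have h1 := abs_cos_le_one (q 0 - q 1)
  have h2 := abs_cos_le_one (q 0 - q 2)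
  have h3 : |p.m * p.r ^ 2 / 4 - p.m * p.r ^ 2 / 2 * cos (q 0 - q 1)| ≤ p.m * p.r ^ 2 := by
    refine (abs_sub _ _).trans ?_
    rw [abs_mul, abs_of_pos (by positivity : 0 < p.m * p.r ^ 2 / 4),
      abs_of_pos (by positivity : 0 < p.m * p.r ^ 2 / 2)]
    have := mul_le_of_le_one_right (by positivity : 0 ≤ p.m * p.r ^ 2 / 2) h1
    have : 0 < p.m * p.r ^ 2 := by positivity
    linarith
  have h4 : |p.MT * p.l * p.r * cos (q 0 - q 2) + p.MT * p.l ^ 2|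
      ≤ p.MT * p.l * p.r + p.MT * p.l ^ 2 := by
    refine (abs_add_le _ _).trans ?_
    rw [abs_mul, abs_of_pos (by positivity : 0 < p.MT * p.l * p.r),
      abs_of_pos (by positivity : 0 < p.MT * p.l ^ 2)]
    have := mul_le_of_le_one_right (by positivity : 0 ≤ p.MT * p.l * p.r) h2
    linarith
  have h5 : momentum p q v - gain p q * v 0
      = (p.m * p.r ^ 2 / 4 - p.m * p.r ^ 2 / 2 * cos (q 0 - q 1)) * (v 0 + v 1)
        + (p.MT * p.l * p.r * cos (q 0 - q 2) + p.MT * p.l ^ 2) * v 2 := by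
    rw [momentum_eq]
    ring
  rw [h5]
  refine (abs_add_le _ _).trans ?_
  rw [abs_mul, abs_mul]
  have h6 := mul_le_mul_of_nonneg_right h3 (abs_nonneg (v 0 + v 1))
  have h7 := mul_le_mul_of_nonneg_right h4 (abs_nonneg (v 2))
  have h8 : 0 ≤ p.m * p.r ^ 2 * |v 2| := by positivity
  have h9 : 0 ≤ (p.MT * p.l * p.r + p.MT * p.l ^ 2) * |v 0 + v 1| := by positivity
  linarith

theorem gravityMoment_eq (q : Fin 3 → ℝ) :
    gravityMoment p q = p.g * p.r * (2 * p.MH + 2 * p.MT + 3 * p.m) / 2 * sin (q 0 - p.lam)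
      + -(p.g * p.m * p.r / 2) * sin (q 1 - p.lam) + p.MT * p.g * p.l * sin (q 2 - p.lam) := by
  simp only [gravityMoment, gravity, Fin.sum_univ_three, Matrix.cons_val]
  ring

theorem abs_mul_sin_le (a x : ℝ) : |a * sin x| ≤ |a| := by
  rw [abs_mul]
  exact mul_le_of_le_one_right (abs_nonneg _) (abs_sin_le_one _)

theorem exists_abs_gravityMoment_le : ∃ B, ∀ q, |gravityMoment p q| ≤ B := by
  refine ⟨|p.g * p.r * (2 * p.MH + 2 * p.MT + 3 * p.m) / 2| + |-(p.g * p.m * p.r / 2)|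
    + |p.MT * p.g * p.l|, fun q => ?_⟩
  rw [gravityMoment_eq]
  exact (abs_add_three _ _ _).trans
    (add_le_add (add_le_add (abs_mul_sin_le _ _) (abs_mul_sin_le _ _)) (abs_mul_sin_le _ _))

theorem exists_abs_gain_sub_le :
    ∃ B, ∀ q, |gain p q - gain p (zeroConfig p (q 0))| ≤ B * (|q 2 - p.q3ref| + |q 0 + q 1|) := by
  refine ⟨|p.MT * p.l * p.r|, fun q => ?_⟩
  have h : gain p q - gain p (zeroConfig p (q 0))
      = p.MT * p.l * p.r * (cos (q 0 - q 2) - cos (q 0 - p.q3ref)) := by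
    simp only [gain, zeroConfig, Matrix.cons_val]
    ring
  rw [h, abs_mul]
  refine mul_le_mul_of_nonneg_left ((abs_cos_sub_cos_le _ _).trans ?_) (abs_nonneg _)
  have h2 : q 0 - q 2 - (q 0 - p.q3ref) = -(q 2 - p.q3ref) := by ring
  rw [h2, abs_neg]
  exact le_add_of_nonneg_right (abs_nonneg _)

theorem exists_abs_gravityMoment_sub_le :
    ∃ B, ∀ q, |gravityMoment p q - gravityMoment p (zeroConfig p (q 0))|
      ≤ B * (|q 2 - p.q3ref| + |q 0 + q 1|) := by
  refine ⟨|-(p.g * p.m * p.r / 2)| + |p.MT * p.g * p.l|, fun q => ?_⟩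
  have h : gravityMoment p q - gravityMoment p (zeroConfig p (q 0))
      = -(p.g * p.m * p.r / 2) * (sin (q 1 - p.lam) - sin (-q 0 - p.lam))
        + p.MT * p.g * p.l * (sin (q 2 - p.lam) - sin (p.q3ref - p.lam)) := by
    simp only [gravityMoment_eq, zeroConfig, Matrix.cons_val]
    ring
  rw [h]
  refine (abs_add_le _ _).trans ?_
  rw [abs_mul, abs_mul]
  have h1 := abs_sin_sub_sin_le (q 1 - p.lam) (-q 0 - p.lam)
  have h2 := abs_sin_sub_sin_le (q 2 - p.lam) (p.q3ref - p.lam)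
  have h3 : q 1 - p.lam - (-q 0 - p.lam) = q 0 + q 1 := by ring
  have h4 : q 2 - p.lam - (p.q3ref - p.lam) = q 2 - p.q3ref := by ring
  rw [h3] at h1
  rw [h4] at h2
  have h5 := mul_le_mul_of_nonneg_left h1 (abs_nonneg (-(p.g * p.m * p.r / 2)))
  have h6 := mul_le_mul_of_nonneg_left h2 (abs_nonneg (p.MT * p.g * p.l))
  have h7 := mul_nonneg (abs_nonneg (-(p.g * p.m * p.r / 2))) (abs_nonneg (q 2 - p.q3ref))
  have h8 := mul_nonneg (abs_nonneg (p.MT * p.g * p.l)) (abs_nonneg (q 0 + q 1))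
  linarith

/-- Every entry of the error connection has this shape: sines times velocities over a multiple of D.
-/
theorem abs_lincomb_div_le {X Y a b x y d d₀ : ℝ} (hd₀ : 0 < d₀) (hd : d₀ ≤ d) :
    |(X * sin a * x + Y * sin b * y) / d| ≤ (|X| + |Y|) / d₀ * (|x| + |y|) := by
  rw [abs_div, abs_of_pos (hd₀.trans_le hd)]
  have h1 : |X * sin a * x + Y * sin b * y| ≤ (|X| + |Y|) * (|x| + |y|) := by
    refine (abs_add_le _ _).trans ?_
    rw [abs_mul (X * _), abs_mul (Y * _)]
    have h1 := mul_le_mul_of_nonneg_right (abs_mul_sin_le X a) (abs_nonneg x)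
    have h2 := mul_le_mul_of_nonneg_right (abs_mul_sin_le Y b) (abs_nonneg y)
    have h3 := mul_nonneg (abs_nonneg X) (abs_nonneg y)
    have h4 := mul_nonneg (abs_nonneg Y) (abs_nonneg x)
    linarith
  rw [div_mul_eq_mul_div]
  exact div_le_div₀ (by positivity) h1 hd₀ hd

theorem exists_abs_errorConnection_le :
    ∃ B, ∀ q v i j, |errorConnection p q v i j| ≤ B * (|v 0| + |v 2| + |v 0 + v 1|) := by
  have hl := p.l_pos
  have hr := p.r_pos
  have hD0 : 0 < 4 * p.MH + p.m := by linarith [p.MH_pos, p.m_pos]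
  set D := 4 * p.MH + p.m with hD
  refine ⟨((|p.MT| + |p.m|) / D + (|p.m * p.l ^ 2| + |p.MT * p.r ^ 2|) / (p.l ^ 2 * D)
    + (|p.m * p.l ^ 2| + |p.MT * p.r ^ 2|) / (p.r ^ 2 * D)) * 6, fun q v i j => ?_⟩
  have hf : D ≤ errorFactor p q := le_errorFactor p q
  have hab : |alpha v| + |beta v| ≤ 6 * (|v 0| + |v 2| + |v 0 + v 1|) := by
    have h1 : |alpha v| ≤ 2 * (|v 0| + |v 2|) := by
      rw [alpha, abs_mul, abs_two]
      exact mul_le_mul_of_nonneg_left (abs_sub _ _) zero_le_two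
    have h2 : |beta v| ≤ 4 * |v 0| + 2 * |v 0 + v 1| := by
      have : beta v = 4 * v 0 - 2 * (v 0 + v 1) := by rw [beta]; ring
      rw [this]
      refine (abs_sub _ _).trans ?_
      rw [abs_mul, abs_mul, abs_two]
      norm_num
    linarith [abs_nonneg (v 2), abs_nonneg (v 0 + v 1)]
  have hX : 0 ≤ (|p.MT| + |p.m|) / D := by positivity
  have hY : 0 ≤ (|p.m * p.l ^ 2| + |p.MT * p.r ^ 2|) / (p.l ^ 2 * D) := by positivity
  have hZ : 0 ≤ (|p.m * p.l ^ 2| + |p.MT * p.r ^ 2|) / (p.r ^ 2 * D) := by positivity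
  have key : |errorConnection p q v i j| ≤ ((|p.MT| + |p.m|) / D
      + (|p.m * p.l ^ 2| + |p.MT * p.r ^ 2|) / (p.l ^ 2 * D)
      + (|p.m * p.l ^ 2| + |p.MT * p.r ^ 2|) / (p.r ^ 2 * D)) * (|alpha v| + |beta v|) := by
    have hs : 0 ≤ |alpha v| + |beta v| := by positivity
    rw [errorConnection_eq]
    fin_cases i <;> fin_cases j <;> simp only [Fin.zero_eta, Fin.mk_one, Matrix.of_apply,
      Matrix.cons_val', Matrix.cons_val_zero, Matrix.cons_val_one, Matrix.cons_val_fin_one]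
    · exact (abs_lincomb_div_le hD0 hf).trans (mul_le_mul_of_nonneg_right (by linarith) hs)
    · have := abs_lincomb_div_le (X := p.m * p.l ^ 2) (Y := -(p.MT * p.r ^ 2)) (a := beta q)
        (b := alpha q) (x := alpha v) (y := beta v) (by positivity : 0 < p.l ^ 2 * D)
        (mul_le_mul_of_nonneg_left hf (by positivity))
      rw [abs_neg] at this
      refine (le_of_eq ?_).trans (this.trans (mul_le_mul_of_nonneg_right (by linarith) hs))
      congr 2
      ring
    · have := abs_lincomb_div_le (X := -(p.m * p.l ^ 2)) (Y := p.MT * p.r ^ 2) (a := beta q)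
        (b := alpha q) (x := alpha v) (y := beta v) (by positivity : 0 < p.r ^ 2 * D)
        (mul_le_mul_of_nonneg_left hf (by positivity))
      rw [abs_neg] at this
      refine (le_of_eq ?_).trans (this.trans (mul_le_mul_of_nonneg_right (by linarith) hs))
      congr 2
      ring
    · exact (abs_lincomb_div_le hD0 hf).trans (mul_le_mul_of_nonneg_right (by linarith) hs)
  refine key.trans ?_
  rw [mul_assoc]
  exact mul_le_mul_of_nonneg_left hab (by positivity)

/-! ### Smoothness -/

section Smooth

variable {E : Type*} [NormedAddCommGroup E] [NormedSpace ℝ E] {q v : E → Fin 3 → ℝ}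
  {w : E → Fin 2 → ℝ} {x : E}

theorem contDiffAt_inertia (hq : ∀ i, ContDiffAt ℝ 1 (fun x => q x i) x) (i j : Fin 3) :
    ContDiffAt ℝ 1 (fun x => inertia p (q x) i j) x := by
  have h0 := hq 0
  have h1 := hq 1
  have h2 := hq 2
  fin_cases i <;> fin_cases j <;> simp [inertia] <;> fun_prop

theorem contDiffAt_connection (hq : ∀ i, ContDiffAt ℝ 1 (fun x => q x i) x)
    (hv : ∀ i, ContDiffAt ℝ 1 (fun x => v x i) x) (i j : Fin 3) :
    ContDiffAt ℝ 1 (fun x => connection p (q x) (v x) i j) x := by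
  have h0 := hq 0
  have h1 := hq 1
  have h2 := hq 2
  have h0' := hv 0
  have h1' := hv 1
  have h2' := hv 2
  fin_cases i <;> fin_cases j <;> simp [connection] <;> fun_prop

theorem contDiffAt_gravity (a : ℝ) (hq : ∀ i, ContDiffAt ℝ 1 (fun x => q x i) x) (i : Fin 3) :
    ContDiffAt ℝ 1 (fun x => gravity p a (q x) i) x := by
  have h0 := hq 0
  have h1 := hq 1
  have h2 := hq 2
  fin_cases i <;> simp [gravity] <;> fun_prop

theorem contDiffAt_errorFactor (hq : ∀ i, ContDiffAt ℝ 1 (fun x => q x i) x) :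
    ContDiffAt ℝ 1 (fun x => errorFactor p (q x)) x := by
  have h0 := hq 0
  have h1 := hq 1
  have h2 := hq 2
  simp only [errorFactor, alpha, beta]
  fun_prop

theorem contDiffAt_errorInertia (hq : ∀ i, ContDiffAt ℝ 1 (fun x => q x i) x) (i j : Fin 2) :
    ContDiffAt ℝ 1 (fun x => errorInertia p (q x) i j) x := by
  have h := contDiffAt_errorFactor p hq
  fin_cases i <;> fin_cases j <;> simp [errorInertia] <;> fun_prop

theorem contDiffAt_errorConnection (hq : ∀ i, ContDiffAt ℝ 1 (fun x => q x i) x)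
    (hv : ∀ i, ContDiffAt ℝ 1 (fun x => v x i) x) (i j : Fin 2) :
    ContDiffAt ℝ 1 (fun x => errorConnection p (q x) (v x) i j) x := by
  refine contDiffAt_matrix_mul_apply (contDiffAt_matrix_inv_apply (contDiffAt_errorInertia p hq)
    (isUnit_det_errorInertia p (q x)).ne_zero) (fun i j => ?_) i j
  have h0 := hq 0
  have h1 := hq 1
  have h2 := hq 2
  have h0' := hv 0
  have h1' := hv 1
  have h2' := hv 2
  fin_cases i <;> fin_cases j <;> simp [alpha, beta] <;> fun_prop

theorem contDiffAt_eta (hq : ∀ i, ContDiffAt ℝ 1 (fun x => q x i) x) (i : Fin 2) :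
    ContDiffAt ℝ 1 (fun x => eta p (q x) i) x := by
  refine contDiffAt_mulVec_apply (contDiffAt_matrix_inv_apply (contDiffAt_errorInertia p hq)
    (isUnit_det_errorInertia p (q x)).ne_zero) (fun i => ?_) i
  have h0 := hq 0
  have h1 := hq 1
  have h2 := hq 2
  fin_cases i <;> simp <;> fun_prop

theorem contDiffAt_inertia_inv (hq : ∀ i, ContDiffAt ℝ 1 (fun x => q x i) x) (i j : Fin 3) :
    ContDiffAt ℝ 1 (fun x => (inertia p (q x))⁻¹ i j) x :=
  contDiffAt_matrix_inv_apply (contDiffAt_inertia p hq) (isUnit_det_inertia p (q x)).ne_zero i j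

theorem contDiffAt_forceToError (hq : ∀ i, ContDiffAt ℝ 1 (fun x => q x i) x) (i : Fin 2)
    (j : Fin 3) : ContDiffAt ℝ 1 (fun x => forceToError p (q x) i j) x :=
  contDiffAt_matrix_mul_apply (A := fun x => errorInertia p (q x) * outputJacobian)
    (B := fun x => (inertia p (q x))⁻¹)
    (contDiffAt_matrix_mul_apply (A := fun x => errorInertia p (q x))
      (B := fun _ => outputJacobian) (contDiffAt_errorInertia p hq) fun _ _ => contDiffAt_const)
    (contDiffAt_inertia_inv p hq) i j

theorem contDiffAt_omegaE (hv : ∀ i, ContDiffAt ℝ 1 (fun x => v x i) x) (i : Fin 2) :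
    ContDiffAt ℝ 1 (fun x => omegaE (v x) i) x :=
  contDiffAt_mulVec_apply (A := fun _ => outputJacobian) (fun _ _ => contDiffAt_const) hv i

theorem contDiffAt_control (K : Gains) (lamC : ℝ) (hq : ∀ i, ContDiffAt ℝ 1 (fun x => q x i) x)
    (hv : ∀ i, ContDiffAt ℝ 1 (fun x => v x i) x) (hw : ∀ i, ContDiffAt ℝ 1 (fun x => w x i) x)
    (hx : gain p (q x) ≠ 0) (i : Fin 2) :
    ContDiffAt ℝ 1 (fun x => control p K lamC (q x) (v x) (w x) i) x := by
  have hB : ∀ i j, ContDiffAt ℝ 1 (fun x => errorInput p (q x) i j) x :=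
    contDiffAt_matrix_mul_apply (A := fun x => forceToError p (q x)) (B := fun _ => inputMatrix)
      (contDiffAt_forceToError p hq) fun _ _ => contDiffAt_const
  have h1 : ∀ i, ContDiffAt ℝ 1 (fun x => errorVelocityForce p (q x) (v x) i) x :=
    contDiffAt_mulVec_apply (A := fun x => forceToError p (q x))
      (y := fun x => connection p (q x) (v x) *ᵥ v x) (contDiffAt_forceToError p hq)
      (contDiffAt_mulVec_apply (contDiffAt_connection p hq hv) hv)
  have h2 : ∀ i, ContDiffAt ℝ 1 (fun x => errorGravity p lamC (q x) i) x := fun i =>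
    (contDiffAt_mulVec_apply (contDiffAt_forceToError p hq) (contDiffAt_gravity p lamC hq) i).neg
  have h3 : ∀ i, ContDiffAt ℝ 1 (fun x => (errorInertia p (q x) *ᵥ
      (errorConnection p (q x) (v x) *ᵥ omegaE (v x))) i) x :=
    contDiffAt_mulVec_apply (contDiffAt_errorInertia p hq)
      (contDiffAt_mulVec_apply (contDiffAt_errorConnection p hq hv) (contDiffAt_omegaE hv))
  have h4 : ∀ i, ContDiffAt ℝ 1 (fun x => (errorInertia p (q x) *ᵥ
      (K.kp • eta p (q x) + K.kd • omegaE (v x) + K.kI • w x)) i) x :=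
    contDiffAt_mulVec_apply (contDiffAt_errorInertia p hq) fun i =>
      ((contDiffAt_const.mul (contDiffAt_eta p hq i)).add
        (contDiffAt_const.mul (contDiffAt_omegaE hv i))).add (contDiffAt_const.mul (hw i))
  exact contDiffAt_mulVec_apply (A := fun x => (errorInput p (q x))⁻¹)
    (y := fun x => errorVelocityForce p (q x) (v x) + errorGravity p lamC (q x)
      - errorInertia p (q x) *ᵥ (errorConnection p (q x) (v x) *ᵥ omegaE (v x))
      - errorInertia p (q x) *ᵥ (K.kp • eta p (q x) + K.kd • omegaE (v x) + K.kI • w x))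
    (contDiffAt_matrix_inv_apply hB ((det_errorInput_ne_zero_iff p (q x)).2 hx))
    (fun i => (((h1 i).add (h2 i)).sub (h3 i)).sub (h4 i)) i

theorem contDiffAt_swingAcc {u : E → Fin 2 → ℝ} (hq : ∀ i, ContDiffAt ℝ 1 (fun x => q x i) x)
    (hv : ∀ i, ContDiffAt ℝ 1 (fun x => v x i) x) (hu : ∀ i, ContDiffAt ℝ 1 (fun x => u x i) x)
    (i : Fin 3) : ContDiffAt ℝ 1 (fun x => swingAcc p (q x) (v x) (u x) i) x := by
  have h1 : ∀ i, ContDiffAt ℝ 1 (fun x => (connection p (q x) (v x) *ᵥ v x) i) x :=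
    contDiffAt_mulVec_apply (contDiffAt_connection p hq hv) hv
  have h2 : ∀ i, ContDiffAt ℝ 1 (fun x => (inputMatrix *ᵥ u x) i) x :=
    contDiffAt_mulVec_apply (A := fun _ => inputMatrix) (fun _ _ => contDiffAt_const) hu
  exact contDiffAt_mulVec_apply (A := fun x => (inertia p (q x))⁻¹)
    (y := fun x => gravity p p.lam (q x) - connection p (q x) (v x) *ᵥ v x + inputMatrix *ᵥ u x)
    (contDiffAt_inertia_inv p hq)
    (fun i => ((contDiffAt_gravity p p.lam hq i).sub (h1 i)).add (h2 i)) i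

theorem contDiffAt_integralRate (hq : ∀ i, ContDiffAt ℝ 1 (fun x => q x i) x)
    (hv : ∀ i, ContDiffAt ℝ 1 (fun x => v x i) x) (hw : ∀ i, ContDiffAt ℝ 1 (fun x => w x i) x)
    (i : Fin 2) : ContDiffAt ℝ 1 (fun x => integralRate p (q x) (v x) (w x) i) x :=
  (contDiffAt_eta p hq i).sub
    (contDiffAt_mulVec_apply (contDiffAt_errorConnection p hq hv) hw i)

theorem contDiffAt_disturbance (lamC : ℝ) (hq : ∀ i, ContDiffAt ℝ 1 (fun x => q x i) x)
    (i : Fin 2) : ContDiffAt ℝ 1 (fun x => disturbance p lamC (q x) i) x :=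
  contDiffAt_mulVec_apply (A := fun _ => outputJacobian)
    (y := fun x => (inertia p (q x))⁻¹ *ᵥ (gravity p p.lam (q x) - gravity p lamC (q x)))
    (fun _ _ => contDiffAt_const)
    (contDiffAt_mulVec_apply (A := fun x => (inertia p (q x))⁻¹)
      (y := fun x => gravity p p.lam (q x) - gravity p lamC (q x)) (contDiffAt_inertia_inv p hq)
      fun i => (contDiffAt_gravity p p.lam hq i).sub (contDiffAt_gravity p lamC hq i)) i

end Smooth

/-- The vector field of the closed loop during the swing phase. -/
noncomputable def closedLoop (K : Gains) (lamC : ℝ)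
    (x : (Fin 3 → ℝ) × (Fin 3 → ℝ) × (Fin 2 → ℝ)) : (Fin 3 → ℝ) × (Fin 3 → ℝ) × (Fin 2 → ℝ) :=
  (x.2.1, swingAcc p x.1 x.2.1 (control p K lamC x.1 x.2.1 x.2.2),
    integralRate p x.1 x.2.1 x.2.2)

theorem continuous_gain : Continuous (gain p) := by
  unfold gain
  fun_prop

/-- All inertia tensors are invertible everywhere; only the inverse of B_e restricts the domain, to
the configurations with nonzero `gain`. -/
theorem contDiffOn_closedLoop (K : Gains) (lamC : ℝ) :
    ContDiffOn ℝ 1 (closedLoop p K lamC) {x | gain p x.1 ≠ 0} := by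
  intro x hx
  have hq : ∀ i, ContDiffAt ℝ 1
      (fun x : (Fin 3 → ℝ) × (Fin 3 → ℝ) × (Fin 2 → ℝ) => x.1 i) x := fun i => by fun_prop
  have hv : ∀ i, ContDiffAt ℝ 1
      (fun x : (Fin 3 → ℝ) × (Fin 3 → ℝ) × (Fin 2 → ℝ) => x.2.1 i) x := fun i => by fun_prop
  have hw : ∀ i, ContDiffAt ℝ 1
      (fun x : (Fin 3 → ℝ) × (Fin 3 → ℝ) × (Fin 2 → ℝ) => x.2.2 i) x := fun i => by fun_prop
  refine ContDiffAt.contDiffWithinAt ?_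
  refine (contDiffAt_pi.2 hv).prodMk ((contDiffAt_pi.2 ?_).prodMk (contDiffAt_pi.2 ?_))
  · exact contDiffAt_swingAcc p hq hv (contDiffAt_control p K lamC hq hv hw hx)
  · exact contDiffAt_integralRate p hq hv hw

/-- The disturbance contains the inverse inertia, so continuity on a compact cube takes the place of
an explicit bound. -/
theorem exists_abs_disturbance_le (lamC ρ : ℝ) :
    ∃ B, ∀ q : Fin 3 → ℝ, (∀ i, |q i| ≤ ρ) → ∀ i, |disturbance p lamC q i| ≤ B := by
  have hc : Continuous (disturbance p lamC) :=
    continuous_pi fun i => continuous_iff_continuousAt.2 fun q =>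
      (contDiffAt_disturbance p lamC (q := fun q => q) (fun i => by fun_prop) i).continuousAt
  obtain ⟨B, hB⟩ := (isCompact_univ_pi fun _ : Fin 3 => isCompact_Icc (a := -ρ)
    (b := ρ)).exists_bound_of_continuousOn hc.continuousOn
  refine ⟨B, fun q hq i => ?_⟩
  exact (norm_le_pi_norm (disturbance p lamC q) i).trans (hB q fun i _ => abs_le.1 (hq i))

/-- All the bounds of the model that the estimates use, with one constant. -/
structure ModelBound (lamC B : ℝ) : Prop where
  one_le : 1 ≤ B
  gain_le : ∀ q, |gain p q| ≤ B
  momentum_sub_le : ∀ q v, |momentum p q v - gain p q * v 0| ≤ B * (|v 2| + |v 0 + v 1|)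
  gravityMoment_le : ∀ q, |gravityMoment p q| ≤ B
  gain_sub_le : ∀ q, |gain p q - gain p (zeroConfig p (q 0))|
    ≤ B * (|q 2 - p.q3ref| + |q 0 + q 1|)
  power_sub_le : ∀ q, |gain p q * gravityMoment p q
    - gain p (zeroConfig p (q 0)) * gravityMoment p (zeroConfig p (q 0))|
    ≤ B * (|q 2 - p.q3ref| + |q 0 + q 1|)
  errorConnection_le : ∀ q v i j, |errorConnection p q v i j|
    ≤ B * (|v 0| + |v 2| + |v 0 + v 1|)
  disturbance_le : ∀ q : Fin 3 → ℝ, |q 0| ≤ p.q1ref + 1 → |q 2 - p.q3ref| ≤ 1 → |q 0 + q 1| ≤ 1 →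
    ∀ i, |disturbance p lamC q i| ≤ B

theorem exists_modelBound (lamC : ℝ) : ∃ B, ModelBound p lamC B := by
  obtain ⟨B1, h1⟩ := exists_abs_gain_le p
  obtain ⟨B2, h2⟩ := exists_abs_momentum_sub_le p
  obtain ⟨B3, h3⟩ := exists_abs_gravityMoment_le p
  obtain ⟨B4, h4⟩ := exists_abs_gain_sub_le p
  obtain ⟨B5, h5⟩ := exists_abs_gravityMoment_sub_le p
  obtain ⟨B6, h6⟩ := exists_abs_errorConnection_le p
  obtain ⟨B7, h7⟩ := exists_abs_disturbance_le p lamC (p.q1ref + |p.q3ref| + 2)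
  have h1' : ∀ q, |gain p q| ≤ |B1| := fun q => (h1 q).trans (le_abs_self _)
  have h3' : ∀ q, |gravityMoment p q| ≤ |B3| := fun q => (h3 q).trans (le_abs_self _)
  have hp : 0 ≤ |B1| * |B5| + |B3| * |B4| := by positivity
  have a1 := abs_nonneg B1
  have a2 := abs_nonneg B2
  have a3 := abs_nonneg B3
  have a4 := abs_nonneg B4
  have a5 := abs_nonneg B5
  have a6 := abs_nonneg B6
  have a7 := abs_nonneg B7
  have l2 := le_abs_self B2
  have l4 := le_abs_self B4
  have l5 := le_abs_self B5
  have l6 := le_abs_self B6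
  have l7 := le_abs_self B7
  set B := 1 + |B1| + |B2| + |B3| + |B4| + |B5| + |B6| + |B7| + (|B1| * |B5| + |B3| * |B4|)
  refine ⟨B, by linarith, fun q => (h1' q).trans (by linarith), fun q v => (h2 q v).trans ?_,
    fun q => (h3' q).trans (by linarith), fun q => (h4 q).trans ?_, fun q => ?_,
    fun q v i j => (h6 q v i j).trans ?_, fun q e0 e1 e2 i => (h7 q ?_ i).trans (by linarith)⟩
  · exact mul_le_mul_of_nonneg_right (by linarith) (by positivity)
  · exact mul_le_mul_of_nonneg_right (by linarith) (by positivity)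
  · have hs : gain p q * gravityMoment p q
        - gain p (zeroConfig p (q 0)) * gravityMoment p (zeroConfig p (q 0))
        = gain p q * (gravityMoment p q - gravityMoment p (zeroConfig p (q 0)))
          + gravityMoment p (zeroConfig p (q 0)) * (gain p q - gain p (zeroConfig p (q 0))) := by
      ring
    have hn : 0 ≤ |q 2 - p.q3ref| + |q 0 + q 1| := by positivity
    rw [hs]
    refine (abs_add_le _ _).trans ?_
    rw [abs_mul, abs_mul]
    have k1 := mul_le_mul (h1' q) ((h5 q).trans (mul_le_mul_of_nonneg_right l5 hn)) (abs_nonneg _)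
      a1
    have k2 := mul_le_mul (h3' (zeroConfig p (q 0)))
      ((h4 q).trans (mul_le_mul_of_nonneg_right l4 hn)) (abs_nonneg _) a3
    have k3 := mul_le_mul_of_nonneg_right
      (by linarith : |B1| * |B5| + |B3| * |B4| ≤ B) hn
    linarith
  · exact mul_le_mul_of_nonneg_right (by linarith) (by positivity)
  · rw [abs_le] at e0 e1 e2
    have := le_abs_self p.q3ref
    have := neg_abs_le p.q3ref
    have := p.q1ref_pos
    intro i
    rw [abs_le]
    fin_cases i
    · change _ ≤ q 0 ∧ q 0 ≤ _
      constructor <;> linarith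
    · change _ ≤ q 1 ∧ q 1 ≤ _
      constructor <;> linarith
    · change _ ≤ q 2 ∧ q 2 ≤ _
      constructor <;> linarith

end Biped

/-! ### Decay of the output energy along the closed loop -/

/-- This lets the error one-form act as a linear spring whose varying stiffness stays between two
positive constants. -/
theorem exists_sin_eq_mul {x : ℝ} (hx : |x| ≤ 1) : ∃ s ∈ Icc (1 / 2 : ℝ) 1, sin x = s * x := by
  have key : ∀ y : ℝ, 0 < y → y ≤ 1 → ∃ s ∈ Icc (1 / 2 : ℝ) 1, sin y = s * y := by
    intro y hy hy1
    refine ⟨sin y / y, ⟨?_, ?_⟩, (div_mul_cancel₀ _ hy.ne').symm⟩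
    · rw [le_div_iff₀ hy]
      have h1 := sin_gt_sub_cube hy
      have h2 : y ^ 3 ≤ y := by
        have := mul_le_mul_of_nonneg_left (pow_le_one₀ (n := 2) hy.le hy1) hy.le
        linarith [pow_succ' y 2]
      linarith
    · rw [div_le_one hy]
      exact sin_le hy.le
  rcases lt_trichotomy x 0 with h | h | h
  · obtain ⟨s, hs, h1⟩ := key (-x) (by linarith) (by linarith [neg_abs_le x])
    refine ⟨s, hs, ?_⟩
    rw [sin_neg] at h1
    linarith
  · exact ⟨1, by norm_num, by simp [h]⟩
  · exact key x h ((le_abs_self x).trans hx)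

/-- Here N bounds the scaled state, d the disturbance, and 2GN the connection terms. The quadratic
part has the factor G, which has to be small against k. -/
theorem pid_perturbation_le {P o z f g d G N : ℝ} (hP : |P| ≤ N) (ho : |o| ≤ N) (hz : |z| ≤ N)
    (hf : |f| ≤ d + 2 * G * N) (hg : |g| ≤ 2 * G * N) :
    (P + o + z) * f + (2 * z + P) * g ≤ 3 * N * d + 12 * G * N ^ 2 := by
  have hN : 0 ≤ N := (abs_nonneg _).trans hP
  have h1 : |P + o + z| ≤ 3 * N := (abs_add_three _ _ _).trans (by linarith)
  have h2 : |2 * z + P| ≤ 3 * N := by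
    refine (abs_add_le _ _).trans ?_
    rw [abs_mul, abs_two]
    linarith
  have h3 := (le_abs_self _).trans ((abs_mul (P + o + z) f).le.trans
    (mul_le_mul h1 hf (abs_nonneg _) (by positivity)))
  have h4 := (le_abs_self _).trans ((abs_mul (2 * z + P) g).le.trans
    (mul_le_mul h2 hg (abs_nonneg _) (by positivity)))
  linarith

namespace Biped

variable (p : Params)

/-- In a neighbourhood of the zero dynamics the error one-form is proportional to the output. -/
theorem exists_eta_eq_mul : ∃ lam0 lam1 : ℝ, 0 < lam0 ∧ lam0 ≤ lam1 ∧ ∀ q : Fin 3 → ℝ,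
    |q 2 - p.q3ref| ≤ 1 → |q 0 + q 1| ≤ 1 →
    (∃ L ∈ Icc lam0 lam1, eta p q 0 = L * (q 2 - p.q3ref)) ∧
    (∃ L ∈ Icc lam0 lam1, eta p q 1 = L * (q 0 + q 1)) := by
  have hl := p.l_pos
  have hr := p.r_pos
  have h0 : 0 < 4 * p.MH + p.m := by linarith [p.MH_pos, p.m_pos]
  set D0 := 4 * p.MH + p.m with hD0
  set D1 := 4 * p.MH + 4 * p.MT + 5 * p.m with hD1
  have h01 : D0 ≤ D1 := (le_errorFactor p 0).trans (errorFactor_le p 0)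
  have hD1p : 0 < D1 := h0.trans_le h01
  have key : ∀ (q : Fin 3 → ℝ) (b s : ℝ), 0 < b → s ∈ Icc (1 / 2 : ℝ) 1 →
      1 / 2 / (b * D1) ≤ s / (b * errorFactor p q) ∧ s / (b * errorFactor p q) ≤ 1 / (b * D0) := by
    intro q b s hb hs
    have := errorFactor_pos p q
    have hs0 : 0 < s := by linarith [hs.1]
    constructor
    · exact div_le_div₀ hs0.le hs.1 (by positivity)
        (mul_le_mul_of_nonneg_left (errorFactor_le p q) hb.le)
    · exact div_le_div₀ zero_le_one hs.2 (by positivity)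
        (mul_le_mul_of_nonneg_left (le_errorFactor p q) hb.le)
  refine ⟨min (1 / 2 / (p.l ^ 2 * D1)) (1 / 2 / (p.r ^ 2 * D1)),
    max (1 / (p.l ^ 2 * D0)) (1 / (p.r ^ 2 * D0)), by positivity, ?_, fun q h1 h2 => ?_⟩
  · have := key 0 (p.l ^ 2) 1 (by positivity) (by norm_num)
    exact (min_le_left _ _).trans (this.1.trans (this.2.trans (le_max_left _ _)))
  · rw [eta_eq]
    constructor
    · obtain ⟨s, hs, h⟩ := exists_sin_eq_mul h1
      have := key q (p.l ^ 2) s (by positivity) hs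
      refine ⟨s / (p.l ^ 2 * errorFactor p q), ⟨(min_le_left _ _).trans this.1,
        this.2.trans (le_max_left _ _)⟩, ?_⟩
      simp only [Matrix.cons_val_zero, h]
      ring
    · obtain ⟨s, hs, h⟩ := exists_sin_eq_mul h2
      have := key q (p.r ^ 2) s (by positivity) hs
      refine ⟨s / (p.r ^ 2 * errorFactor p q), ⟨(min_le_right _ _).trans this.1,
        this.2.trans (le_max_right _ _)⟩, ?_⟩
      simp only [Matrix.cons_val_one, Matrix.cons_val_fin_one, h]
      ring

/-- The Lyapunov function of the output dynamics. -/
noncomputable def outputEnergy (a k : ℝ) (q v : Fin 3 → ℝ) (w : Fin 2 → ℝ) : ℝ :=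
  pidEnergy a k (q 2 - p.q3ref) (v 2) (w 0) + pidEnergy a k (q 0 + q 1) (v 0 + v 1) (w 1)

theorem outputEnergy_nonneg (a k : ℝ) (q v : Fin 3 → ℝ) (w : Fin 2 → ℝ) :
    0 ≤ outputEnergy p a k q v w :=
  add_nonneg (pidEnergy_nonneg _ _ _ _ _) (pidEnergy_nonneg _ _ _ _ _)

/-- The square of the norm which `outputEnergy` is equivalent to. -/
noncomputable def outputNormSq (a k : ℝ) (q v : Fin 3 → ℝ) (w : Fin 2 → ℝ) : ℝ :=
  (a * k * (q 2 - p.q3ref) + v 2) ^ 2 + v 2 ^ 2 + (k ^ 2 * w 0) ^ 2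
    + ((a * k * (q 0 + q 1) + (v 0 + v 1)) ^ 2 + (v 0 + v 1) ^ 2 + (k ^ 2 * w 1) ^ 2)

theorem outputNormSq_le (a k : ℝ) (q v : Fin 3 → ℝ) (w : Fin 2 → ℝ) :
    outputNormSq p a k q v w ≤ 6 * outputEnergy p a k q v w := by
  have h1 := sq_add_sq_add_sq_le_pidEnergy a k (q 2 - p.q3ref) (v 2) (w 0)
  have h2 := sq_add_sq_add_sq_le_pidEnergy a k (q 0 + q 1) (v 0 + v 1) (w 1)
  unfold outputNormSq outputEnergy
  linarith

theorem outputEnergy_le (a k : ℝ) (q v : Fin 3 → ℝ) (w : Fin 2 → ℝ) :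
    outputEnergy p a k q v w ≤ 2 * outputNormSq p a k q v w := by
  have h1 := pidEnergy_le a k (q 2 - p.q3ref) (v 2) (w 0)
  have h2 := pidEnergy_le a k (q 0 + q 1) (v 0 + v 1) (w 1)
  unfold outputNormSq outputEnergy
  linarith

theorem abs_le_of_outputNormSq {a k : ℝ} {q v : Fin 3 → ℝ} {w : Fin 2 → ℝ} {N : ℝ} (hN : 0 ≤ N)
    (h : outputNormSq p a k q v w ≤ N ^ 2) :
    |a * k * (q 2 - p.q3ref) + v 2| ≤ N ∧ |v 2| ≤ N ∧ |k ^ 2 * w 0| ≤ N ∧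
    |a * k * (q 0 + q 1) + (v 0 + v 1)| ≤ N ∧ |v 0 + v 1| ≤ N ∧ |k ^ 2 * w 1| ≤ N := by
  unfold outputNormSq at h
  have h1 := sq_nonneg (a * k * (q 2 - p.q3ref) + v 2)
  have h2 := sq_nonneg (v 2)
  have h3 := sq_nonneg (k ^ 2 * w 0)
  have h4 := sq_nonneg (a * k * (q 0 + q 1) + (v 0 + v 1))
  have h5 := sq_nonneg (v 0 + v 1)
  have h6 := sq_nonneg (k ^ 2 * w 1)
  refine ⟨?_, ?_, ?_, ?_, ?_, ?_⟩ <;> refine abs_le_of_sq_le_sq ?_ hN <;> linarith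

/-- The output energy bounds the state of the output dynamics. -/
theorem abs_le_sqrt_outputEnergy {a k : ℝ} (ha : 1 ≤ a) (hk : 0 < k) (q v : Fin 3 → ℝ)
    (w : Fin 2 → ℝ) :
    |q 2 - p.q3ref| ≤ 6 * √(outputEnergy p a k q v w) / k ∧
    |q 0 + q 1| ≤ 6 * √(outputEnergy p a k q v w) / k ∧
    |v 2| ≤ 3 * √(outputEnergy p a k q v w) ∧ |v 0 + v 1| ≤ 3 * √(outputEnergy p a k q v w) ∧
    |k ^ 2 * w 0| ≤ 3 * √(outputEnergy p a k q v w) ∧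
    |k ^ 2 * w 1| ≤ 3 * √(outputEnergy p a k q v w) := by
  have hQ := outputEnergy_nonneg p a k q v w
  obtain ⟨h1, h2, h3, h4, h5, h6⟩ := abs_le_of_outputNormSq p (a := a) (k := k) (q := q) (v := v)
    (w := w) (N := 3 * √(outputEnergy p a k q v w)) (by positivity) (by
      rw [mul_pow, Real.sq_sqrt hQ]
      have := outputNormSq_le p a k q v w
      linarith)
  have key : ∀ e o : ℝ, |a * k * e + o| ≤ 3 * √(outputEnergy p a k q v w) →
      |o| ≤ 3 * √(outputEnergy p a k q v w) → |e| ≤ 6 * √(outputEnergy p a k q v w) / k := by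
    intro e o h1 h2
    rw [le_div_iff₀ hk]
    have h3 : |a * k * e| ≤ 6 * √(outputEnergy p a k q v w) := by
      have := abs_sub (a * k * e + o) o
      rw [add_sub_cancel_right] at this
      linarith
    rw [abs_mul, abs_mul, abs_of_pos hk, abs_of_pos (one_pos.trans_le ha)] at h3
    have := mul_le_mul_of_nonneg_right ha (by positivity : 0 ≤ k * |e|)
    linarith
  exact ⟨key _ _ h1 h2, key _ _ h4 h5, h2, h5, h3, h6⟩

/-- The gains `a k`, `2 k²`, `c k³`. -/
noncomputable def highGains {a c k : ℝ} (ha : 0 < a) (hc : 0 < c) (hk : 0 < k) : Gains where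
  kp := 2 * k ^ 2
  kd := a * k
  kI := c * k ^ 3
  kp_pos := by positivity
  kd_pos := by positivity
  kI_pos := by positivity

/-- Decay of the output energy along the closed loop. -/
theorem exists_outputEnergy_decay {lamC B : ℝ} (hB : ModelBound p lamC B) :
    ∃ a c : ℝ, ∃ (ha : 1 ≤ a) (hc : 0 < c), ∀ (k : ℝ) (hk : 0 < k) (G : ℝ) (t : ℝ)
      (q v : ℝ → Fin 3 → ℝ) (w : ℝ → Fin 2 → ℝ),
      24 * G ≤ k * (c / 16) → gain p (q t) ≠ 0 → |q t 0| ≤ p.q1ref + 1 →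
      |q t 2 - p.q3ref| ≤ 1 → |q t 0 + q t 1| ≤ 1 →
      (∀ i j, |errorConnection p (q t) (v t) i j| ≤ G) →
      HasDerivAt q (v t) t →
      HasDerivAt v (swingAcc p (q t) (v t)
        (control p (highGains (one_pos.trans_le ha) hc hk) lamC (q t) (v t) (w t))) t →
      HasDerivAt w (integralRate p (q t) (v t) (w t)) t →
      ∃ Q', HasDerivAt (fun t => outputEnergy p a k (q t) (v t) (w t)) Q' t ∧
        Q' ≤ -(2 * (c / 32) * k) * outputEnergy p a k (q t) (v t) (w t) + 144 * B ^ 2 / c / k := by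
  obtain ⟨lam0, lam1, h0, h01, heta⟩ := exists_eta_eq_mul p
  have ha : (1 : ℝ) ≤ 1 + 4 * lam1 := by linarith
  have hc : 0 < lam0 / (1 + 4 * lam1) := div_pos h0 (by linarith)
  set a := 1 + 4 * lam1 with had
  set c := lam0 / a with hcd
  refine ⟨a, c, ha, hc, fun k hk G t q v w hG hg hq0 he1 he2 hΓ hq hv hw => ?_⟩
  have hq' := hasDerivAt_pi.1 hq
  have hv' := hasDerivAt_pi.1 hv
  have hw' := hasDerivAt_pi.1 hw
  have hQ1 := hasDerivAt_pidEnergy (a := a) (k := k) ((hq' 2).sub_const p.q3ref) (hv' 2) (hw' 0)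
  have hQ2 := hasDerivAt_pidEnergy (a := a) (k := k) ((hq' 0).add (hq' 1)) ((hv' 0).add (hv' 1))
    (hw' 1)
  refine ⟨_, hQ1.add hQ2, ?_⟩
  simp only [Pi.add_apply]
  have hacc := outputJacobian_mulVec_swingAcc p (highGains (one_pos.trans_le ha) hc hk) lamC (v t)
    (w t) hg
  set A := swingAcc p (q t) (v t)
    (control p (highGains (one_pos.trans_le ha) hc hk) lamC (q t) (v t) (w t))
  rw [outputJacobian_mulVec] at hacc
  obtain ⟨⟨L1, hL1, heta1⟩, ⟨L2, hL2, heta2⟩⟩ := heta (q t) he1 he2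
  set Γ := errorConnection p (q t) (v t) with hΓd
  have homega : omegaE (v t) = ![v t 2, v t 0 + v t 1] := outputJacobian_mulVec _
  have hA2 : A 2 = (disturbance p lamC (q t) 0 - (Γ 0 0 * v t 2 + Γ 0 1 * (v t 0 + v t 1)))
      - a * k * v t 2 - 2 * k ^ 2 * (L1 * (q t 2 - p.q3ref)) - c * k ^ 3 * w t 0 := by
    have := congrFun hacc 0
    simp only [homega, Matrix.mulVec, dotProduct, Fin.sum_univ_two, highGains, heta1, Pi.sub_apply,
      Pi.add_apply, Pi.smul_apply, smul_eq_mul, Matrix.cons_val_zero, Matrix.cons_val_one,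
      Matrix.cons_val_fin_one] at this
    rw [this]
    ring
  have hA01 : A 0 + A 1
      = (disturbance p lamC (q t) 1 - (Γ 1 0 * v t 2 + Γ 1 1 * (v t 0 + v t 1)))
      - a * k * (v t 0 + v t 1) - 2 * k ^ 2 * (L2 * (q t 0 + q t 1)) - c * k ^ 3 * w t 1 := by
    have := congrFun hacc 1
    simp only [homega, Matrix.mulVec, dotProduct, Fin.sum_univ_two, highGains, heta2, Pi.sub_apply,
      Pi.add_apply, Pi.smul_apply, smul_eq_mul, Matrix.cons_val_zero, Matrix.cons_val_one,
      Matrix.cons_val_fin_one] at this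
    rw [this]
    ring
  have hR0 : integralRate p (q t) (v t) (w t) 0
      = L1 * (q t 2 - p.q3ref) + -(Γ 0 0 * w t 0 + Γ 0 1 * w t 1) := by
    simp [integralRate, heta1]
    ring
  have hR1 : integralRate p (q t) (v t) (w t) 1
      = L2 * (q t 0 + q t 1) + -(Γ 1 0 * w t 0 + Γ 1 1 * w t 1) := by
    simp [integralRate, heta2]
    ring
  rw [hA2, hA01, hR0, hR1]
  have hlow := outputEnergy_le p a k (q t) (v t) (w t)
  set S := outputNormSq p a k (q t) (v t) (w t) with hS
  have hS0 : 0 ≤ S := by rw [hS, outputNormSq]; positivity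
  set N := √S with hN
  have hNN : N ^ 2 = S := Real.sq_sqrt hS0
  obtain ⟨b1, b2, b3, b4, b5, b6⟩ := abs_le_of_outputNormSq p (Real.sqrt_nonneg S) hNN.ge
  have hN0 : 0 ≤ N := Real.sqrt_nonneg S
  have hG0 : 0 ≤ G := (abs_nonneg _).trans (hΓ 0 0)
  have hlin : ∀ i x y, |x| ≤ N → |y| ≤ N → |Γ i 0 * x + Γ i 1 * y| ≤ 2 * G * N := by
    intro i x y hx hy
    refine (abs_add_le _ _).trans ?_
    rw [abs_mul, abs_mul]
    have := mul_le_mul (hΓ i 0) hx (abs_nonneg _) hG0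
    have := mul_le_mul (hΓ i 1) hy (abs_nonneg _) hG0
    linarith
  have hf : ∀ i, |disturbance p lamC (q t) i - (Γ i 0 * v t 2 + Γ i 1 * (v t 0 + v t 1))|
      ≤ B + 2 * G * N := fun i =>
    (abs_sub _ _).trans (add_le_add (hB.disturbance_le _ hq0 he1 he2 i) (hlin i _ _ b2 b5))
  have hgb : ∀ i, |k ^ 2 * -(Γ i 0 * w t 0 + Γ i 1 * w t 1)| ≤ 2 * G * N := by
    intro i
    have : k ^ 2 * -(Γ i 0 * w t 0 + Γ i 1 * w t 1)
        = -(Γ i 0 * (k ^ 2 * w t 0) + Γ i 1 * (k ^ 2 * w t 1)) := by ring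
    rw [this, abs_neg]
    exact hlin i _ _ b3 b6
  have d1 := pidEnergy_deriv_le (e := q t 2 - p.q3ref) (o := v t 2) (w := w t 0)
    (f := disturbance p lamC (q t) 0 - (Γ 0 0 * v t 2 + Γ 0 1 * (v t 0 + v t 1)))
    (g := -(Γ 0 0 * w t 0 + Γ 0 1 * w t 1)) hk h0 hL1.1 hL1.2 had hcd
  have d2 := pidEnergy_deriv_le (e := q t 0 + q t 1) (o := v t 0 + v t 1) (w := w t 1)
    (f := disturbance p lamC (q t) 1 - (Γ 1 0 * v t 2 + Γ 1 1 * (v t 0 + v t 1)))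
    (g := -(Γ 1 0 * w t 0 + Γ 1 1 * w t 1)) hk h0 hL2.1 hL2.2 had hcd
  have e1 := pid_perturbation_le b1 b2 b3 (hf 0) (hgb 0)
  have e2 := pid_perturbation_le b4 b5 b6 (hf 1) (hgb 1)
  have hSd : S = (a * k * (q t 2 - p.q3ref) + v t 2) ^ 2 + v t 2 ^ 2 + (k ^ 2 * w t 0) ^ 2
    + ((a * k * (q t 0 + q t 1) + (v t 0 + v t 1)) ^ 2 + (v t 0 + v t 1) ^ 2
      + (k ^ 2 * w t 1) ^ 2) := rfl
  -- Of the decay rate kc/4, one part kc/16 pays for the connection and another for the disturbance.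
  -- The remaining kc/8 of S gives kc/16 of the energy, which is at most 2S.
  have m1 : 24 * G * N ^ 2 ≤ k * (c / 16) * N ^ 2 := mul_le_mul_of_nonneg_right hG (by positivity)
  -- Completing the square leaves a constant of order 1/k: high gain also suppresses the
  -- disturbance.
  have m2 : 6 * N * B ≤ k * (c / 16) * N ^ 2 + 144 * B ^ 2 / c / k := by
    have h : k * (c / 16) * N ^ 2 + 144 * B ^ 2 / c / k - 6 * N * B
        = k * c / 16 * (N - 48 * B / (k * c)) ^ 2 := by
      field_simp
      ring
    have : 0 ≤ k * c / 16 * (N - 48 * B / (k * c)) ^ 2 := by positivity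
    linarith
  have m3 : k * (c / 16) * outputEnergy p a k (q t) (v t) (w t) ≤ k * (c / 16) * (2 * S) :=
    mul_le_mul_of_nonneg_left hlow (by positivity)
  have m4 : -(k * (c / 4)) * S = -(k * (c / 4)) * ((a * k * (q t 2 - p.q3ref) + v t 2) ^ 2
      + v t 2 ^ 2 + (k ^ 2 * w t 0) ^ 2) + -(k * (c / 4)) * ((a * k * (q t 0 + q t 1)
      + (v t 0 + v t 1)) ^ 2 + (v t 0 + v t 1) ^ 2 + (k ^ 2 * w t 1) ^ 2) := by
    rw [hSd]
    ring
  rw [hNN] at e1 e2 m1 m2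
  linarith

end Biped

namespace Biped

variable (p : Params)

/-! ### The reset map -/

theorem inertiaDS_mulVec (q : Fin 3 → ℝ) (x : Fin 5 → ℝ) : inertiaDS p q *ᵥ x = ![
    p.m * p.r ^ 2 / 4 * x 0 + -(p.m * p.r * cos (q 0)) / 2 * x 3
      + p.m * p.r * sin (q 0) / 2 * x 4,
    p.m * p.r ^ 2 / 4 * x 1 + -(p.m * p.r * cos (q 1)) / 2 * x 3
      + p.m * p.r * sin (q 1) / 2 * x 4,
    p.MT * p.l ^ 2 * x 2 + p.MT * p.l * cos (q 2) * x 3 + -(p.MT * p.l * sin (q 2)) * x 4,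
    -(p.m * p.r * cos (q 0)) / 2 * x 0 + -(p.m * p.r * cos (q 1)) / 2 * x 1
      + p.MT * p.l * cos (q 2) * x 2 + (2 * p.m + p.MH + p.MT) * x 3,
    p.m * p.r * sin (q 0) / 2 * x 0 + p.m * p.r * sin (q 1) / 2 * x 1
      + -(p.MT * p.l * sin (q 2)) * x 2 + (2 * p.m + p.MH + p.MT) * x 4] := by
  ext i
  rw [Matrix.mulVec, dotProduct, Fin.sum_univ_five]
  fin_cases i <;> simp [inertiaDS]

/-- The kinetic energy of the unpinned biped is the sum of those of its point masses. -/
theorem inertiaDS_quadratic (q : Fin 3 → ℝ) (x : Fin 5 → ℝ) :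
    x ⬝ᵥ (inertiaDS p q *ᵥ x)
      = p.m * ((x 3 - p.r / 2 * cos (q 0) * x 0) ^ 2 + (x 4 + p.r / 2 * sin (q 0) * x 0) ^ 2)
        + p.m * ((x 3 - p.r / 2 * cos (q 1) * x 1) ^ 2 + (x 4 + p.r / 2 * sin (q 1) * x 1) ^ 2)
        + p.MT * ((x 3 + p.l * cos (q 2) * x 2) ^ 2 + (x 4 - p.l * sin (q 2) * x 2) ^ 2)
        + p.MH * (x 3 ^ 2 + x 4 ^ 2) := by
  rw [inertiaDS_mulVec, dotProduct, Fin.sum_univ_five]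
  simp only [Matrix.cons_val]
  linear_combination (p.m * p.r ^ 2 / 4 * x 0 ^ 2) * (-sin_sq_add_cos_sq (q 0))
    + (p.m * p.r ^ 2 / 4 * x 1 ^ 2) * (-sin_sq_add_cos_sq (q 1))
    + (p.MT * p.l ^ 2 * x 2 ^ 2) * (-sin_sq_add_cos_sq (q 2))

/-- The hip mass forces the hip velocity to vanish; after that each of the other point masses forces
the angular velocity of its own link to vanish. -/
theorem eq_zero_of_inertiaDS {q : Fin 3 → ℝ} {x : Fin 5 → ℝ}
    (h : x ⬝ᵥ (inertiaDS p q *ᵥ x) = 0) : x = 0 := by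
  have hm := p.m_pos
  have hMH := p.MH_pos
  have hMT := p.MT_pos
  have hl := p.l_pos
  have hr := p.r_pos
  rw [inertiaDS_quadratic] at h
  have n1 : 0 ≤ p.m * ((x 3 - p.r / 2 * cos (q 0) * x 0) ^ 2
    + (x 4 + p.r / 2 * sin (q 0) * x 0) ^ 2) := by positivity
  have n2 : 0 ≤ p.m * ((x 3 - p.r / 2 * cos (q 1) * x 1) ^ 2
    + (x 4 + p.r / 2 * sin (q 1) * x 1) ^ 2) := by positivity
  have n3 : 0 ≤ p.MT * ((x 3 + p.l * cos (q 2) * x 2) ^ 2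
    + (x 4 - p.l * sin (q 2) * x 2) ^ 2) := by positivity
  have n4 : 0 ≤ p.MH * (x 3 ^ 2 + x 4 ^ 2) := by positivity
  have z : ∀ {M y : ℝ}, 0 < M → M * y = 0 → y = 0 := fun hM h =>
    (mul_eq_zero.1 h).resolve_left hM.ne'
  have h4 := z hMH (by linarith : p.MH * (x 3 ^ 2 + x 4 ^ 2) = 0)
  have h3 : x 3 = 0 := pow_eq_zero_iff two_ne_zero |>.1 (by linarith [sq_nonneg (x 3), sq_nonneg (x 4)])
  have h4 : x 4 = 0 := pow_eq_zero_iff two_ne_zero |>.1 (by linarith [sq_nonneg (x 3), sq_nonneg (x 4)])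
  have k1 := z hm (by linarith : p.m * ((x 3 - p.r / 2 * cos (q 0) * x 0) ^ 2
    + (x 4 + p.r / 2 * sin (q 0) * x 0) ^ 2) = 0)
  have k2 := z hm (by linarith : p.m * ((x 3 - p.r / 2 * cos (q 1) * x 1) ^ 2
    + (x 4 + p.r / 2 * sin (q 1) * x 1) ^ 2) = 0)
  have k3 := z hMT (by linarith : p.MT * ((x 3 + p.l * cos (q 2) * x 2) ^ 2
    + (x 4 - p.l * sin (q 2) * x 2) ^ 2) = 0)
  rw [h3, h4] at k1 k2 k3
  have h0 : x 0 = 0 := by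
    have : (p.r / 2) ^ 2 * x 0 ^ 2 = 0 := by
      linear_combination k1 - (p.r / 2) ^ 2 * x 0 ^ 2 * sin_sq_add_cos_sq (q 0)
    exact pow_eq_zero_iff two_ne_zero |>.1 (z (by positivity) this)
  have h1 : x 1 = 0 := by
    have : (p.r / 2) ^ 2 * x 1 ^ 2 = 0 := by
      linear_combination k2 - (p.r / 2) ^ 2 * x 1 ^ 2 * sin_sq_add_cos_sq (q 1)
    exact pow_eq_zero_iff two_ne_zero |>.1 (z (by positivity) this)
  have h2 : x 2 = 0 := by
    have : p.l ^ 2 * x 2 ^ 2 = 0 := by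
      linear_combination k3 - p.l ^ 2 * x 2 ^ 2 * sin_sq_add_cos_sq (q 2)
    exact pow_eq_zero_iff two_ne_zero |>.1 (z (by positivity) this)
  ext i
  fin_cases i <;> assumption

theorem det_inertiaDS_ne_zero (q : Fin 3 → ℝ) : (inertiaDS p q).det ≠ 0 := by
  intro h
  obtain ⟨x, hx, h⟩ := Matrix.exists_mulVec_eq_zero_iff.2 h
  exact hx (eq_zero_of_inertiaDS p (by rw [h, dotProduct_zero]))

/-- For y in the kernel put u = M⁻¹Jᵀy. Its kinetic energy is the pairing of y with Ju = 0, so u = 0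
and Jᵀy = 0; the hip components of Jᵀy are y itself. -/
theorem det_footInertia_ne_zero (q : Fin 3 → ℝ) :
    (swingFootJacobian p q * (inertiaDS p q)⁻¹ * (swingFootJacobian p q)ᵀ).det ≠ 0 := by
  intro h
  obtain ⟨y, hy, h⟩ := Matrix.exists_mulVec_eq_zero_iff.2 h
  set u := (inertiaDS p q)⁻¹ *ᵥ ((swingFootJacobian p q)ᵀ *ᵥ y) with hu
  have hMu : inertiaDS p q *ᵥ u = (swingFootJacobian p q)ᵀ *ᵥ y :=
    mulVec_inv_mulVec_self (det_inertiaDS_ne_zero p q).isUnit _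
  have hJu : swingFootJacobian p q *ᵥ u = 0 := by
    rw [← h, hu]
    simp only [mulVec_mulVec, Matrix.mul_assoc]
  have hu0 : u = 0 := by
    refine eq_zero_of_inertiaDS p (q := q) ?_
    rw [hMu, dotProduct_mulVec, vecMul_transpose, hJu, zero_dotProduct]
  rw [hu0, mulVec_zero] at hMu
  refine hy ?_
  have h3 := congrFun hMu 3
  have h4 := congrFun hMu 4
  simp [swingFootJacobian, Matrix.mulVec, dotProduct, Fin.sum_univ_two] at h3 h4
  ext i
  fin_cases i
  · exact h3.symm
  · exact h4.symm

theorem contDiffAt_swingFootJacobian (q : Fin 3 → ℝ) (i : Fin 2) (j : Fin 5) :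
    ContDiffAt ℝ 1 (fun q => swingFootJacobian p q i j) q := by
  fin_cases i <;> fin_cases j <;> simp [swingFootJacobian] <;> fun_prop

theorem contDiffAt_inertiaDS (q : Fin 3 → ℝ) (i j : Fin 5) :
    ContDiffAt ℝ 1 (fun q => inertiaDS p q i j) q := by
  fin_cases i <;> fin_cases j <;> simp [inertiaDS] <;> fun_prop

theorem contDiffAt_pinnedJacobian (q : Fin 3 → ℝ) (i : Fin 5) (j : Fin 3) :
    ContDiffAt ℝ 1 (fun q => pinnedJacobian p q i j) q := by
  fin_cases i <;> fin_cases j <;> simp [pinnedJacobian] <;> fun_prop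

theorem contDiffAt_resetMatrix (q : Fin 3 → ℝ) (i j : Fin 3) :
    ContDiffAt ℝ 1 (fun q => (relabelDS * impactMatrix p q) i j) q := by
  have hJ := contDiffAt_swingFootJacobian p q
  have hJt : ∀ i j, ContDiffAt ℝ 1 (fun q => (swingFootJacobian p q)ᵀ i j) q := fun i j => hJ j i
  have hP := contDiffAt_pinnedJacobian p q
  have hMi := contDiffAt_matrix_inv_apply (contDiffAt_inertiaDS p q) (det_inertiaDS_ne_zero p q)
  have hS := contDiffAt_matrix_inv_apply (A := fun q => swingFootJacobian p q * (inertiaDS p q)⁻¹ *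
      (swingFootJacobian p q)ᵀ)
    (contDiffAt_matrix_mul_apply (contDiffAt_matrix_mul_apply hJ hMi) hJt)
    (det_footInertia_ne_zero p q)
  have hI : ∀ i j, ContDiffAt ℝ 1 (fun q => impulseMatrix p q i j) q := fun i j =>
    (contDiffAt_matrix_mul_apply hS (contDiffAt_matrix_mul_apply hJ hP) i j).neg
  have hF : ∀ i j, ContDiffAt ℝ 1 (fun q => impactMatrix p q i j) q := fun i j =>
    (contDiffAt_matrix_mul_apply (contDiffAt_matrix_mul_apply hMi hJt) hI i j).add (hP i j)
  exact contDiffAt_matrix_mul_apply (A := fun _ => relabelDS) (fun _ _ => contDiffAt_const) hF i j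

theorem relabel_mulVec (q : Fin 3 → ℝ) : relabel *ᵥ q = ![q 1, q 0, q 2] := by
  ext i
  fin_cases i <;> simp [relabel, Matrix.mulVec, dotProduct, Fin.sum_univ_three]

theorem continuous_reset : Continuous (reset p) := by
  have h1 : Continuous fun x : (Fin 3 → ℝ) × (Fin 3 → ℝ) => relabel *ᵥ x.1 :=
    continuous_const.matrix_mulVec continuous_fst
  refine h1.prodMk (continuous_pi fun i => ?_)
  simp only [Matrix.mulVec, dotProduct]
  refine continuous_finsetSum _ fun j _ => ?_
  have h2 : Continuous fun q => (relabelDS * impactMatrix p q) i j :=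
    continuous_iff_continuousAt.2 fun q => (contDiffAt_resetMatrix p q i j).continuousAt
  exact (h2.comp continuous_fst).mul ((continuous_apply j).comp continuous_snd)

theorem continuous_momentum : Continuous fun x : (Fin 3 → ℝ) × (Fin 3 → ℝ) =>
    momentum p x.1 x.2 := by
  have := continuous_gain p
  simp only [momentum_eq]
  fun_prop

theorem continuous_gravityMoment : Continuous (gravityMoment p) := by
  simp only [funext (gravityMoment_eq p)]
  fun_prop

/-! ### The zero dynamics -/

theorem continuous_zeroConfig : Continuous (zeroConfig p) := by
  refine continuous_pi fun i => ?_
  fin_cases i <;> simp [zeroConfig] <;> fun_prop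

theorem momentum_zeroConfig_zeroVel (x y : ℝ) :
    momentum p (zeroConfig p x) (zeroVel y) = gain p (zeroConfig p x) * y := by
  rw [momentum_eq]
  simp [zeroVel]

/-- The potential of the zero dynamics, in the form in which it enters the conservation law of
the squared angular momentum. -/
theorem exists_zeroDyn_potential : ∃ H : ℝ → ℝ, ∀ x,
    HasDerivAt H (gain p (zeroConfig p x) * gravityMoment p (zeroConfig p x)) x := by
  have hc : Continuous fun x => gain p (zeroConfig p x) * gravityMoment p (zeroConfig p x) :=
    ((continuous_gain p).comp (continuous_zeroConfig p)).mul
      ((continuous_gravityMoment p).comp (continuous_zeroConfig p))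
  exact ⟨_, fun x => intervalIntegral.integral_hasDerivAt_right (hc.intervalIntegrable 0 x)
    (hc.stronglyMeasurableAtFilter _ _) hc.continuousAt⟩

/-- The angular momentum after the impact of a state with stance leg velocity `a` on the zero
dynamics manifold. -/
noncomputable def stepMomentum (a : ℝ) : ℝ :=
  momentum p (zeroConfig p (-p.q1ref)) (reset p (zeroConfig p p.q1ref, zeroVel a)).2

/-- The conservation law of the zero dynamics. -/
theorem ZeroDynStep.conservation {a b : ℝ} {p : Params} (h : ZeroDynStep p a b) {H : ℝ → ℝ}
    (hH : ∀ x, HasDerivAt H (gain p (zeroConfig p x) * gravityMoment p (zeroConfig p x)) x) :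
    0 < b ∧
    (∃ y > 0, stepMomentum p a = gain p (zeroConfig p (-p.q1ref)) * y) ∧
    (gain p (zeroConfig p p.q1ref) * b) ^ 2 / 2
      = stepMomentum p a ^ 2 / 2 - H (-p.q1ref) + H p.q1ref ∧
    ∀ x ∈ Icc (-p.q1ref) p.q1ref, gain p (zeroConfig p x) ≠ 0 →
      0 < stepMomentum p a ^ 2 / 2 - H (-p.q1ref) + H x := by
  obtain ⟨T, φ, ψ, χ, u, μ, hT, himp, hφ0, hφT, hψT, hdyn⟩ := h
  -- The impulsive hip torque is internal, so the angular momentum fixes the initial velocity `ψ 0`.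
  have h0 : stepMomentum p a = gain p (zeroConfig p (-p.q1ref)) * ψ 0 := by
    have := congrArg (fun y => ∑ i, y i) himp
    simp only [sum_inputMatrix_mulVec, mulVec_sub, Pi.sub_apply, Finset.sum_sub_distrib] at this
    have h1 := momentum_zeroConfig_zeroVel p (-p.q1ref) (ψ 0)
    rw [momentum] at h1
    rw [stepMomentum, momentum]
    linarith
  have hφc : ContinuousOn φ (Icc 0 T) := fun s hs => (hdyn s hs).2.1.continuousWithinAt
  have hE : ∀ s ∈ Icc 0 T, HasDerivWithinAt
      (fun s => (gain p (zeroConfig p (φ s)) * ψ s) ^ 2 / 2 - H (φ s)) 0 (Icc 0 T) s := by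
    intro s hs
    obtain ⟨-, h1, h2, h3⟩ := hdyn s hs
    have hq : HasDerivWithinAt (fun s => zeroConfig p (φ s)) (zeroVel (ψ s)) (Icc 0 T) s := by
      refine hasDerivWithinAt_pi.2 fun i => ?_
      fin_cases i
      exacts [h1, h1.neg, hasDerivWithinAt_const s _ p.q3ref]
    have hv : HasDerivWithinAt (fun s => zeroVel (ψ s)) (zeroVel (χ s)) (Icc 0 T) s := by
      refine hasDerivWithinAt_pi.2 fun i => ?_
      fin_cases i
      exacts [h2, h2.neg, hasDerivWithinAt_const s _ (0 : ℝ)]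
    have hm := hasDerivWithinAt_momentum p (q := fun s => zeroConfig p (φ s))
      (v := fun s => zeroVel (ψ s)) (a := zeroVel (χ s)) (u := u s) hq hv h3.symm
    simp only [momentum_zeroConfig_zeroVel] at hm
    refine (((hm.pow 2).div_const 2).sub ((hH (φ s)).comp_hasDerivWithinAt s h1)).congr_deriv ?_
    simp
    ring
  have hconst : ∀ s ∈ Icc 0 T, (gain p (zeroConfig p (φ s)) * ψ s) ^ 2 / 2 - H (φ s)
      = stepMomentum p a ^ 2 / 2 - H (-p.q1ref) := by
    have := constant_of_has_deriv_right_zero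
      (f := fun s => (gain p (zeroConfig p (φ s)) * ψ s) ^ 2 / 2 - H (φ s)) (a := 0) (b := T)
      (fun s hs => (hE s hs).continuousWithinAt)
      (fun s hs => (hE s (Ico_subset_Icc_self hs)).mono_of_mem_nhdsWithin
        (Icc_mem_nhdsGE_of_mem hs))
    intro s hs
    rw [this s hs, h0, hφ0]
  have hT' : T ∈ Icc 0 T := right_mem_Icc.2 hT.le
  have h0' : (0 : ℝ) ∈ Icc 0 T := left_mem_Icc.2 hT.le
  refine ⟨hψT ▸ (hdyn T hT').1, ⟨ψ 0, (hdyn 0 h0').1, h0⟩, ?_, fun x hx hg => ?_⟩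
  · have := hconst T hT'
    rw [hφT, hψT] at this
    linarith
  · have hivt := intermediate_value_Icc hT.le hφc
    rw [hφ0, hφT] at hivt
    obtain ⟨s, hs, rfl⟩ := hivt hx
    have h1 := hconst s hs
    have h2 := (hdyn s hs).1
    have : 0 < (gain p (zeroConfig p (φ s)) * ψ s) ^ 2 := by positivity
    linarith

/-- Where the controller is defined on the zero dynamics, the gain has a constant sign and is
bounded away from zero, also in a neighbourhood. -/
theorem exists_le_sign_mul_gain
    (hdec : ∀ a ∈ Icc (-p.q1ref) p.q1ref, (errorInput p (zeroConfig p a)).det ≠ 0) :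
    ∃ σ c₀ ε : ℝ, (σ = 1 ∨ σ = -1) ∧ 0 < c₀ ∧ 0 < ε ∧ ∀ q : Fin 3 → ℝ, -p.q1ref - ε ≤ q 0 →
      q 0 ≤ p.q1ref → |q 2 - p.q3ref| ≤ ε → c₀ ≤ σ * gain p q := by
  have hc : Continuous fun x => gain p (zeroConfig p x) :=
    (continuous_gain p).comp (continuous_zeroConfig p)
  have hne : ∀ x ∈ Icc (-p.q1ref) p.q1ref, gain p (zeroConfig p x) ≠ 0 := fun x hx =>
    (det_errorInput_ne_zero_iff p _).1 (hdec x hx)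
  have hmem : -p.q1ref ∈ Icc (-p.q1ref) p.q1ref := ⟨le_rfl, by linarith [p.q1ref_pos]⟩
  have hconn : IsPreconnected ((fun x => gain p (zeroConfig p x)) '' Icc (-p.q1ref) p.q1ref) :=
    isPreconnected_Icc.image _ hc.continuousOn
  have hsign : ∃ σ : ℝ, (σ = 1 ∨ σ = -1) ∧ ∀ x ∈ Icc (-p.q1ref) p.q1ref,
      0 < σ * gain p (zeroConfig p x) := by
    have h0 : (0 : ℝ) ∉ (fun x => gain p (zeroConfig p x)) '' Icc (-p.q1ref) p.q1ref := by
      rintro ⟨x, hx, h⟩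
      exact hne x hx h
    rcases (hne _ hmem).lt_or_gt with hlt | hgt
    · refine ⟨-1, Or.inr rfl, fun x hx => ?_⟩
      by_contra hcon
      exact h0 (hconn.ordConnected.out (mem_image_of_mem _ hmem) (mem_image_of_mem _ hx)
        ⟨hlt.le, by linarith⟩)
    · refine ⟨1, Or.inl rfl, fun x hx => ?_⟩
      by_contra hcon
      exact h0 (hconn.ordConnected.out (mem_image_of_mem _ hx) (mem_image_of_mem _ hmem)
        ⟨by linarith, hgt.le⟩)
  obtain ⟨σ, hσ, hpos⟩ := hsign
  obtain ⟨x₀, hx₀, hmin⟩ := isCompact_Icc.exists_isMinOn ⟨_, hmem⟩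
    (f := fun x => σ * gain p (zeroConfig p x)) (hc.const_mul σ).continuousOn
  set c₁ := σ * gain p (zeroConfig p x₀) with hc₁
  have hc₁0 : 0 < c₁ := hpos x₀ hx₀
  have hb : 0 < p.MT * p.l * p.r := mul_pos (mul_pos p.MT_pos p.l_pos) p.r_pos
  refine ⟨σ, c₁ / 2, c₁ / (4 * (p.MT * p.l * p.r)), hσ, by positivity, by positivity,
    fun q h1 h2 h3 => ?_⟩
  set ε := c₁ / (4 * (p.MT * p.l * p.r)) with hε
  have hεpos : 0 < ε := by positivity
  -- The angle is clamped to the interval on which `gain` is controlled. Clamping and the torso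
  -- error each cost at most ε, and ε is chosen so that together they use up half of c₁.
  set x := max (q 0) (-p.q1ref) with hx
  have hxm : x ∈ Icc (-p.q1ref) p.q1ref := ⟨le_max_right _ _, max_le h2 hmem.2⟩
  have hxq : |q 0 - x| ≤ ε := by
    rw [abs_le]
    constructor
    · rcases max_cases (q 0) (-p.q1ref) with h | h <;> linarith
    · linarith [le_max_left (q 0) (-p.q1ref)]
  have hd : gain p q - gain p (zeroConfig p x)
      = p.MT * p.l * p.r * (cos (q 0 - q 2) - cos (x - p.q3ref)) := by
    simp only [gain, zeroConfig, Matrix.cons_val]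
    ring
  have hlip : |gain p q - gain p (zeroConfig p x)| ≤ c₁ / 2 := by
    rw [hd, abs_mul, abs_of_pos hb]
    have h4 := abs_cos_sub_cos_le (q 0 - q 2) (x - p.q3ref)
    have h5 : q 0 - q 2 - (x - p.q3ref) = (q 0 - x) - (q 2 - p.q3ref) := by ring
    rw [h5] at h4
    have h6 : |cos (q 0 - q 2) - cos (x - p.q3ref)| ≤ 2 * ε :=
      h4.trans ((abs_sub _ _).trans (by linarith))
    refine (mul_le_mul_of_nonneg_left h6 hb.le).trans (le_of_eq ?_)
    rw [hε]
    have := p.MT_pos.ne'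
    have := p.l_pos.ne'
    have := p.r_pos.ne'
    field_simp
    ring
  have hmx : c₁ ≤ σ * gain p (zeroConfig p x) := hmin hxm
  have hab : |σ * (gain p q - gain p (zeroConfig p x))| ≤ c₁ / 2 := by
    rw [abs_mul]
    rcases hσ with h | h <;> simpa [h] using hlip
  have := (abs_le.1 hab).1
  linarith

end Biped

/-! ### The tube around the zero dynamics and the differential inequalities in it -/

namespace Biped

variable (p : Params)

theorem abs_mul_of_sign {σ : ℝ} (hσ : σ = 1 ∨ σ = -1) (x : ℝ) : |σ * x| = |x| := by
  rcases hσ with rfl | rfl <;> simp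

theorem ModelBound.nonneg {p : Params} {lamC B : ℝ} (hB : ModelBound p lamC B) : 0 ≤ B :=
  zero_le_one.trans hB.one_le

/-- The momentum determines the stance leg velocity up to the output velocity. -/
theorem gain_mul_velocity_sub_le {lamC B Y σ : ℝ} (hB : ModelBound p lamC B)
    (hσ : σ = 1 ∨ σ = -1) {q v : Fin 3 → ℝ} (h2 : |v 2| ≤ Y) (h01 : |v 0 + v 1| ≤ Y) :
    |σ * gain p q * v 0 - σ * momentum p q v| ≤ 2 * B * Y := by
  have h : σ * gain p q * v 0 - σ * momentum p q v
      = -(σ * (momentum p q v - gain p q * v 0)) := by ring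
  rw [h, abs_neg, abs_mul_of_sign hσ]
  refine (hB.momentum_sub_le q v).trans ?_
  have := mul_le_mul_of_nonneg_left (add_le_add h2 h01) hB.nonneg
  linarith

/-- Bounds of the stance leg velocity in terms of the momentum. -/
theorem velocity_bounds {lamC B c₀ Y σ slo shi : ℝ} (hB : ModelBound p lamC B)
    (hσ : σ = 1 ∨ σ = -1) (hc₀ : 0 < c₀) (hslo : 0 < slo) {q v : Fin 3 → ℝ}
    (hg : c₀ ≤ σ * gain p q) (h2 : |v 2| ≤ Y) (h01 : |v 0 + v 1| ≤ Y)
    (hs : slo ≤ σ * momentum p q v) (hs' : σ * momentum p q v ≤ shi) :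
    slo / B - 2 * B * Y / c₀ ≤ v 0 ∧ v 0 ≤ shi / c₀ + 2 * B * Y / c₀ ∧
      |v 0| ≤ shi / c₀ + 2 * B * Y / c₀ := by
  have hB0 : 0 < B := one_pos.trans_le hB.one_le
  have hY : 0 ≤ Y := (abs_nonneg _).trans h2
  have hg0 : 0 < σ * gain p q := hc₀.trans_le hg
  have hgB : σ * gain p q ≤ B :=
    (le_abs_self _).trans ((abs_mul_of_sign hσ _).le.trans (hB.gain_le q))
  have hr := gain_mul_velocity_sub_le p hB hσ (q := q) h2 h01
  set r := σ * gain p q * v 0 - σ * momentum p q v with hrd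
  have hv : v 0 = (σ * momentum p q v) / (σ * gain p q) + r / (σ * gain p q) := by
    rw [← add_div, hrd, add_sub_cancel, mul_div_cancel_left₀ _ hg0.ne']
  have hrg : |r / (σ * gain p q)| ≤ 2 * B * Y / c₀ := by
    rw [abs_div, abs_of_pos hg0]
    exact div_le_div₀ (by positivity) hr hc₀ hg
  have h3 : slo / B ≤ (σ * momentum p q v) / (σ * gain p q) :=
    div_le_div₀ (hslo.le.trans hs) hs hg0 hgB
  have h4 : (σ * momentum p q v) / (σ * gain p q) ≤ shi / c₀ :=
    div_le_div₀ (hslo.le.trans (hs.trans hs')) hs' hc₀ hg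
  rw [abs_le] at hrg
  have h5 : 0 ≤ slo / B := by positivity
  have h6 : slo / B - 2 * B * Y / c₀ ≤ v 0 := by rw [hv]; linarith
  have h7 : v 0 ≤ shi / c₀ + 2 * B * Y / c₀ := by rw [hv]; linarith
  refine ⟨h6, h7, abs_le.2 ⟨?_, h7⟩⟩
  have : 0 ≤ shi / c₀ := h5.trans (h3.trans h4)
  linarith

/-- The tube around the zero dynamics in which the swing phase takes place. -/
def tube (a k M σ slo shi xlo : ℝ) : Set ((Fin 3 → ℝ) × (Fin 3 → ℝ) × (Fin 2 → ℝ)) :=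
  {x | xlo ≤ x.1 0 ∧ x.1 0 ≤ p.q1ref ∧ outputEnergy p a k x.1 x.2.1 x.2.2 ≤ M ^ 2 ∧
    slo ≤ σ * momentum p x.1 x.2.1 ∧ σ * momentum p x.1 x.2.1 ≤ shi}

/-- The output velocity may be as large as M, but the output itself is of size M/k: configurations
stay near the manifold throughout the velocity peak. -/
theorem abs_le_of_mem_tube {a k M σ slo shi xlo : ℝ} (ha : 1 ≤ a) (hk : 0 < k) (hM : 0 ≤ M)
    {x : (Fin 3 → ℝ) × (Fin 3 → ℝ) × (Fin 2 → ℝ)} (hx : x ∈ tube p a k M σ slo shi xlo) :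
    |x.1 2 - p.q3ref| ≤ 6 * M / k ∧ |x.1 0 + x.1 1| ≤ 6 * M / k ∧ |x.2.1 2| ≤ 3 * M ∧
      |x.2.1 0 + x.2.1 1| ≤ 3 * M ∧ |k ^ 2 * x.2.2 0| ≤ 3 * M ∧ |k ^ 2 * x.2.2 1| ≤ 3 * M := by
  obtain ⟨h1, h2, h3, h4, h5, h6⟩ := abs_le_sqrt_outputEnergy p ha hk x.1 x.2.1 x.2.2
  have hs : √(outputEnergy p a k x.1 x.2.1 x.2.2) ≤ M := Real.sqrt_le_iff.2 ⟨hM, hx.2.2.1⟩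
  have h7 : 6 * √(outputEnergy p a k x.1 x.2.1 x.2.2) / k ≤ 6 * M / k := by gcongr
  exact ⟨h1.trans h7, h2.trans h7, by linarith, by linarith, by linarith, by linarith⟩

theorem continuous_outputEnergy (a k : ℝ) :
    Continuous fun x : (Fin 3 → ℝ) × (Fin 3 → ℝ) × (Fin 2 → ℝ) =>
      outputEnergy p a k x.1 x.2.1 x.2.2 := by
  unfold outputEnergy pidEnergy
  fun_prop

theorem isClosed_tube (a k M σ slo shi xlo : ℝ) : IsClosed (tube p a k M σ slo shi xlo) := by
  have h0 : Continuous fun x : (Fin 3 → ℝ) × (Fin 3 → ℝ) × (Fin 2 → ℝ) => x.1 0 := by fun_prop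
  have h1 : Continuous fun x : (Fin 3 → ℝ) × (Fin 3 → ℝ) × (Fin 2 → ℝ) =>
      σ * momentum p x.1 x.2.1 :=
    ((continuous_momentum p).comp (g := fun x : (Fin 3 → ℝ) × (Fin 3 → ℝ) => momentum p x.1 x.2)
      (f := fun x : (Fin 3 → ℝ) × (Fin 3 → ℝ) × (Fin 2 → ℝ) => (x.1, x.2.1))
      (by fun_prop)).const_mul σ
  have h2 := continuous_outputEnergy p a k
  exact (isClosed_Ici.preimage h0).inter ((isClosed_Iic.preimage h0).inter
    ((isClosed_Iic.preimage h2).inter ((isClosed_Ici.preimage h1).inter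
      (isClosed_Iic.preimage h1))))

/-- The tube does not mention the stance leg velocity; it is recovered from the momentum because
`gain` is bounded below there. -/
theorem exists_bound_of_mem_tube {lamC B a k M σ slo shi xlo c₀ ε : ℝ} (hB : ModelBound p lamC B)
    (hσ : σ = 1 ∨ σ = -1) (hc₀ : 0 < c₀) (hslo : 0 < slo) (ha : 1 ≤ a) (hk : 0 < k) (hM : 0 ≤ M)
    (hgain : ∀ q : Fin 3 → ℝ, xlo ≤ q 0 → q 0 ≤ p.q1ref → |q 2 - p.q3ref| ≤ ε →
      c₀ ≤ σ * gain p q)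
    (hMε : 6 * M / k ≤ ε) : ∃ ρ, ∀ x ∈ tube p a k M σ slo shi xlo,
      (∀ i, |x.1 i| ≤ ρ) ∧ (∀ i, |x.2.1 i| ≤ ρ) ∧ ∀ i, |x.2.2 i| ≤ ρ := by
  refine ⟨|xlo| + |p.q1ref| + |p.q3ref| + 6 * M / k
    + |shi / c₀ + 2 * B * (3 * M) / c₀| + 3 * M + 3 * M / k ^ 2, fun x hx => ?_⟩
  obtain ⟨h1, h2, h3, h4, h5, h6⟩ := abs_le_of_mem_tube p ha hk hM hx
  obtain ⟨-, -, hv⟩ := velocity_bounds p hB hσ hc₀ hslo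
    (hgain x.1 hx.1 hx.2.1 (h1.trans hMε)) h3 h4 hx.2.2.2.1 hx.2.2.2.2
  have hv' := hv.trans (le_abs_self _)
  have n1 := abs_nonneg xlo
  have n2 := abs_nonneg p.q1ref
  have n3 := abs_nonneg p.q3ref
  have n4 : 0 ≤ 6 * M / k := by positivity
  have n5 := abs_nonneg (shi / c₀ + 2 * B * (3 * M) / c₀)
  have n6 : 0 ≤ 3 * M / k ^ 2 := by positivity
  have hq0 : |x.1 0| ≤ |xlo| + |p.q1ref| := by
    rw [abs_le]
    constructor
    · linarith [hx.1, neg_abs_le xlo]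
    · linarith [hx.2.1, le_abs_self p.q1ref]
  have hq1 : |x.1 1| ≤ |x.1 0 + x.1 1| + |x.1 0| := by
    have := abs_sub (x.1 0 + x.1 1) (x.1 0)
    rwa [add_sub_cancel_left] at this
  have hq2 : |x.1 2| ≤ |x.1 2 - p.q3ref| + |p.q3ref| := by
    have := abs_add_le (x.1 2 - p.q3ref) p.q3ref
    rwa [sub_add_cancel] at this
  have hv1 : |x.2.1 1| ≤ |x.2.1 0 + x.2.1 1| + |x.2.1 0| := by
    have := abs_sub (x.2.1 0 + x.2.1 1) (x.2.1 0)
    rwa [add_sub_cancel_left] at this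
  have hw : ∀ y, |k ^ 2 * y| ≤ 3 * M → |y| ≤ 3 * M / k ^ 2 := by
    intro y hy
    rw [le_div_iff₀ (by positivity), mul_comm, ← abs_of_pos (by positivity : 0 < k ^ 2),
      ← abs_mul]
    exact hy
  refine ⟨fun i => ?_, fun i => ?_, fun i => ?_⟩
  · fin_cases i
    · change |x.1 0| ≤ _
      linarith
    · change |x.1 1| ≤ _
      linarith
    · change |x.1 2| ≤ _
      linarith
  · fin_cases i
    · change |x.2.1 0| ≤ _
      linarith
    · change |x.2.1 1| ≤ _
      linarith
    · change |x.2.1 2| ≤ _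
      linarith
  · fin_cases i
    · change |x.2.2 0| ≤ _
      linarith [hw _ h5]
    · change |x.2.2 1| ≤ _
      linarith [hw _ h6]

theorem isCompact_tube {lamC B a k M σ slo shi xlo c₀ ε : ℝ} (hB : ModelBound p lamC B)
    (hσ : σ = 1 ∨ σ = -1) (hc₀ : 0 < c₀) (hslo : 0 < slo) (ha : 1 ≤ a) (hk : 0 < k) (hM : 0 ≤ M)
    (hgain : ∀ q : Fin 3 → ℝ, xlo ≤ q 0 → q 0 ≤ p.q1ref → |q 2 - p.q3ref| ≤ ε →
      c₀ ≤ σ * gain p q)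
    (hMε : 6 * M / k ≤ ε) : IsCompact (tube p a k M σ slo shi xlo) := by
  refine Metric.isCompact_of_isClosed_isBounded (isClosed_tube p _ _ _ _ _ _ _) ?_
  obtain ⟨ρ, hρ⟩ := exists_bound_of_mem_tube p (slo := slo) (shi := shi) hB hσ hc₀ hslo ha hk hM
    hgain hMε
  refine (Metric.isBounded_closedBall (x := 0) (r := |ρ|)).subset fun x hx => ?_
  obtain ⟨h1, h2, h3⟩ := hρ x hx
  rw [mem_closedBall_zero_iff]
  have hn := abs_nonneg ρ
  have hle := le_abs_self ρ
  exact max_le ((pi_norm_le_iff_of_nonneg hn).2 fun i => (h1 i).trans hle)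
    (max_le ((pi_norm_le_iff_of_nonneg hn).2 fun i => (h2 i).trans hle)
      ((pi_norm_le_iff_of_nonneg hn).2 fun i => (h3 i).trans hle))

/-- The differential inequalities of the closed loop in the tube. -/
theorem exists_tube_derivatives {lamC B σ c₀ ε xlo : ℝ} {H : ℝ → ℝ} (hB : ModelBound p lamC B)
    (hσ : σ = 1 ∨ σ = -1) (hc₀ : 0 < c₀) (hε : 0 < ε) (hε1 : ε ≤ 1) (hxlo : -p.q1ref - 1 ≤ xlo)
    (hgain : ∀ q : Fin 3 → ℝ, xlo ≤ q 0 → q 0 ≤ p.q1ref → |q 2 - p.q3ref| ≤ ε →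
      c₀ ≤ σ * gain p q)
    (hH : ∀ x, HasDerivAt H (gain p (zeroConfig p x) * gravityMoment p (zeroConfig p x)) x) :
    ∃ (a c : ℝ) (ha : 1 ≤ a) (hc : 0 < c), ∀ slo shi : ℝ, 0 < slo → 0 < shi → ∃ C, 0 ≤ C ∧
      ∀ R, 0 < R → ∃ θ₀, 0 < θ₀ ∧ ∀ (k θ : ℝ) (hk : 1 ≤ k), 0 < θ → θ ≤ θ₀ → 1 ≤ k * θ →
      6 * (R * (k * θ)) / k ≤ ε ∧
      ∀ (q v : ℝ → Fin 3 → ℝ) (w : ℝ → Fin 2 → ℝ) (t : ℝ),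
      (q t, v t, w t) ∈ tube p a k (R * (k * θ)) σ slo shi xlo →
      HasDerivAt q (v t) t →
      HasDerivAt v (swingAcc p (q t) (v t) (control p
        (highGains (one_pos.trans_le ha) hc (one_pos.trans_le hk)) lamC (q t) (v t) (w t))) t →
      HasDerivAt w (integralRate p (q t) (v t) (w t)) t →
      ∃ x' E' Q', HasDerivAt (fun t => q t 0) x' t ∧
        HasDerivAt (fun t => (σ * momentum p (q t) (v t)) ^ 2 / 2 - H (q t 0)) E' t ∧
        HasDerivAt (fun t => outputEnergy p a k (q t) (v t) (w t)) Q' t ∧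
        Q' ≤ -(2 * (c / 32) * k) * outputEnergy p a k (q t) (v t) (w t) + C / k ∧
        |E'| ≤ C * √(outputEnergy p a k (q t) (v t) (w t)) ∧
        slo / B - C * √(outputEnergy p a k (q t) (v t) (w t)) ≤ x' ∧
        x' ≤ shi / c₀ + C * √(outputEnergy p a k (q t) (v t) (w t)) := by
  obtain ⟨a, c, ha, hc, hdecay⟩ := exists_outputEnergy_decay p hB
  have hB0 : 0 < B := one_pos.trans_le hB.one_le
  refine ⟨a, c, ha, hc, fun slo shi hslo hshi => ?_⟩
  refine ⟨144 * B ^ 2 / c + 6 * B / c₀ + (12 * B * shi / c₀ + 12 * B ^ 2 / c₀ + 6 * B ^ 2),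
    by positivity, fun R hR => ?_⟩
  set C := 144 * B ^ 2 / c + 6 * B / c₀ + (12 * B * shi / c₀ + 12 * B ^ 2 / c₀ + 6 * B ^ 2)
    with hC
  set G₀ := B * (shi / c₀ + 6 * B * R / c₀ + 6 * R) with hG₀
  have hG₀pos : 0 < G₀ := by positivity
  -- The first bound keeps the output within ε of zero. The second makes the connection, which may
  -- grow like kθ during the peak, small against the decay rate.
  refine ⟨min (ε / (6 * R)) (c / (384 * G₀)), by positivity, fun k θ hk hθ hθ0 hkθ => ?_⟩
  have hk0 : 0 < k := one_pos.trans_le hk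
  have hsm : 6 * (R * (k * θ)) / k ≤ ε := by
    have h := hθ0.trans (min_le_left _ _)
    rw [le_div_iff₀ (by positivity)] at h
    rw [div_le_iff₀ hk0]
    have := mul_le_mul_of_nonneg_left h hk0.le
    linarith
  refine ⟨hsm, fun q v w t hx hq hv hw => ?_⟩
  have hM : 0 ≤ R * (k * θ) := by positivity
  obtain ⟨h1, h2, -, -, -, -⟩ := abs_le_of_mem_tube p ha hk0 hM hx
  obtain ⟨h1', h2', h3, h4, -, -⟩ := abs_le_sqrt_outputEnergy p ha hk0 (q t) (v t) (w t)
  simp only at h1 h2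
  have hQM : √(outputEnergy p a k (q t) (v t) (w t)) ≤ R * (k * θ) :=
    Real.sqrt_le_iff.2 ⟨hM, hx.2.2.1⟩
  have hr0 := Real.sqrt_nonneg (outputEnergy p a k (q t) (v t) (w t))
  set r := √(outputEnergy p a k (q t) (v t) (w t)) with hr
  have hge := hgain (q t) hx.1 hx.2.1 (h1.trans hsm)
  obtain ⟨hv1, hv2, hv3⟩ := velocity_bounds p hB hσ hc₀ hslo hge h3 h4 hx.2.2.2.1 hx.2.2.2.2
  have hgne : gain p (q t) ≠ 0 := by
    intro h
    rw [h, mul_zero] at hge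
    linarith
  have hq0 : |q t 0| ≤ p.q1ref + 1 := abs_le.2 ⟨by linarith [hx.1], by linarith [hx.2.1]⟩
  have hΓ : ∀ i j, |errorConnection p (q t) (v t) i j| ≤ G₀ * (k * θ) := by
    intro i j
    refine (hB.errorConnection_le _ _ i j).trans ?_
    rw [hG₀, mul_assoc]
    refine mul_le_mul_of_nonneg_left ?_ hB0.le
    have e1 : 2 * B * (3 * r) / c₀ ≤ 6 * B * R / c₀ * (k * θ) := by
      rw [div_mul_eq_mul_div]
      have := mul_le_mul_of_nonneg_left hQM hB0.le
      exact div_le_div_of_nonneg_right (by linarith) hc₀.le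
    have e2 : shi / c₀ ≤ shi / c₀ * (k * θ) := le_mul_of_one_le_right (by positivity) hkθ
    linarith
  have hG : 24 * (G₀ * (k * θ)) ≤ k * (c / 16) := by
    have h := hθ0.trans (min_le_right _ _)
    rw [le_div_iff₀ (by positivity)] at h
    have := mul_le_mul_of_nonneg_left h hk0.le
    linarith
  obtain ⟨Q', hQ', hQle⟩ := hdecay k hk0 (G₀ * (k * θ)) t q v w hG hgne hq0
    (h1.trans (hsm.trans hε1)) (h2.trans (hsm.trans hε1)) hΓ hq hv hw
  have hmom := hasDerivWithinAt_momentum p (s := univ) hq.hasDerivWithinAt hv.hasDerivWithinAt rfl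
  rw [hasDerivWithinAt_univ] at hmom
  have hq0' := hasDerivAt_pi.1 hq 0
  have hCk : 144 * B ^ 2 / c / k ≤ C / k := by
    have : 144 * B ^ 2 / c ≤ C := by
      rw [hC, add_assoc]
      exact le_add_of_nonneg_right (by positivity)
    gcongr
  have hCv : 2 * B * (3 * r) / c₀ ≤ C * r := by
    have e : 2 * B * (3 * r) / c₀ = 6 * B / c₀ * r := by ring
    rw [e]
    refine mul_le_mul_of_nonneg_right ?_ hr0
    rw [hC, add_right_comm]
    exact le_add_of_nonneg_left (by positivity)
  refine ⟨v t 0, _, Q', hq0', (((hmom.const_mul σ).pow 2).div_const 2).sub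
    ((hH (q t 0)).comp t hq0'), hQ', by linarith, ?_, by linarith, by linarith⟩
  set gz := gain p (zeroConfig p (q t 0)) * gravityMoment p (zeroConfig p (q t 0)) with hgz
  have hσ2 : σ ^ 2 = 1 := by rcases hσ with rfl | rfl <;> norm_num
  -- The rate of the conserved quantity is a sum of two products, each with a factor that vanishes
  -- on the zero dynamics manifold.
  have heq : (2 : ℕ) * (σ * momentum p (q t) (v t)) ^ (2 - 1) * (σ * gravityMoment p (q t)) / 2
      - gz * v t 0 = v t 0 * (gain p (q t) * gravityMoment p (q t) - gz)
        + (momentum p (q t) (v t) - gain p (q t) * v t 0) * gravityMoment p (q t) := by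
    push_cast
    simp only [pow_one]
    linear_combination momentum p (q t) (v t) * gravityMoment p (q t) * hσ2
  rw [heq]
  refine (abs_add_le _ _).trans ?_
  rw [abs_mul, abs_mul]
  have f1 := (hB.momentum_sub_le (q t) (v t)).trans
    (mul_le_mul_of_nonneg_left (add_le_add h3 h4) hB0.le)
  have f2 := mul_le_mul f1 (hB.gravityMoment_le (q t)) (abs_nonneg _) (by positivity)
  have f3 := hB.power_sub_le (q t)
  -- The velocity bound is a constant plus a multiple of r. The output is estimated by 12r against
  -- the constant, but only by 2 against r, so that the final bound is linear in r.
  have f4 : |q t 2 - p.q3ref| + |q t 0 + q t 1| ≤ 2 := by linarith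
  have f5 : |q t 2 - p.q3ref| + |q t 0 + q t 1| ≤ 12 * r := by
    have : 6 * r / k ≤ 6 * r := div_le_self (by positivity) hk
    linarith
  have f6 := mul_le_mul hv3 f3 (abs_nonneg _) ((abs_nonneg _).trans hv3)
  have f7 : shi / c₀ * (B * (|q t 2 - p.q3ref| + |q t 0 + q t 1|)) ≤ shi / c₀ * (B * (12 * r)) := by
    gcongr
  have f8 : 2 * B * (3 * r) / c₀ * (B * (|q t 2 - p.q3ref| + |q t 0 + q t 1|))
      ≤ 2 * B * (3 * r) / c₀ * (B * 2) := by gcongr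
  have f9 : (12 * B * shi / c₀ + 12 * B ^ 2 / c₀ + 6 * B ^ 2) * r ≤ C * r := by
    refine mul_le_mul_of_nonneg_right ?_ hr0
    rw [hC]
    exact le_add_of_nonneg_left (by positivity)
  have f10 : (12 * B * shi / c₀ + 12 * B ^ 2 / c₀ + 6 * B ^ 2) * r
      = shi / c₀ * (B * (12 * r)) + 2 * B * (3 * r) / c₀ * (B * 2) + B * (3 * r + 3 * r) * B := by
    ring
  rw [f10] at f9
  linarith

end Biped

/-! ### Uniform constants near the zero dynamics -/

/-- Only one of the two points has to lie in the compact set: here that set is the manifold of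
pre-impact states, and the other point is a true state near it. -/
theorem IsCompact.exists_forall_dist_lt_abs_sub_lt {X : Type*} [PseudoMetricSpace X] {s : Set X}
    (hs : IsCompact s) {f : X → ℝ} (hf : Continuous f) {e : ℝ} (he : 0 < e) :
    ∃ d > 0, ∀ x ∈ s, ∀ y, dist y x < d → |f y - f x| < e := by
  have h := hs.uniformContinuousAt_of_continuousAt f (fun x _ => hf.continuousAt)
    (Metric.dist_mem_uniformity he)
  obtain ⟨d, hd, h⟩ := Metric.mem_uniformity_dist.1 h
  refine ⟨d, hd, fun x hx y hxy => ?_⟩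
  have := h (by rwa [dist_comm] at hxy) hx
  rwa [mem_ofPred_eq, dist_comm, Real.dist_eq] at this

/-- The difference of squares factors, and since both momenta have the same sign their sum is at
least slo; thus closeness of energies gives closeness of momenta and then of speeds. -/
theorem abs_sub_le_of_energy_sub_le {g g₁ b v s slo c₀ r₁ r₂ e : ℝ} (hc₀ : 0 < c₀) (hslo : 0 < slo)
    (hg : c₀ ≤ g) (hs : slo ≤ s) (hb : 0 ≤ b) (hg₁ : 0 ≤ g₁) (h1 : |g * v - s| ≤ r₁)
    (h2 : |g - g₁| ≤ r₂) (h3 : |s ^ 2 / 2 - (g₁ * b) ^ 2 / 2| ≤ e) :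
    |v - b| ≤ (2 * e / slo + r₁ + b * r₂) / c₀ := by
  rw [le_div_iff₀ hc₀]
  have h4 : |s - g₁ * b| ≤ 2 * e / slo := by
    rw [le_div_iff₀ hslo]
    have h5 : s ^ 2 / 2 - (g₁ * b) ^ 2 / 2 = (s - g₁ * b) * (s + g₁ * b) / 2 := by ring
    have h6 : slo ≤ s + g₁ * b := by
      have := mul_nonneg hg₁ hb
      linarith
    rw [h5, abs_div, abs_mul, abs_two, abs_of_pos (hslo.trans_le h6)] at h3
    have := mul_le_mul_of_nonneg_left h6 (abs_nonneg (s - g₁ * b))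
    linarith
  have h7 : (v - b) * g = (g * v - s) + (s - g₁ * b) - b * (g - g₁) := by ring
  have h8 : |v - b| * g ≤ 2 * e / slo + r₁ + b * r₂ := by
    rw [← abs_of_pos (hc₀.trans_le hg), ← abs_mul, h7]
    refine (abs_sub _ _).trans ?_
    have := abs_add_le (g * v - s) (s - g₁ * b)
    rw [abs_mul b, abs_of_nonneg hb]
    have := mul_le_mul_of_nonneg_left h2 hb
    linarith
  exact (mul_le_mul_of_nonneg_left hg (abs_nonneg _)).trans h8

theorem eventually_mul_lt_nhdsGT_zero (A : ℝ) {e : ℝ} (he : 0 < e) :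
    ∀ᶠ d in 𝓝[>] (0 : ℝ), A * d < e := by
  have h : Tendsto (fun d : ℝ => A * d) (𝓝[>] 0) (𝓝 (A * 0)) :=
    ((continuous_const.mul continuous_id).tendsto 0).mono_left nhdsWithin_le_nhds
  rw [mul_zero] at h
  exact h.eventually (gt_mem_nhds he)

/-- The size of the output after a fixed positive time: the initial peak grows like k, but the decay
is exponential in k. -/
theorem tendsto_mul_exp_neg_add_div (A D : ℝ) {b : ℝ} (hb : 0 < b) :
    Tendsto (fun k : ℝ => A * k * exp (-(b * k)) + D / k) atTop (𝓝 0) := by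
  have h1 : Tendsto (fun k : ℝ => (b * k) ^ 1 * exp (-(b * k))) atTop (𝓝 0) :=
    (tendsto_pow_mul_exp_neg_atTop_nhds_zero 1).comp (tendsto_id.const_mul_atTop hb)
  have h2 := (h1.const_mul (A / b)).add ((tendsto_const_nhds (x := D)).div_atTop tendsto_id)
  rw [mul_zero, add_zero] at h2
  refine h2.congr fun k => ?_
  simp only [id, pow_one]
  field_simp

namespace Biped

variable (p : Params)

theorem continuous_zeroVel : Continuous zeroVel := by
  refine continuous_pi fun i => ?_
  fin_cases i <;> simp [zeroVel] <;> fun_prop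

/-- The angular momentum just after an impact. -/
noncomputable def postMomentum (x : (Fin 3 → ℝ) × (Fin 3 → ℝ)) : ℝ :=
  momentum p (reset p x).1 (reset p x).2

theorem continuous_postMomentum : Continuous (postMomentum p) :=
  (continuous_momentum p).comp (continuous_reset p)

theorem reset_fst (x : (Fin 3 → ℝ) × (Fin 3 → ℝ)) : (reset p x).1 = ![x.1 1, x.1 0, x.1 2] :=
  relabel_mulVec _

theorem reset_zeroConfig (a : ℝ) :
    (reset p (zeroConfig p p.q1ref, zeroVel a)).1 = zeroConfig p (-p.q1ref) := by
  rw [reset_fst]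
  ext i
  fin_cases i <;> simp [zeroConfig]

theorem stepMomentum_eq (a : ℝ) :
    stepMomentum p a = postMomentum p (zeroConfig p p.q1ref, zeroVel a) := by
  rw [stepMomentum, postMomentum, reset_zeroConfig]

theorem continuous_stepMomentum : Continuous (stepMomentum p) := by
  have : stepMomentum p = fun a => postMomentum p (zeroConfig p p.q1ref, zeroVel a) :=
    funext fun a => stepMomentum_eq p a
  rw [this]
  exact (continuous_postMomentum p).comp (continuous_const.prodMk continuous_zeroVel)

/-- Uniform bounds of the kinetic term of the zero dynamics along the steps that start in `V`. -/
theorem exists_energy_bounds {σ c₀ ε : ℝ} {H : ℝ → ℝ} {V : Set ℝ} (hσ : σ = 1 ∨ σ = -1)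
    (hc₀ : 0 < c₀) (hε : 0 < ε) (hε1 : ε ≤ 1)
    (hgain : ∀ x ∈ Icc (-p.q1ref) p.q1ref, c₀ ≤ σ * gain p (zeroConfig p x))
    (hH : ∀ x, HasDerivAt H (gain p (zeroConfig p x) * gravityMoment p (zeroConfig p x)) x)
    (hVc : IsCompact V) (hVne : V.Nonempty) (hgait : ∀ a ∈ V, ∃ b ∈ interior V, ZeroDynStep p a b) :
    ∃ ε₁ tol slo shi, 0 < ε₁ ∧ ε₁ ≤ ε ∧ 0 < tol ∧ 0 < slo ∧ 0 < shi ∧ ∀ a ∈ V,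
      slo < σ * stepMomentum p a ∧
      ∀ E, |E - (stepMomentum p a ^ 2 / 2 - H (-p.q1ref))| ≤ tol →
        ∀ y ∈ Icc (-p.q1ref - ε₁) p.q1ref, 2 * slo ^ 2 ≤ E + H y ∧ E + H y ≤ shi ^ 2 / 4 := by
  have hq := p.q1ref_pos
  have hHc : Continuous H := continuous_iff_continuousAt.2 fun x => (hH x).continuousAt
  have hne : ∀ x ∈ Icc (-p.q1ref) p.q1ref, gain p (zeroConfig p x) ≠ 0 := by
    intro x hx h
    have := hgain x hx
    rw [h, mul_zero] at this
    linarith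
  set f : ℝ × ℝ → ℝ := fun z => stepMomentum p z.1 ^ 2 / 2 - H (-p.q1ref) + H z.2 with hf
  have hfc : Continuous f := ((((continuous_stepMomentum p).comp continuous_fst).pow 2).div_const
    2 |>.sub continuous_const).add (hHc.comp continuous_snd)
  have hpos : ∀ a ∈ V, ∀ x ∈ Icc (-p.q1ref) p.q1ref, 0 < f (a, x) := by
    intro a ha x hx
    obtain ⟨b, -, hab⟩ := hgait a ha
    exact (hab.conservation hH).2.2.2 x hx (hne x hx)
  have hmem : -p.q1ref ∈ Icc (-p.q1ref) p.q1ref := ⟨le_rfl, by linarith⟩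
  obtain ⟨a₀, ha₀⟩ := hVne
  -- Compactness turns the pointwise positivity of the kinetic term into a uniform lower bound m.
  obtain ⟨z₀, hz₀, hmin⟩ := (hVc.prod (isCompact_Icc (a := -p.q1ref) (b := p.q1ref))).exists_isMinOn
    ⟨(a₀, -p.q1ref), ha₀, hmem⟩ hfc.continuousOn
  obtain ⟨M, hM⟩ := (hVc.prod (isCompact_Icc (a := -p.q1ref - 1)
    (b := p.q1ref))).exists_bound_of_continuousOn hfc.continuousOn
  set m := f z₀ with hm
  have hm0 : 0 < m := hpos _ hz₀.1 _ hz₀.2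
  -- With a nonzero output the swing starts near -q₁ref rather than at it, so the bounds are
  -- extended a little to the left.
  obtain ⟨ε₂, hε₂, hnear⟩ := Metric.continuousAt_iff.1 (hHc.continuousAt (x := -p.q1ref)) (m / 4)
    (by positivity)
  -- Then 2 slo² = m/2, which is what remains of m after m/4 for the extension to the left and m/4
  -- for the tolerance in `E`.
  set slo := √m / 2 with hslo
  have hslo0 : 0 < slo := by positivity
  have hslo2 : 2 * slo ^ 2 = m / 2 := by
    rw [hslo, div_pow, Real.sq_sqrt hm0.le]
    ring
  have hkin : ∀ a ∈ V, ∀ E, |E - (stepMomentum p a ^ 2 / 2 - H (-p.q1ref))| ≤ m / 4 →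
      ∀ y ∈ Icc (-p.q1ref - min ε (ε₂ / 2)) p.q1ref, 2 * slo ^ 2 ≤ E + H y ∧
        E + H y ≤ (2 * (|M| + m + 1)) ^ 2 / 4 := by
    intro a ha E hE y hy
    rw [abs_le] at hE
    have hε3 := min_le_left ε (ε₂ / 2)
    have hε4 := min_le_right ε (ε₂ / 2)
    constructor
    · have h1 : m - m / 4 ≤ f (a, y) := by
        rcases le_total (-p.q1ref) y with h | h
        · have := hmin (show (a, y) ∈ V ×ˢ Icc (-p.q1ref) p.q1ref from ⟨ha, h, hy.2⟩)
          have h2 : m ≤ f (a, y) := this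
          linarith
        · have h2 : m ≤ f (a, -p.q1ref) :=
            hmin (show (a, -p.q1ref) ∈ V ×ˢ Icc (-p.q1ref) p.q1ref from ⟨ha, hmem⟩)
          have h3 := hnear (x := y) (by
            rw [Real.dist_eq, abs_lt]
            constructor <;> linarith [hy.1])
          rw [Real.dist_eq, abs_lt] at h3
          simp only [hf] at h2 ⊢
          linarith
      rw [hslo2]
      simp only [hf] at h1
      linarith
    · have h1 : f (a, y) ≤ M := (le_abs_self _).trans
        (hM (a, y) ⟨ha, by linarith [hy.1], hy.2⟩)
      have h2 := le_abs_self M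
      have h3 := abs_nonneg M
      have h4 : (2 * (|M| + m + 1)) ^ 2 / 4 = (|M| + m + 1) ^ 2 := by ring
      have h5 : |M| + m + 1 ≤ (|M| + m + 1) ^ 2 := le_self_pow₀ (by linarith) two_ne_zero
      rw [h4]
      simp only [hf] at h1
      linarith
  refine ⟨min ε (ε₂ / 2), m / 4, slo, 2 * (|M| + m + 1), by positivity, min_le_left _ _,
    by positivity, hslo0, by positivity, fun a ha => ⟨?_, hkin a ha⟩⟩
  obtain ⟨b, -, hab⟩ := hgait a ha
  obtain ⟨-, ⟨y, hy, hy'⟩, -⟩ := hab.conservation hH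
  have h1 := (hkin a ha _ (by rw [sub_self, abs_zero]; positivity) (-p.q1ref)
    ⟨by linarith [lt_min hε (half_pos hε₂)], hmem.2⟩).1
  have h2 : 0 < σ * stepMomentum p a := by
    rw [hy', ← mul_assoc]
    exact mul_pos (hc₀.trans_le (hgain _ hmem)) hy
  refine lt_of_pow_lt_pow_left₀ 2 h2.le ?_
  have hσ2 : σ ^ 2 = 1 := by rcases hσ with rfl | rfl <;> norm_num
  rw [mul_pow, hσ2, one_mul]
  have : 0 < slo ^ 2 := by positivity
  linarith

/-- The zero dynamics return to the interior of `V` with a uniform margin. -/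
theorem exists_return_margin {σ c₀ : ℝ} {H : ℝ → ℝ} {V : Set ℝ} (hσ : σ = 1 ∨ σ = -1)
    (hc₀ : 0 < c₀) (hgain : c₀ ≤ σ * gain p (zeroConfig p p.q1ref))
    (hH : ∀ x, HasDerivAt H (gain p (zeroConfig p x) * gravityMoment p (zeroConfig p x)) x)
    (hVc : IsCompact V) (hgait : ∀ a ∈ V, ∃ b ∈ interior V, ZeroDynStep p a b) :
    ∃ ρ > 0, ∀ a ∈ V, ∃ b > 0, (σ * gain p (zeroConfig p p.q1ref) * b) ^ 2 / 2
      = stepMomentum p a ^ 2 / 2 - H (-p.q1ref) + H p.q1ref ∧ ∀ y, |y - b| < ρ → y ∈ V := by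
  set g := σ * gain p (zeroConfig p p.q1ref) with hg
  have hg0 : 0 < g := hc₀.trans_le hgain
  have hσ2 : σ ^ 2 = 1 := by rcases hσ with rfl | rfl <;> norm_num
  -- The conservation law determines the next speed by an explicit continuous formula. The image of
  -- V is then compact inside the open interior of V, and a thickening of it gives the margin.
  set β : ℝ → ℝ := fun a => √(2 * (stepMomentum p a ^ 2 / 2 - H (-p.q1ref) + H p.q1ref)) / g
    with hβ
  have hβc : Continuous β := by
    have := continuous_stepMomentum p
    fun_prop
  have hb : ∀ a ∈ V, β a ∈ interior V ∧ 0 < β a ∧ (g * β a) ^ 2 / 2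
      = stepMomentum p a ^ 2 / 2 - H (-p.q1ref) + H p.q1ref := by
    intro a ha
    obtain ⟨b, hbV, hab⟩ := hgait a ha
    obtain ⟨hb0, -, h, -⟩ := hab.conservation hH
    have h1 : (g * b) ^ 2 / 2 = stepMomentum p a ^ 2 / 2 - H (-p.q1ref) + H p.q1ref := by
      rw [← h, hg, mul_assoc, mul_pow σ, hσ2, one_mul]
    have h2 : β a = b := by
      simp only [hβ]
      rw [← h1, mul_div_cancel₀ _ two_ne_zero, Real.sqrt_sq (by positivity),
        mul_div_cancel_left₀ _ hg0.ne']
    rw [h2]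
    exact ⟨hbV, hb0, h1⟩
  obtain ⟨ρ, hρ, hsub⟩ := (hVc.image hβc).exists_thickening_subset_open isOpen_interior
    (image_subset_iff.2 fun a ha => (hb a ha).1)
  refine ⟨ρ, hρ, fun a ha => ⟨β a, (hb a ha).2.1, (hb a ha).2.2, fun y hy => ?_⟩⟩
  exact interior_subset (hsub (Metric.mem_thickening_iff.2 ⟨β a, mem_image_of_mem _ ha, hy⟩))

/-- Near the zero dynamics manifold the output is bounded by `eta`. -/
theorem exists_output_le : ∃ A, 0 ≤ A ∧ ∀ δ, 0 ≤ δ → ∀ q v, (q, v) ∈ Zdelta p δ →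
    |q 2 - p.q3ref| ≤ A * δ ∧ |q 0 + q 1| ≤ A * δ ∧ |v 2| ≤ δ ∧ |v 0 + v 1| ≤ δ := by
  have hl := p.l_pos
  have hr := p.r_pos
  have hpi := Real.pi_pos
  have hD : 0 < 4 * p.MH + 4 * p.MT + 5 * p.m := by linarith [p.MH_pos, p.MT_pos, p.m_pos]
  set D := 4 * p.MH + 4 * p.MT + 5 * p.m with hDd
  -- Jordan's inequality, |sin x| ≥ (2/π)|x| for |x| ≤ π/2, is where the restriction of the
  -- neighbourhood to output errors below π/2 enters.
  refine ⟨π / 2 * ((p.l ^ 2 + p.r ^ 2) * D), by positivity, fun δ hδ q v h => ?_⟩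
  obtain ⟨h1, h2⟩ := h
  rw [Real.sqrt_le_iff] at h2
  simp only [Fin.sum_univ_two, omegaE, outputJacobian_mulVec, Matrix.cons_val_zero,
    Matrix.cons_val_one, Matrix.cons_val_fin_one] at h2
  have n1 := sq_nonneg (eta p q 0)
  have n2 := sq_nonneg (eta p q 1)
  have n3 := sq_nonneg (v 2)
  have n4 := sq_nonneg (v 0 + v 1)
  have e1 : |eta p q 0| ≤ δ := abs_le_of_sq_le_sq (by linarith) hδ
  have e2 : |eta p q 1| ≤ δ := abs_le_of_sq_le_sq (by linarith) hδ
  have key : ∀ e b : ℝ, 0 < b → b ≤ p.l ^ 2 + p.r ^ 2 → |e| < π / 2 →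
      |sin e / (b * errorFactor p q)| ≤ δ → |e| ≤ π / 2 * ((p.l ^ 2 + p.r ^ 2) * D) * δ := by
    intro e b hb hb' he h
    have hf := errorFactor_pos p q
    rw [abs_div, abs_of_pos (by positivity : 0 < b * errorFactor p q),
      div_le_iff₀ (by positivity)] at h
    have h3 := Real.mul_abs_le_abs_sin he.le
    have h4 : b * errorFactor p q ≤ (p.l ^ 2 + p.r ^ 2) * D :=
      mul_le_mul hb' (errorFactor_le p q) hf.le (by positivity)
    have h5 := mul_le_mul_of_nonneg_left h4 hδ
    have h6 : |e| = π / 2 * (2 / π * |e|) := by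
      field_simp
    rw [h6, mul_assoc]
    refine mul_le_mul_of_nonneg_left ?_ (by positivity)
    linarith
  have hl2 : 0 < p.l ^ 2 := by positivity
  have hr2 : 0 < p.r ^ 2 := by positivity
  have o1 := h1 0
  have o2 := h1 1
  simp only [output, Matrix.cons_val_zero, Matrix.cons_val_one, Matrix.cons_val_fin_one] at o1 o2
  rw [eta_eq] at e1 e2
  simp only [Matrix.cons_val_zero, Matrix.cons_val_one, Matrix.cons_val_fin_one] at e1 e2
  exact ⟨key _ _ hl2 (by linarith) o1 e1, key _ _ hr2 (by linarith) o2 e2,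
    abs_le_of_sq_le_sq (by linarith) hδ, abs_le_of_sq_le_sq (by linarith) hδ⟩

/-- A continuous function of the pre-impact state is close to its value on the zero dynamics
manifold. -/
theorem eventually_abs_sub_zeroDyn_lt {V : Set ℝ} (hVc : IsCompact V)
    {f : (Fin 3 → ℝ) × (Fin 3 → ℝ) → ℝ} (hf : Continuous f) {e : ℝ} (he : 0 < e) :
    ∀ᶠ δ in 𝓝[>] 0, ∀ q v, (q, v) ∈ switchingSurface p ∩ Zdelta p δ → v 0 ∈ V →
      |f (q, v) - f (zeroConfig p p.q1ref, zeroVel (v 0))| < e := by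
  obtain ⟨A, hA, hout⟩ := exists_output_le p
  have hK : IsCompact ((fun a => (zeroConfig p p.q1ref, zeroVel a)) '' V) :=
    hVc.image (continuous_const.prodMk continuous_zeroVel)
  obtain ⟨d, hd, h⟩ := hK.exists_forall_dist_lt_abs_sub_lt hf he
  filter_upwards [eventually_mul_lt_nhdsGT_zero (A + 1) hd, self_mem_nhdsWithin] with δ hδ hδ0
  rintro q v ⟨hS, hZ⟩ hv
  refine h _ (mem_image_of_mem _ hv) _ ?_
  have hδ0' : 0 < δ := hδ0
  obtain ⟨h1, h2, h3, h4⟩ := hout δ hδ0'.le q v hZ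
  have hS' : q 0 = p.q1ref := hS
  have hAδ : 0 ≤ A * δ := by positivity
  have hd' : A * δ + δ < d := by linarith
  rw [Prod.dist_eq, max_lt_iff, dist_pi_lt_iff hd, dist_pi_lt_iff hd]
  constructor
  · intro i
    rw [Real.dist_eq]
    fin_cases i
    · simpa [zeroConfig, hS'] using hd
    · simp only [zeroConfig, Fin.mk_one, Matrix.cons_val_one, Matrix.cons_val_zero]
      rw [← hS', sub_neg_eq_add, add_comm]
      linarith
    · change |q 2 - p.q3ref| < d
      linarith
  · intro i
    rw [Real.dist_eq]
    fin_cases i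
    · simpa [zeroVel] using hd
    · simp only [zeroVel, Fin.mk_one, Matrix.cons_val_one, Matrix.cons_val_zero]
      rw [sub_neg_eq_add, add_comm]
      linarith
    · change |v 2 - 0| < d
      rw [sub_zero]
      linarith

/-- The velocities after an impact near the zero dynamics manifold are bounded. -/
theorem exists_reset_snd_le {V : Set ℝ} (hVc : IsCompact V) :
    ∃ A, 0 ≤ A ∧ ∀ᶠ δ in 𝓝[>] 0, ∀ q v, (q, v) ∈ switchingSurface p ∩ Zdelta p δ → v 0 ∈ V →
      ∀ i, |(reset p (q, v)).2 i| ≤ A := by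
  have hc : ∀ i, Continuous fun x => (reset p x).2 i := fun i =>
    (continuous_apply i).comp (continuous_snd.comp (continuous_reset p))
  have hz : Continuous fun a => (reset p (zeroConfig p p.q1ref, zeroVel a)).2 :=
    continuous_snd.comp ((continuous_reset p).comp (continuous_const.prodMk continuous_zeroVel))
  obtain ⟨M, hM⟩ := hVc.exists_bound_of_continuousOn hz.continuousOn
  refine ⟨|M| + 1, by positivity, ?_⟩
  have hev := eventually_all.2 fun i => eventually_abs_sub_zeroDyn_lt p hVc (hc i) one_pos
  filter_upwards [hev] with δ hδ q v hqv hv i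
  have h1 := hδ i q v hqv hv
  have h2 := (norm_le_pi_norm _ i).trans ((hM (v 0) hv).trans (le_abs_self M))
  rw [Real.norm_eq_abs] at h2
  have h3 := abs_sub_abs_le_abs_sub ((reset p (q, v)).2 i)
    ((reset p (zeroConfig p p.q1ref, zeroVel (v 0))).2 i)
  linarith

end Biped

/-! ### One swing phase, from impact to impact -/

namespace Biped

variable (p : Params)

/-- The states before an impact from which the next swing phase is controlled. -/
structure PreImpact (V : Set ℝ) (δ ρ : ℝ) (q v : Fin 3 → ℝ) (w : Fin 2 → ℝ) : Prop where
  mem : (q, v) ∈ switchingSurface p ∩ Zdelta p δ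
  velocity : v 0 ∈ V
  integral : ∀ i, |w i| ≤ ρ

/-- The estimates of the swing phase. -/
theorem swing_estimates {lamC B σ c₀ xlo a k δ μ C R W T Tm slo shi : ℝ} {H : ℝ → ℝ}
    {K : Gains} (hB : 0 ≤ slo / B) (hHc : Continuous H)
    (hk1 : 1 ≤ k) (hkδ : 1 ≤ k * δ) (hμ : 0 < μ) (hC : 0 ≤ C)
    (hR : 0 < R) (hRC : C / (2 * μ) ≤ R ^ 2 / 2)
    (hW : W = C * (R / (2 * μ) + √(C / (2 * μ)) * Tm)) (hslo : 0 < slo) (hshi : 0 < shi)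
    (hder : ∀ (q v : ℝ → Fin 3 → ℝ) (w : ℝ → Fin 2 → ℝ) (t : ℝ),
      (q t, v t, w t) ∈ tube p a k (R * (k * δ)) σ slo shi xlo → HasDerivAt q (v t) t →
      HasDerivAt v (swingAcc p (q t) (v t) (control p K lamC (q t) (v t) (w t))) t →
      HasDerivAt w (integralRate p (q t) (v t) (w t)) t →
      ∃ x' E' Q', HasDerivAt (fun t => q t 0) x' t ∧
        HasDerivAt (fun t => (σ * momentum p (q t) (v t)) ^ 2 / 2 - H (q t 0)) E' t ∧
        HasDerivAt (fun t => outputEnergy p a k (q t) (v t) (w t)) Q' t ∧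
        Q' ≤ -(2 * μ * k) * outputEnergy p a k (q t) (v t) (w t) + C / k ∧
        |E'| ≤ C * √(outputEnergy p a k (q t) (v t) (w t)) ∧
        slo / B - C * √(outputEnergy p a k (q t) (v t) (w t)) ≤ x' ∧
        x' ≤ shi / c₀ + C * √(outputEnergy p a k (q t) (v t) (w t)))
    {q v : ℝ → Fin 3 → ℝ} {w : ℝ → Fin 2 → ℝ} (hTm : T ≤ Tm)
    (hq : ContinuousOn q (Icc 0 T)) (hv : ContinuousOn v (Icc 0 T))
    (hw : ContinuousOn w (Icc 0 T)) (hxhi : ∀ t ∈ Icc 0 T, q t 0 ≤ p.q1ref)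
    (hsol : ∀ t ∈ Ioo 0 T, (q t, v t, w t) ∈ tube p a k (R * (k * δ)) σ slo shi xlo →
      HasDerivAt q (v t) t ∧
      HasDerivAt v (swingAcc p (q t) (v t) (control p K lamC (q t) (v t) (w t))) t ∧
      HasDerivAt w (integralRate p (q t) (v t) (w t)) t)
    (hQ0 : outputEnergy p a k (q 0) (v 0) (w 0) ≤ (R / 2 * (k * δ)) ^ 2)
    (hs0 : slo ≤ σ * momentum p (q 0) (v 0))
    (henergy : ∀ y ∈ Icc xlo p.q1ref,
      2 * slo ^ 2 ≤ (σ * momentum p (q 0) (v 0)) ^ 2 / 2 - H (q 0 0) + H y ∧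
      (σ * momentum p (q 0) (v 0)) ^ 2 / 2 - H (q 0 0) + H y ≤ shi ^ 2 / 4)
    (hsmall : W * δ ≤ slo ^ 2) (hx0 : xlo + W * δ < q 0 0) :
    ∀ t ∈ Icc 0 T, (q t, v t, w t) ∈ tube p a k (R * (k * δ)) σ slo shi xlo ∧
      √(outputEnergy p a k (q t) (v t) (w t))
        ≤ R / 2 * (k * δ) * exp (-(μ * k * t)) + √(C / (2 * μ)) / k ∧
      |(σ * momentum p (q t) (v t)) ^ 2 / 2 - H (q t 0)
        - ((σ * momentum p (q 0) (v 0)) ^ 2 / 2 - H (q 0 0))| ≤ W * δ ∧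
      q 0 0 + slo / B * t - W * δ ≤ q t 0 ∧ q t 0 ≤ q 0 0 + shi / c₀ * t + W * δ := by
  have hk : 0 < k := one_pos.trans_le hk1
  have hxc : ContinuousOn (fun t => q t 0) (Icc 0 T) := continuousOn_pi.1 hq 0
  have hsc : ContinuousOn (fun t => σ * momentum p (q t) (v t)) (Icc 0 T) := by
    have h := (continuous_momentum p).comp_continuousOn (s := Icc 0 T)
      (g := fun x : (Fin 3 → ℝ) × (Fin 3 → ℝ) => momentum p x.1 x.2)
      (f := fun t => (q t, v t)) (hq.prodMk hv)
    exact continuousOn_const.mul h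
  have hQc : ContinuousOn (fun t => outputEnergy p a k (q t) (v t) (w t)) (Icc 0 T) :=
    (continuous_outputEnergy p a k).comp_continuousOn (s := Icc 0 T)
      (g := fun x : (Fin 3 → ℝ) × (Fin 3 → ℝ) × (Fin 2 → ℝ) => outputEnergy p a k x.1 x.2.1 x.2.2)
      (f := fun t => (q t, v t, w t)) (hq.prodMk (hv.prodMk hw))
  have hd := fun t (ht : t ∈ Ioo 0 T) (h1 : xlo ≤ q t 0) (h2 : q t 0 ≤ p.q1ref)
      (h3 : outputEnergy p a k (q t) (v t) (w t) ≤ (R * (k * δ)) ^ 2)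
      (h4 : slo ≤ σ * momentum p (q t) (v t)) (h5 : σ * momentum p (q t) (v t) ≤ shi) =>
    have hm : (q t, v t, w t) ∈ tube p a k (R * (k * δ)) σ slo shi xlo := ⟨h1, h2, h3, h4, h5⟩
    have h := hsol t ht hm
    hder q v w t hm h.1 h.2.1 h.2.2
  have htube := mem_tube (x := fun t => q t 0) (s := fun t => σ * momentum p (q t) (v t))
    (Q := fun t => outputEnergy p a k (q t) (v t) (w t)) (H := H) (xlo := xlo) (xhi := p.q1ref)
    (slo := slo) (shi := shi) (vlo := slo / B) (vhi := shi / c₀) hk1 hkδ hμ hC hR hRC hW hTm hB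
    hslo hshi hxc hsc hQc hHc hQ0 hs0 hxhi henergy hsmall hx0 hd
  intro t ht
  obtain ⟨h1, -, h2, h3, h4⟩ := tube_estimates (x := fun t => q t 0)
    (s := fun t => σ * momentum p (q t) (v t))
    (Q := fun t => outputEnergy p a k (q t) (v t) (w t)) (H := H) (xlo := xlo) (xhi := p.q1ref)
    (slo := slo) (shi := shi) (vlo := slo / B) (vhi := shi / c₀) hk hkδ hμ hC hR hW hTm hxc hsc
    hQc hHc hQ0 hd htube ht
  exact ⟨htube t ht, h1, h2, h3, h4⟩

/-- A state with small output energy is in the neighbourhood of the zero dynamics manifold. -/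
theorem mem_Zdelta_of_outputEnergy_le {a k δ ξ lam0 lam1 : ℝ} (ha : 1 ≤ a) (hk : 1 ≤ k)
    (hlam : 0 < lam0)
    (heta : ∀ q : Fin 3 → ℝ, |q 2 - p.q3ref| ≤ 1 → |q 0 + q 1| ≤ 1 →
      (∃ L ∈ Icc lam0 lam1, eta p q 0 = L * (q 2 - p.q3ref)) ∧
      (∃ L ∈ Icc lam0 lam1, eta p q 1 = L * (q 0 + q 1)))
    {q v : Fin 3 → ℝ} {w : Fin 2 → ℝ} (h : √(outputEnergy p a k q v w) ≤ ξ) (hξ : 6 * ξ ≤ 1)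
    (hξδ : (12 * lam1 + 6) * ξ ≤ δ) :
    (q, v) ∈ Zdelta p δ ∧ ∀ i, |w i| ≤ 1 / k ^ 2 := by
  have hk0 : 0 < k := one_pos.trans_le hk
  have hξ0 : 0 ≤ ξ := (Real.sqrt_nonneg _).trans h
  obtain ⟨h1, h2, h3, h4, h5, h6⟩ := abs_le_sqrt_outputEnergy p ha hk0 q v w
  have h7 : 6 * √(outputEnergy p a k q v w) / k ≤ 6 * ξ :=
    (div_le_self (by positivity) hk).trans (by linarith)
  have e1 : |q 2 - p.q3ref| ≤ 6 * ξ := h1.trans h7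
  have e2 : |q 0 + q 1| ≤ 6 * ξ := h2.trans h7
  have o1 : |v 2| ≤ 3 * ξ := by linarith
  have o2 : |v 0 + v 1| ≤ 3 * ξ := by linarith
  obtain ⟨⟨L1, hL1, hη1⟩, ⟨L2, hL2, hη2⟩⟩ := heta q (e1.trans hξ) (e2.trans hξ)
  have hlam1 : 0 < lam1 := hlam.trans_le (hL1.1.trans hL1.2)
  have key : ∀ L e, L ∈ Icc lam0 lam1 → |e| ≤ 6 * ξ → (L * e) ^ 2 ≤ (6 * lam1 * ξ) ^ 2 := by
    intro L e hL he
    rw [← sq_abs, abs_mul, abs_of_pos (hlam.trans_le hL.1)]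
    refine pow_le_pow_left₀ (mul_nonneg (hlam.le.trans hL.1) (abs_nonneg _)) ?_ 2
    have := mul_le_mul hL.2 he (abs_nonneg _) hlam1.le
    linarith
  have hpi := Real.pi_gt_three
  refine ⟨⟨?_, ?_⟩, ?_⟩
  · intro i
    fin_cases i
    · change |q 2 - p.q3ref| < π / 2
      linarith
    · change |q 0 + q 1| < π / 2
      linarith
  · rw [Real.sqrt_le_iff]
    refine ⟨le_trans (by positivity) hξδ, ?_⟩
    simp only [Fin.sum_univ_two, omegaE, outputJacobian_mulVec, Matrix.cons_val_zero,
      Matrix.cons_val_one, Matrix.cons_val_fin_one]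
    rw [hη1, hη2]
    have k1 := key L1 _ hL1 e1
    have k2 := key L2 _ hL2 e2
    have k3 : v 2 ^ 2 ≤ (3 * ξ) ^ 2 := sq_le_sq' (neg_le_of_abs_le o1) (le_of_abs_le o1)
    have k4 : (v 0 + v 1) ^ 2 ≤ (3 * ξ) ^ 2 := sq_le_sq' (neg_le_of_abs_le o2) (le_of_abs_le o2)
    have k5 : ((12 * lam1 + 6) * ξ) ^ 2 ≤ δ ^ 2 := pow_le_pow_left₀ (by positivity) hξδ 2
    have k6 : 0 ≤ lam1 * ξ ^ 2 := by positivity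
    have k7 : 0 ≤ lam1 ^ 2 * ξ ^ 2 := by positivity
    have k8 : 0 ≤ ξ ^ 2 := by positivity
    linarith
  · have hw : ∀ y, |k ^ 2 * y| ≤ 3 * √(outputEnergy p a k q v w) → |y| ≤ 1 / k ^ 2 := by
      intro y hy
      rw [le_div_iff₀ (by positivity), mul_comm, ← abs_of_pos (by positivity : 0 < k ^ 2),
        ← abs_mul]
      linarith
    intro i
    fin_cases i
    · exact hw _ h5
    · exact hw _ h6

/-- The output energy just after an impact. -/
theorem outputEnergy_reset_le {a k δ A A' : ℝ} (ha : 0 ≤ a) (hk : 0 < k) (hkδ : 1 ≤ k * δ)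
    (hA : 0 ≤ A) (hA' : 0 ≤ A') {q v : Fin 3 → ℝ} {w : Fin 2 → ℝ} (h1 : |q 2 - p.q3ref| ≤ A * δ)
    (h2 : |q 0 + q 1| ≤ A * δ) (h3 : ∀ i, |(reset p (q, v)).2 i| ≤ A')
    (h4 : ∀ i, |w i| ≤ 1 / k ^ 2) :
    outputEnergy p a k (reset p (q, v)).1 (reset p (q, v)).2 w
      ≤ (2 * (a * A + 4 * A' + 1) * (k * δ)) ^ 2 := by
  refine (outputEnergy_le p a k _ _ _).trans ?_
  unfold outputNormSq
  rw [reset_fst]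
  simp only [Matrix.cons_val_zero, Matrix.cons_val_one, Matrix.cons_val]
  set v' := (reset p (q, v)).2
  have hM : 0 ≤ k * δ := zero_le_one.trans hkδ
  -- The velocities after the impact are bounded but not small; because kδ ≥ 1 they still fit the
  -- scale kδ.
  have hA2 : A' ≤ A' * (k * δ) := le_mul_of_one_le_right hA' hkδ
  have o1 : |v' 2| ≤ 2 * A' * (k * δ) := by linarith [h3 2]
  have o2 : |v' 0 + v' 1| ≤ 2 * A' * (k * δ) := by
    linarith [h3 0, h3 1, abs_add_le (v' 0) (v' 1)]
  have hP : ∀ e o, |e| ≤ A * δ → |o| ≤ 2 * A' * (k * δ) →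
      (a * k * e + o) ^ 2 ≤ ((a * A + 2 * A') * (k * δ)) ^ 2 := by
    intro e o he ho
    rw [← sq_abs]
    refine pow_le_pow_left₀ (abs_nonneg _) ((abs_add_le _ _).trans ?_) 2
    rw [abs_mul, abs_of_nonneg (by positivity : 0 ≤ a * k)]
    have := mul_le_mul_of_nonneg_left he (by positivity : 0 ≤ a * k)
    linarith
  have ho : ∀ o : ℝ, |o| ≤ 2 * A' * (k * δ) → o ^ 2 ≤ (2 * A' * (k * δ)) ^ 2 := fun o h =>
    sq_le_sq' (neg_le_of_abs_le h) (le_of_abs_le h)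
  have hz : ∀ i, (k ^ 2 * w i) ^ 2 ≤ (k * δ) ^ 2 := by
    intro i
    rw [← sq_abs]
    refine pow_le_pow_left₀ (abs_nonneg _) ?_ 2
    rw [abs_mul, abs_of_pos (by positivity : 0 < k ^ 2)]
    have := h4 i
    rw [le_div_iff₀ (by positivity)] at this
    linarith
  have p1 := hP _ _ h1 o1
  have p2 := hP (q 1 + q 0) _ (by rwa [add_comm]) o2
  have q1 := ho _ o1
  have q2 := ho _ o2
  have z0 := hz 0
  have z1 := hz 1
  have hfin : 4 * (((a * A + 2 * A') * (k * δ)) ^ 2 + (2 * A' * (k * δ)) ^ 2 + (k * δ) ^ 2)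
      ≤ (2 * (a * A + 4 * A' + 1) * (k * δ)) ^ 2 := by
    have e : (2 * (a * A + 4 * A' + 1) * (k * δ)) ^ 2
        - 4 * (((a * A + 2 * A') * (k * δ)) ^ 2 + (2 * A' * (k * δ)) ^ 2 + (k * δ) ^ 2)
        = (k * δ) ^ 2 * (4 * ((a * A + 4 * A' + 1) ^ 2 - (a * A + 2 * A') ^ 2 - (2 * A') ^ 2
          - 1)) := by ring
    have haA : 0 ≤ a * A := by positivity
    have e2 : 0 ≤ (a * A + 4 * A' + 1) ^ 2 - (a * A + 2 * A') ^ 2 - (2 * A') ^ 2 - 1 := by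
      have : (a * A + 4 * A' + 1) ^ 2 - (a * A + 2 * A') ^ 2 - (2 * A') ^ 2 - 1
          = 4 * (a * A) * A' + 8 * A' ^ 2 + 2 * (a * A) + 8 * A' := by ring
      rw [this]
      positivity
    have e3 : 0 ≤ (k * δ) ^ 2 * (4 * ((a * A + 4 * A' + 1) ^ 2 - (a * A + 2 * A') ^ 2
        - (2 * A') ^ 2 - 1)) := by positivity
    linarith
  linarith

/-- With the gains `K`, the swing phase leads from the states before an impact to such states, in
a time between `Tmin` and `Tmax` and inside the set `S`. -/
def SwingReturns (K : Gains) (lamC : ℝ) (V : Set ℝ) (δ ρ Tmin Tmax : ℝ)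
    (S : Set ((Fin 3 → ℝ) × (Fin 3 → ℝ) × (Fin 2 → ℝ))) : Prop :=
  ∀ q₀ v₀ w₀, PreImpact p V δ ρ q₀ v₀ w₀ → (reset p (q₀, v₀)).1 0 < p.q1ref ∧
  ∀ (T : ℝ) (q v : ℝ → Fin 3 → ℝ) (w : ℝ → Fin 2 → ℝ), 0 ≤ T → T ≤ Tmax →
    ContinuousOn q (Icc 0 T) → ContinuousOn v (Icc 0 T) → ContinuousOn w (Icc 0 T) →
    (q 0, v 0) = reset p (q₀, v₀) → w 0 = w₀ → (∀ t ∈ Icc 0 T, q t 0 ≤ p.q1ref) →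
    (∀ t ∈ Ioo 0 T, (q t, v t, w t) ∈ S → HasDerivAt q (v t) t ∧
      HasDerivAt v (swingAcc p (q t) (v t) (control p K lamC (q t) (v t) (w t))) t ∧
      HasDerivAt w (integralRate p (q t) (v t) (w t)) t) →
    (∀ t ∈ Icc 0 T, (q t, v t, w t) ∈ S) ∧ T < Tmax ∧
    (q T 0 = p.q1ref → Tmin ≤ T ∧ PreImpact p V δ ρ (q T) (v T) (w T))

/-- For a small neighbourhood of the zero dynamics manifold there are gains with which the swing
phase leads from every state before an impact to another such state, in a time between two
positive bounds and inside a compact set in which the closed loop is smooth. -/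
theorem exists_swing (lamC : ℝ)
    (hdec : ∀ a ∈ Icc (-p.q1ref) p.q1ref, (errorInput p (zeroConfig p a)).det ≠ 0)
    {V : Set ℝ} (hVc : IsCompact V) (hVne : V.Nonempty)
    (hgait : ∀ a ∈ V, ∃ b ∈ interior V, ZeroDynStep p a b) :
    ∃ δ₀ > 0, ∀ δ, 0 < δ → δ < δ₀ → ∃ (K : Gains)
      (S : Set ((Fin 3 → ℝ) × (Fin 3 → ℝ) × (Fin 2 → ℝ))) (ρ Tmin Tmax : ℝ),
      IsCompact S ∧ (∀ x ∈ S, gain p x.1 ≠ 0) ∧ 0 < ρ ∧ 0 < Tmin ∧ 0 < Tmax ∧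
      SwingReturns p K lamC V δ ρ Tmin Tmax S := by
  have hq1 := p.q1ref_pos
  obtain ⟨B, hB⟩ := exists_modelBound p lamC
  have hB0 : 0 < B := one_pos.trans_le hB.one_le
  obtain ⟨σ, c₀, ε₀, hσ, hc₀, hε₀, hgain₀⟩ := exists_le_sign_mul_gain p hdec
  set ε := min ε₀ 1 with hεd
  have hε : 0 < ε := lt_min hε₀ one_pos
  have hε1 : ε ≤ 1 := min_le_right _ _
  have hgain : ∀ q : Fin 3 → ℝ, -p.q1ref - ε ≤ q 0 → q 0 ≤ p.q1ref → |q 2 - p.q3ref| ≤ ε →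
      c₀ ≤ σ * gain p q := fun q h1 h2 h3 =>
    hgain₀ q (by linarith [min_le_left ε₀ 1]) h2 (h3.trans (min_le_left _ _))
  have hgainz : ∀ x ∈ Icc (-p.q1ref) p.q1ref, c₀ ≤ σ * gain p (zeroConfig p x) := fun x hx =>
    hgain (zeroConfig p x) (by simp only [zeroConfig, Matrix.cons_val_zero]; linarith [hx.1])
      (by simpa [zeroConfig] using hx.2) (by simpa [zeroConfig] using hε.le)
  obtain ⟨H, hH⟩ := exists_zeroDyn_potential p
  have hHc : Continuous H := continuous_iff_continuousAt.2 fun x => (hH x).continuousAt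
  obtain ⟨ε₁, tol, slo, shi, hε₁, hε₁ε, htol, hslo, hshi, hen⟩ :=
    exists_energy_bounds p hσ hc₀ hε hε1 hgainz hH hVc hVne hgait
  obtain ⟨m, hm, hret⟩ := exists_return_margin p hσ hc₀ (hgainz _ ⟨by linarith, le_rfl⟩) hH hVc
    hgait
  set xlo := -p.q1ref - ε₁ with hxlo
  have hgainx : ∀ q : Fin 3 → ℝ, xlo ≤ q 0 → q 0 ≤ p.q1ref → |q 2 - p.q3ref| ≤ ε →
      c₀ ≤ σ * gain p q := fun q h1 h2 h3 => hgain q (by linarith) h2 h3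
  obtain ⟨a, c, ha, hc, hder⟩ := exists_tube_derivatives p hB hσ hc₀ hε hε1
    (by linarith : -p.q1ref - 1 ≤ xlo) hgainx hH
  obtain ⟨C, hC, hder⟩ := hder slo shi hslo hshi
  obtain ⟨lam0, lam1, hlam0, hlam01, heta⟩ := exists_eta_eq_mul p
  obtain ⟨A, hA, hout⟩ := exists_output_le p
  obtain ⟨A', hA', hres⟩ := exists_reset_snd_le p hVc
  set μ := c / 32 with hμd
  have hμ : 0 < μ := by positivity
  -- The first summand makes the energy after an impact at most (R/2 · kδ)²; the other two give the
  -- inequality `hRC` for the steady part.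
  set R := 4 * (a * A + 4 * A' + 1) + C / μ + 1 with hRd
  have haA : 0 ≤ a * A := mul_nonneg (by linarith) hA
  have hR1 : 1 ≤ R := by
    have : 0 ≤ C / μ := by positivity
    linarith
  have hR : 0 < R := one_pos.trans_le hR1
  have hRC : C / (2 * μ) ≤ R ^ 2 / 2 := by
    have e1 : C / (2 * μ) = C / μ / 2 := by field_simp
    have e2 : R ≤ R ^ 2 := le_self_pow₀ hR1 two_ne_zero
    rw [e1]
    linarith
  obtain ⟨θ₀, hθ₀, hder⟩ := hder R hR
  -- At mean speed slo/B the stance angle would rise by 3q₁ref + 1 in this time, past q₁ref even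
  -- after the losses of order δ.
  set Tmax := (3 * p.q1ref + 1) / (slo / B) with hTmax
  have hvlo : 0 < slo / B := by positivity
  have hTmax0 : 0 < Tmax := by positivity
  set W := C * (R / (2 * μ) + √(C / (2 * μ)) * Tmax) with hW
  have hW0 : 0 ≤ W := by positivity
  -- The amount c₀ m slo / 24 is granted twice: to the energy just after the impact, and to its
  -- drift during the swing.
  set tol₂ := min tol (c₀ * m * slo / 24) with htol₂
  have htol₂0 : 0 < tol₂ := by positivity
  have hE : Continuous fun x : (Fin 3 → ℝ) × (Fin 3 → ℝ) =>
      postMomentum p x ^ 2 / 2 - H ((reset p x).1 0) := by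
    have h1 := continuous_postMomentum p
    have h2 : Continuous fun x : (Fin 3 → ℝ) × (Fin 3 → ℝ) => (reset p x).1 0 :=
      (continuous_apply 0).comp (continuous_fst.comp (continuous_reset p))
    fun_prop
  have hev : ∀ᶠ δ in 𝓝[>] (0 : ℝ), δ ≤ θ₀ ∧ (A + W) * δ < ε₁ ∧ (A + W) * δ < p.q1ref ∧
      W * δ < slo ^ 2 ∧ W * δ < c₀ * m * slo / 24 ∧
      (∀ q v, (q, v) ∈ switchingSurface p ∩ Zdelta p δ → v 0 ∈ V →
        |postMomentum p (q, v) - postMomentum p (zeroConfig p p.q1ref, zeroVel (v 0))| < slo ∧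
        |postMomentum p (q, v) ^ 2 / 2 - H ((reset p (q, v)).1 0)
          - (postMomentum p (zeroConfig p p.q1ref, zeroVel (v 0)) ^ 2 / 2
            - H ((reset p (zeroConfig p p.q1ref, zeroVel (v 0))).1 0))| < tol₂ ∧
        ∀ i, |(reset p (q, v)).2 i| ≤ A') := by
    filter_upwards [eventually_mul_lt_nhdsGT_zero 1 hθ₀, eventually_mul_lt_nhdsGT_zero (A + W) hε₁,
      eventually_mul_lt_nhdsGT_zero (A + W) hq1,
      eventually_mul_lt_nhdsGT_zero W (by positivity : 0 < slo ^ 2),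
      eventually_mul_lt_nhdsGT_zero W (by positivity : 0 < c₀ * m * slo / 24),
      eventually_abs_sub_zeroDyn_lt p hVc (continuous_postMomentum p) hslo,
      eventually_abs_sub_zeroDyn_lt p hVc hE htol₂0, hres] with δ h1 h2 h3 h4 h5 h6 h7 h8
    exact ⟨by linarith, h2, h3, h4, h5, fun q v h hv => ⟨h6 q v h hv, h7 q v h hv, h8 q v h hv⟩⟩
  obtain ⟨δ₀, hδ₀, hδ₀'⟩ := mem_nhdsGT_iff_exists_Ioo_subset.1 hev
  refine ⟨δ₀, hδ₀, fun δ hδ hδlt => ?_⟩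
  obtain ⟨hδθ, hAW1, hAW2, hWslo, hWm, hpost⟩ := hδ₀' ⟨hδ, hδlt⟩
  -- The stance angle must rise by nearly 2q₁ref, and by at least q₁ref after the corrections of
  -- order δ, at mean speed at most shi/c₀.
  set Tmin := p.q1ref / (shi / c₀) with hTmin
  have hvhi : 0 < shi / c₀ := by positivity
  have hTmin0 : 0 < Tmin := by positivity
  -- the size of the output at the end of the swing phase
  set ξ : ℝ → ℝ := fun k => R / 2 * δ * k * exp (-(μ * Tmin * k)) + √(C / (2 * μ)) / k with hξ
  have hξlim : Tendsto ξ atTop (𝓝 0) :=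
    tendsto_mul_exp_neg_add_div (R / 2 * δ) (√(C / (2 * μ))) (by positivity)
  have hevk : ∀ x : ℝ, ∀ e, 0 < e → ∀ᶠ k in atTop, x * ξ k < e := by
    intro x e he
    have h := hξlim.const_mul x
    rw [mul_zero] at h
    exact h.eventually (gt_mem_nhds he)
  -- Only now, with δ fixed, is the gain parameter chosen; k ≥ 1/δ is the condition kδ ≥ 1 of the
  -- peak estimates.
  obtain ⟨k, hk1, hkδ, hξ1, hξ2, hξ3⟩ : ∃ k, 1 ≤ k ∧ 1 / δ ≤ k ∧ 6 * ξ k < 1 ∧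
      (12 * lam1 + 6) * ξ k < δ ∧ (6 * B + shi / c₀ * (12 * B)) * ξ k < c₀ * m / 3 :=
    ((eventually_ge_atTop 1).and ((eventually_ge_atTop (1 / δ)).and ((hevk 6 1 one_pos).and
      ((hevk _ δ hδ).and (hevk _ (c₀ * m / 3) (by positivity)))))).exists
  have hk : 0 < k := one_pos.trans_le hk1
  replace hkδ : 1 ≤ k * δ := by
    rw [div_le_iff₀ hδ] at hkδ
    exact hkδ
  obtain ⟨hMε, hder⟩ := hder k δ hk1 hδ hδθ hkδ
  have hM : 0 ≤ R * (k * δ) := by positivity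
  refine ⟨highGains (one_pos.trans_le ha) hc (one_pos.trans_le hk1),
    tube p a k (R * (k * δ)) σ slo shi xlo, 1 / k ^ 2, Tmin, Tmax,
    isCompact_tube p hB hσ hc₀ hslo ha hk hM hgainx hMε, ?_, by positivity, hTmin0, hTmax0, ?_⟩
  · intro x hx h
    have := hgainx x.1 hx.1 hx.2.1 ((abs_le_of_mem_tube p ha hk hM hx).1.trans hMε)
    rw [h, mul_zero] at this
    linarith
  intro q₀ v₀ w₀ hpre
  obtain ⟨he1, he2, ho1, ho2⟩ := hout δ hδ.le q₀ v₀ hpre.mem.2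
  have hq₀ : q₀ 0 = p.q1ref := hpre.mem.1
  obtain ⟨hp1, hp2, hp3⟩ := hpost q₀ v₀ hpre.mem hpre.velocity
  rw [← stepMomentum_eq, reset_zeroConfig] at hp2
  rw [← stepMomentum_eq] at hp1
  simp only [zeroConfig, Matrix.cons_val_zero] at hp2
  have hx0 : (reset p (q₀, v₀)).1 0 = q₀ 1 := by rw [reset_fst]; rfl
  have he2' := abs_le.1 he2
  have hWδ : 0 ≤ W * δ := by positivity
  refine ⟨by rw [hx0]; linarith, ?_⟩
  intro T q v w hT0 hTT hqc hvc hwc hreset hw0 hxhi hsol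
  have hq0 : q 0 = (reset p (q₀, v₀)).1 := congrArg Prod.fst hreset
  have hv0 : v 0 = (reset p (q₀, v₀)).2 := congrArg Prod.snd hreset
  have hx0' : q 0 0 = q₀ 1 := by rw [hq0, hx0]
  have hmom0 : momentum p (q 0) (v 0) = postMomentum p (q₀, v₀) := by
    rw [hq0, hv0, postMomentum]
  have hσ2 : σ ^ 2 = 1 := by rcases hσ with rfl | rfl <;> norm_num
  have hE0 : |(σ * momentum p (q 0) (v 0)) ^ 2 / 2 - H (q 0 0)
      - (stepMomentum p (v₀ 0) ^ 2 / 2 - H (-p.q1ref))| < tol₂ := by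
    rw [mul_pow, hσ2, one_mul, hmom0, hq0]
    exact hp2
  obtain ⟨hstep, hen⟩ := hen (v₀ 0) hpre.velocity
  have henergy := hen _ (hE0.le.trans (min_le_left _ _))
  have hxlt : xlo + W * δ < q 0 0 := by rw [hx0', hxlo]; linarith
  -- Closeness to the zero dynamics yields the sign of the momentum only; the bound by slo comes
  -- from the energy once the sign is known.
  have hs0pos : 0 < σ * momentum p (q 0) (v 0) := by
    have h1 : |σ * (postMomentum p (q₀, v₀) - stepMomentum p (v₀ 0))| < slo := by
      rwa [abs_mul_of_sign hσ]
    have := (abs_lt.1 h1).1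
    rw [hmom0]
    linarith
  have hs0 : slo ≤ σ * momentum p (q 0) (v 0) := by
    have h1 := (henergy (q 0 0) ⟨by linarith, hxhi 0 (left_mem_Icc.2 hT0)⟩).1
    refine le_of_sq_le_sq ?_ hs0pos.le
    have : 0 < slo ^ 2 := by positivity
    linarith
  have hQ0 : outputEnergy p a k (q 0) (v 0) (w 0) ≤ (R / 2 * (k * δ)) ^ 2 := by
    rw [hq0, hv0, hw0]
    refine (outputEnergy_reset_le p (by linarith) hk hkδ hA hA' he1 he2 hp3
      hpre.integral).trans ?_
    refine pow_le_pow_left₀ (by positivity) ?_ 2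
    refine mul_le_mul_of_nonneg_right ?_ (by positivity)
    have : 0 ≤ C / μ := by positivity
    linarith
  have hest := swing_estimates p hvlo.le hHc hk1 hkδ hμ hC hR hRC hW hslo hshi hder hTT
    hqc hvc hwc hxhi hsol hQ0 hs0 henergy hWslo.le hxlt
  refine ⟨fun t ht => (hest t ht).1, ?_, ?_⟩
  · refine lt_of_le_of_ne hTT fun h => ?_
    obtain ⟨-, -, -, h1, -⟩ := hest T (right_mem_Icc.2 hT0)
    have h2 : slo / B * T = 3 * p.q1ref + 1 := by
      rw [h, hTmax, mul_div_cancel₀ _ hvlo.ne']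
    have := hxhi T (right_mem_Icc.2 hT0)
    rw [h2, hx0'] at h1
    linarith
  · intro hqT
    obtain ⟨htube, hsq, hET, -, h1⟩ := hest T (right_mem_Icc.2 hT0)
    have hTT' : Tmin ≤ T := by
      rw [hTmin, div_le_iff₀ hvhi]
      rw [hqT, hx0'] at h1
      linarith
    have hξT : √(outputEnergy p a k (q T) (v T) (w T)) ≤ ξ k := by
      refine hsq.trans ?_
      simp only [hξ]
      have e1 : exp (-(μ * k * T)) ≤ exp (-(μ * Tmin * k)) := by
        rw [exp_le_exp]
        have := mul_le_mul_of_nonneg_left hTT' (by positivity : 0 ≤ μ * k)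
        linarith
      have e2 := mul_le_mul_of_nonneg_left e1 (by positivity : 0 ≤ R / 2 * (k * δ))
      have e3 : R / 2 * δ * k * exp (-(μ * Tmin * k))
          = R / 2 * (k * δ) * exp (-(μ * Tmin * k)) := by ring
      rw [e3]
      linarith
    obtain ⟨hZ, hw⟩ := mem_Zdelta_of_outputEnergy_le p ha hk1 hlam0 heta hξT hξ1.le hξ2.le
    have hξ0 : 0 ≤ ξ k := (Real.sqrt_nonneg _).trans hξT
    refine ⟨hTT', ⟨⟨hqT, hZ⟩, ?_, hw⟩⟩
    obtain ⟨b, hb0, hb, hbV⟩ := hret (v₀ 0) hpre.velocity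
    obtain ⟨f1, f2, f3, f4, -, -⟩ := abs_le_sqrt_outputEnergy p ha hk (q T) (v T) (w T)
    have f5 : 6 * √(outputEnergy p a k (q T) (v T) (w T)) / k ≤ 6 * ξ k :=
      (div_le_self (by positivity) hk1).trans (by linarith)
    have hgT := hgainx (q T) htube.1 htube.2.1
      ((abs_le_of_mem_tube p ha hk hM htube).1.trans hMε)
    have g1 := gain_mul_velocity_sub_le p hB hσ (q := q T) (v := v T) (Y := 3 * ξ k)
      (by linarith) (by linarith)
    have g2 : |σ * gain p (q T) - σ * gain p (zeroConfig p p.q1ref)| ≤ B * (12 * ξ k) := by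
      rw [← mul_sub, abs_mul_of_sign hσ]
      have := hB.gain_sub_le (q T)
      rw [hqT] at this
      refine this.trans (mul_le_mul_of_nonneg_left ?_ hB0.le)
      rw [hqT] at f2
      linarith
    have g3 : |(σ * momentum p (q T) (v T)) ^ 2 / 2
        - (σ * gain p (zeroConfig p p.q1ref) * b) ^ 2 / 2| ≤ c₀ * m * slo / 12 := by
      rw [hb]
      rw [hqT] at hET
      have e1 := hE0.le.trans (min_le_right _ _)
      rw [abs_le] at hET e1 ⊢
      constructor <;> linarith
    have hgz := hgainz p.q1ref ⟨by linarith, le_rfl⟩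
    have hclose := abs_sub_le_of_energy_sub_le hc₀ hslo hgT htube.2.2.2.1 hb0.le
      (hc₀.le.trans hgz) g1 g2 g3
    have hbmax : b ≤ shi / c₀ := by
      rw [le_div_iff₀ hc₀]
      have e1 := (hen _ (by rw [sub_self, abs_zero]; exact htol.le) p.q1ref
        ⟨by linarith, le_rfl⟩).2
      rw [← hb] at e1
      have e2 : σ * gain p (zeroConfig p p.q1ref) * b ≤ shi := by
        refine le_of_sq_le_sq ?_ hshi.le
        have : 0 < shi ^ 2 := by positivity
        linarith
      have := mul_le_mul_of_nonneg_right hgz hb0.le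
      linarith
    -- Against the margin c₀m, the energy error takes c₀m/6 and the remaining output less than
    -- c₀m/3.
    refine hbV _ (lt_of_le_of_lt hclose ?_)
    rw [div_lt_iff₀ hc₀]
    have e1 : 2 * (c₀ * m * slo / 12) / slo = c₀ * m / 6 := by field_simp; norm_num
    have e2 : b * (B * (12 * ξ k)) ≤ shi / c₀ * (B * (12 * ξ k)) :=
      mul_le_mul_of_nonneg_right hbmax (by positivity)
    have e3 : 0 < c₀ * m := by positivity
    rw [e1]
    linarith

end Biped

/-! ### From single swing phases to walks -/

/-- The concatenation of curves which are parametrized from time zero. -/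
theorem exists_concatenation {X : Type*} {t : ℕ → ℝ} (ht : StrictMono t) (z : X)
    (y : ℕ → ℝ → X) :
    ∃ x : ℝ → X, x (t 0) = z ∧ ∀ k, ∀ s ∈ Ioc (t k) (t (k + 1)), x s = y k (s - t k) := by
  classical
  let f : ℕ → ℝ → X := fun n s => Nat.casesOn n z fun k => y k (s - t k)
  -- The arc at time s is selected by the first impact time not before s, which makes the
  -- concatenation take pre-impact values at impacts; index 0 is reserved for the initial state.
  refine ⟨fun s => if h : ∃ k, s ≤ t k then f (Nat.find h) s else z, ?_, fun k s hs => ?_⟩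
  · have h : ∃ k, t 0 ≤ t k := ⟨0, le_rfl⟩
    have h0 : Nat.find h = 0 := (Nat.find_eq_zero h).2 le_rfl
    simp only [dif_pos h, h0, f]
    rfl
  · have h : ∃ k, s ≤ t k := ⟨k + 1, hs.2⟩
    have h0 : Nat.find h = k + 1 := (Nat.find_eq_iff h).2
      ⟨hs.2, fun n hn => not_le.2 ((ht.monotone (Nat.lt_succ_iff.1 hn)).trans_lt hs.1)⟩
    simp only [dif_pos h, h0, f]

/-- A curve with a limit at the left end of an interval, parametrized from time zero. -/
theorem exists_shift {X : Type*} [TopologicalSpace X] {x : ℝ → X} {a b : ℝ} {z : X}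
    (hx : ContinuousOn x (Ioc a b)) (hz : Tendsto x (𝓝[>] a) (𝓝 z)) :
    ∃ y : ℝ → X, y 0 = z ∧ ContinuousOn y (Icc 0 (b - a)) ∧ ∀ s, 0 < s → y s = x (a + s) := by
  refine ⟨fun s => Function.update x a z (a + s), by simp, ?_, fun s hs => ?_⟩
  · have h : ContinuousOn (Function.update x a z) (Icc a b) := by
      rw [continuousOn_update_iff, Icc_sdiff_left]
      exact ⟨hx, fun _ => hz.mono_left (nhdsWithin_mono _ fun s hs => hs.1)⟩
    refine h.comp (by fun_prop) fun s hs => ⟨?_, ?_⟩ <;> linarith [hs.1, hs.2]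
  · exact Function.update_of_ne (by linarith) _ _

namespace Biped

variable (p : Params)

/-- The state before an impact. -/
abbrev IsPreImpact (V : Set ℝ) (δ ρ : ℝ) (x : (Fin 3 → ℝ) × (Fin 3 → ℝ) × (Fin 2 → ℝ)) : Prop :=
  PreImpact p V δ ρ x.1 x.2.1 x.2.2

/-- The state after an impact. -/
noncomputable def resetFull (x : (Fin 3 → ℝ) × (Fin 3 → ℝ) × (Fin 2 → ℝ)) :
    (Fin 3 → ℝ) × (Fin 3 → ℝ) × (Fin 2 → ℝ) :=
  ((reset p (x.1, x.2.1)).1, (reset p (x.1, x.2.1)).2, x.2.2)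

variable {p}

theorem hasDerivAt_closedLoop {K : Gains} {lamC : ℝ} {q v : ℝ → Fin 3 → ℝ} {w : ℝ → Fin 2 → ℝ}
    {t : ℝ} (hq : HasDerivAt q (v t) t)
    (hv : HasDerivAt v (swingAcc p (q t) (v t) (control p K lamC (q t) (v t) (w t))) t)
    (hw : HasDerivAt w (integralRate p (q t) (v t) (w t)) t) :
    HasDerivAt (fun t => (q t, v t, w t)) (closedLoop p K lamC (q t, v t, w t)) t :=
  hq.prodMk (hv.prodMk hw)

/-- The differential equation is demanded only while the curve is in S, so this applies both to
solutions of the cut-off field and to given trajectories. -/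
theorem SwingReturns.curve {K : Gains} {lamC : ℝ} {V : Set ℝ} {δ ρ Tmin Tmax : ℝ}
    {S : Set ((Fin 3 → ℝ) × (Fin 3 → ℝ) × (Fin 2 → ℝ))}
    (h : SwingReturns p K lamC V δ ρ Tmin Tmax S)
    {z : (Fin 3 → ℝ) × (Fin 3 → ℝ) × (Fin 2 → ℝ)} (hz : IsPreImpact p V δ ρ z) {T : ℝ}
    {y : ℝ → (Fin 3 → ℝ) × (Fin 3 → ℝ) × (Fin 2 → ℝ)} (hT : 0 ≤ T) (hTT : T ≤ Tmax)
    (hy : ContinuousOn y (Icc 0 T)) (hy0 : y 0 = resetFull p z)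
    (hle : ∀ t ∈ Icc 0 T, (y t).1 0 ≤ p.q1ref)
    (hd : ∀ t ∈ Ioo 0 T, y t ∈ S → HasDerivAt y (closedLoop p K lamC (y t)) t) :
    (∀ t ∈ Icc 0 T, y t ∈ S) ∧ T < Tmax ∧
      ((y T).1 0 = p.q1ref → Tmin ≤ T ∧ IsPreImpact p V δ ρ (y T)) :=
  (h z.1 z.2.1 z.2.2 hz).2 T (fun t => (y t).1) (fun t => (y t).2.1) (fun t => (y t).2.2) hT hTT
    hy.fst hy.snd.fst hy.snd.snd (by simp only [hy0, resetFull]) (by simp only [hy0, resetFull])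
    hle fun t ht hS => ⟨(hd t ht hS).fst, (hd t ht hS).snd.fst, (hd t ht hS).snd.snd⟩

/-- The cut-off solution is stopped when the stance angle first reaches q₁ref. The estimates put it
in S up to that time, so it solves the true equations. -/
theorem SwingReturns.exists_step {K : Gains} {lamC : ℝ} {V : Set ℝ} {δ ρ Tmin Tmax : ℝ}
    {S : Set ((Fin 3 → ℝ) × (Fin 3 → ℝ) × (Fin 2 → ℝ))}
    (h : SwingReturns p K lamC V δ ρ Tmin Tmax S) (hS : IsCompact S)
    (hgain : ∀ x ∈ S, gain p x.1 ≠ 0) (hTmax : 0 < Tmax)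
    {z : (Fin 3 → ℝ) × (Fin 3 → ℝ) × (Fin 2 → ℝ)} (hz : IsPreImpact p V δ ρ z) :
    ∃ (T : ℝ) (y : ℝ → (Fin 3 → ℝ) × (Fin 3 → ℝ) × (Fin 2 → ℝ)), Tmin ≤ T ∧
      ContinuousOn y (Icc 0 T) ∧ y 0 = resetFull p z ∧
      (∀ t ∈ Ioo 0 T, HasDerivAt y (closedLoop p K lamC (y t)) t) ∧
      (∀ t ∈ Ico 0 T, (y t).1 0 < p.q1ref) ∧ IsPreImpact p V δ ρ (y T) := by
  obtain ⟨y, hy0, hyc, hyd⟩ := exists_solution_while_mem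
    (isOpen_ne_fun ((continuous_gain p).comp continuous_fst) continuous_const) hS hgain
    (contDiffOn_closedLoop p K lamC) (resetFull p z) hTmax.le
  have hxc : ContinuousOn (fun t => (y t).1 0) (Icc 0 Tmax) := continuousOn_pi.1 hyc.fst 0
  -- A solution that stayed below q₁ref up to Tmax would satisfy the estimates with T = Tmax, and
  -- these give T < Tmax.
  have hreach : {t ∈ Icc 0 Tmax | p.q1ref ≤ (y t).1 0}.Nonempty := by
    by_contra hne
    rw [not_nonempty_iff_eq_empty, eq_empty_iff_forall_notMem] at hne
    exact lt_irrefl _ (h.curve hz hTmax.le le_rfl hyc hy0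
      (fun t ht => le_of_not_ge fun hle => hne t ⟨ht, hle⟩) hyd).2.1
  have hcomp : IsCompact {t ∈ Icc 0 Tmax | p.q1ref ≤ (y t).1 0} :=
    isCompact_Icc.of_isClosed_subset
      (hxc.preimage_isClosed_of_isClosed isClosed_Icc isClosed_Ici) (sep_subset _ _)
  obtain ⟨T, ⟨hT, hTle⟩, hmin⟩ := hcomp.exists_isLeast hreach
  have hsub : Icc 0 T ⊆ Icc 0 Tmax := Icc_subset_Icc_right hT.2
  have hlt : ∀ t ∈ Ico 0 T, (y t).1 0 < p.q1ref := fun t ht => lt_of_not_ge fun hle =>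
    not_le.2 ht.2 (hmin ⟨hsub ⟨ht.1, ht.2.le⟩, hle⟩)
  have hx0 : (y 0).1 0 < p.q1ref := by
    rw [hy0]
    exact (h _ _ _ hz).1
  have heq : (y T).1 0 = p.q1ref := by
    obtain ⟨t, ht, hte⟩ := intermediate_value_Icc hT.1 (hxc.mono hsub) ⟨hx0.le, hTle⟩
    have : t = T := le_antisymm ht.2 (hmin ⟨hsub ht, hte.ge⟩)
    exact this ▸ hte
  have hle : ∀ t ∈ Icc 0 T, (y t).1 0 ≤ p.q1ref := fun t ht => by
    rcases ht.2.lt_or_eq with h1 | h1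
    · exact (hlt t ⟨ht.1, h1⟩).le
    · rw [h1, heq]
  obtain ⟨h1, -, h2⟩ := h.curve hz hT.1 hT.2 (hyc.mono hsub) hy0 hle
    fun t ht => hyd t ⟨ht.1, ht.2.trans_le hT.2⟩
  exact ⟨T, y, (h2 heq).1, hyc.mono hsub, hy0,
    fun t ht => hyd t ⟨ht.1, ht.2.trans_le hT.2⟩ (h1 t (Ioo_subset_Icc_self ht)), hlt, (h2 heq).2⟩

/-- The existence of a walk. -/
theorem SwingReturns.exists_trajectory {K : Gains} {lamC : ℝ} {V : Set ℝ} {δ ρ Tmin Tmax : ℝ}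
    {S : Set ((Fin 3 → ℝ) × (Fin 3 → ℝ) × (Fin 2 → ℝ))}
    (h : SwingReturns p K lamC V δ ρ Tmin Tmax S) (hS : IsCompact S)
    (hgain : ∀ x ∈ S, gain p x.1 ≠ 0) (hTmin : 0 < Tmin) (hTmax : 0 < Tmax)
    {q₀ v₀ : Fin 3 → ℝ} (h₀ : PreImpact p V δ ρ q₀ v₀ 0) :
    ∃ (t : ℕ → ℝ) (q v : ℝ → Fin 3 → ℝ) (w : ℝ → Fin 2 → ℝ),
      IsHybridTrajectory p K lamC t q v w ∧ q (t 0) = q₀ ∧ v (t 0) = v₀ ∧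
      Tendsto t atTop atTop := by
  have hstep := fun z : {z // IsPreImpact p V δ ρ z} => h.exists_step hS hgain hTmax z.2
  choose T y hT hyc hy0 hyd hlt hnext using hstep
  let z : ℕ → {z // IsPreImpact p V δ ρ z} := fun n =>
    Nat.rec ⟨(q₀, v₀, 0), h₀⟩ (fun _ z => ⟨y z (T z), hnext z⟩) n
  have hz0 : (z 0).1 = (q₀, v₀, 0) := rfl
  have hz : ∀ n, (z (n + 1)).1 = y (z n) (T (z n)) := fun n => rfl
  clear_value z
  set t : ℕ → ℝ := fun n => ∑ j ∈ Finset.range n, T (z j) with htd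
  have hts : ∀ n, t (n + 1) = t n + T (z n) := fun n => Finset.sum_range_succ _ _
  have hmono : StrictMono t := strictMono_nat_of_lt_succ fun n => by
    rw [hts]
    linarith [hT (z n)]
  -- Every step lasts at least Tmin, so the impacts do not accumulate.
  have htend : Tendsto t atTop atTop := by
    refine tendsto_atTop_mono (fun n => ?_)
      (tendsto_natCast_atTop_atTop.atTop_mul_const hTmin)
    simp only [htd]
    calc (n : ℝ) * Tmin = ∑ j ∈ Finset.range n, Tmin := by simp
      _ ≤ _ := Finset.sum_le_sum fun j _ => hT (z j)
  clear_value t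
  obtain ⟨x, hx0, hx⟩ := exists_concatenation hmono (q₀, v₀, (0 : Fin 2 → ℝ)) fun n => y (z n)
  have hxz : ∀ n, x (t n) = z n := by
    intro n
    cases n with
    | zero => rw [hx0, hz0]
    | succ n =>
      rw [hx n _ ⟨hmono n.lt_succ_self, le_rfl⟩, hz, hts, add_sub_cancel_left]
  have hshift : ∀ n, ∀ s ∈ Ioo (t n) (t (n + 1)), s - t n ∈ Ioo 0 (T (z n)) := fun n s hs =>
    ⟨by linarith [hs.1], by linarith [hs.2, hts n]⟩
  have hcont : ∀ n, ContinuousOn x (Ioc (t n) (t (n + 1))) := fun n =>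
    ((hyc (z n)).comp (by fun_prop : ContinuousOn (fun s => s - t n) _) fun s hs =>
      ⟨by linarith [hs.1], by linarith [hs.2, hts n]⟩).congr (hx n)
  have hright : ∀ n, Tendsto x (𝓝[>] (t n)) (𝓝 (resetFull p (x (t n)))) := by
    intro n
    have h1 : ContinuousWithinAt (fun s => y (z n) (s - t n)) (Icc (t n) (t (n + 1))) (t n) :=
      ((hyc (z n)).comp (by fun_prop : ContinuousOn (fun s => s - t n) _) fun s hs =>
        ⟨by linarith [hs.1], by linarith [hs.2, hts n]⟩) _
        (left_mem_Icc.2 (hmono n.lt_succ_self).le)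
    have h2 : Tendsto (fun s => y (z n) (s - t n)) (𝓝[>] (t n)) (𝓝 (y (z n) (t n - t n))) := by
      rw [← nhdsWithin_Ioc_eq_nhdsGT (hmono n.lt_succ_self)]
      exact h1.mono Ioc_subset_Icc_self
    rw [sub_self, hy0, ← hxz n] at h2
    refine h2.congr' ?_
    filter_upwards [Ioc_mem_nhdsGT (hmono n.lt_succ_self)] with s hs
    exact (hx n s hs).symm
  have hder : ∀ n, ∀ s ∈ Ioo (t n) (t (n + 1)), HasDerivAt x (closedLoop p K lamC (x s)) s := by
    intro n s hs
    have h1 := (hyd (z n) _ (hshift n s hs)).comp_sub_const s (t n)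
    rw [hx n s ⟨hs.1, hs.2.le⟩]
    refine h1.congr_of_eventuallyEq ?_
    filter_upwards [Ioo_mem_nhds hs.1 hs.2] with r hr
    exact hx n r ⟨hr.1, hr.2.le⟩
  have h3 := fun n => continuous_fst.continuousAt.tendsto.comp (hright n)
  have h4 := fun n => (continuous_fst.comp continuous_snd).continuousAt.tendsto.comp (hright n)
  have h5 := fun n => (continuous_snd.comp continuous_snd).continuousAt.tendsto.comp (hright n)
  refine ⟨t, fun s => (x s).1, fun s => (x s).2.1, fun s => (x s).2.2, ?_,
    congrArg Prod.fst hx0, congrArg (fun x => x.2.1) hx0, htend⟩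
  exact {
    strictMono := hmono
    impact := fun k => by
      rw [hxz]
      exact (z k).2.mem.1
    no_impact := fun k s hs hmem => by
      have h1 := hlt (z k) _ (Ioo_subset_Ico_self (hshift k s hs))
      rw [← hx k s ⟨hs.1, hs.2.le⟩] at h1
      exact h1.ne hmem
    jump := fun k => (h3 k).prodMk_nhds (h4 k)
    integral_start := by rw [hx0]
    integral_right := h5
    left_q := fun k => (hcont k).fst
    left_v := fun k => (hcont k).snd.fst
    left_w := fun k => (hcont k).snd.snd
    deriv_q := fun k s hs => (hder k s hs).fst
    deriv_v := fun k s hs => (hder k s hs).snd.fst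
    deriv_w := fun k s hs => (hder k s hs).snd.snd }

/-- The states before the impacts of a walk. -/
theorem SwingReturns.preImpact {K : Gains} {lamC : ℝ} {V : Set ℝ} {δ ρ Tmin Tmax : ℝ}
    {S : Set ((Fin 3 → ℝ) × (Fin 3 → ℝ) × (Fin 2 → ℝ))}
    (h : SwingReturns p K lamC V δ ρ Tmin Tmax S) (hTmax : 0 < Tmax) {t : ℕ → ℝ}
    {q v : ℝ → Fin 3 → ℝ} {w : ℝ → Fin 2 → ℝ} (hx : IsHybridTrajectory p K lamC t q v w)
    (h₀ : PreImpact p V δ ρ (q (t 0)) (v (t 0)) 0) (k : ℕ) :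
    PreImpact p V δ ρ (q (t k)) (v (t k)) (w (t k)) := by
  induction k with
  | zero => rwa [hx.integral_start]
  | succ k ih =>
    have hlt : t k < t (k + 1) := hx.strictMono k.lt_succ_self
    have hz : IsPreImpact p V δ ρ (q (t k), v (t k), w (t k)) := ih
    have hlim : Tendsto (fun s => (q s, v s, w s)) (𝓝[>] (t k))
        (𝓝 (resetFull p (q (t k), v (t k), w (t k)))) :=
      ((continuous_fst.tendsto _).comp (hx.jump k)).prodMk_nhds
        (((continuous_snd.tendsto _).comp (hx.jump k)).prodMk_nhds (hx.integral_right k))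
    obtain ⟨y, hy0, hyc, hy⟩ := exists_shift
      ((hx.left_q k).prodMk ((hx.left_v k).prodMk (hx.left_w k))) hlim
    have hmem : ∀ s ∈ Ioo 0 (t (k + 1) - t k), t k + s ∈ Ioo (t k) (t (k + 1)) := fun s hs =>
      ⟨by linarith [hs.1], by linarith [hs.2]⟩
    have hyd : ∀ s ∈ Ioo 0 (t (k + 1) - t k), HasDerivAt y (closedLoop p K lamC (y s)) s := by
      intro s hs
      have h1 := (hasDerivAt_closedLoop (hx.deriv_q k _ (hmem s hs)) (hx.deriv_v k _ (hmem s hs))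
        (hx.deriv_w k _ (hmem s hs))).comp_const_add (t k) s
      rw [hy s hs.1]
      refine h1.congr_of_eventuallyEq ?_
      filter_upwards [Ioi_mem_nhds hs.1] with r hr
      exact hy r hr
    have hx0 : (y 0).1 0 < p.q1ref := by
      rw [hy0]
      exact (h _ _ _ hz).1
    have hxc : ContinuousOn (fun s => (y s).1 0) (Icc 0 (t (k + 1) - t k)) :=
      continuousOn_pi.1 hyc.fst 0
    have hle : ∀ s ∈ Icc 0 (t (k + 1) - t k), (y s).1 0 ≤ p.q1ref := by
      intro s hs
      -- An excess over q₁ref would require an earlier crossing of the switching surface, strictly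
      -- between two consecutive impacts.
      by_contra! hgt
      obtain ⟨r, hr, hre⟩ := intermediate_value_Icc hs.1
        (hxc.mono (Icc_subset_Icc_right hs.2)) ⟨hx0.le, hgt.le⟩
      have hre' : (y r).1 0 = p.q1ref := hre
      have hr0 : 0 < r := hr.1.lt_of_ne fun h0 => by
        rw [← h0] at hre'
        exact hx0.ne hre'
      have hrs : r < s := hr.2.lt_of_ne fun h0 => by
        rw [h0] at hre'
        exact hgt.ne' hre'
      refine hx.no_impact k _ (hmem r ⟨hr0, hrs.trans_le hs.2⟩) ?_
      rw [hy r hr0] at hre'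
      exact hre'
    -- A longer swing, restricted to [0, Tmax], would again contradict T < Tmax.
    have hshort : t (k + 1) - t k ≤ Tmax := by
      by_contra! hlong
      exact lt_irrefl _ (h.curve hz hTmax.le le_rfl (hyc.mono (Icc_subset_Icc_right hlong.le)) hy0
        (fun s hs => hle s ⟨hs.1, hs.2.trans hlong.le⟩)
        fun s hs _ => hyd s ⟨hs.1, hs.2.trans hlong⟩).2.1
    have hend := hy (t (k + 1) - t k) (by linarith)
    rw [add_sub_cancel] at hend
    have h2 := (h.curve hz (by linarith) hshort hyc hy0 hle fun s hs _ => hyd s hs).2.2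
    rw [hend] at h2
    exact (h2 (hx.impact (k + 1))).2

end Biped

theorem theorem1 (p : Biped.Params) (lamC : ℝ)
    (hdec : ∀ a ∈ Icc (-p.q1ref) p.q1ref, (Biped.errorInput p (Biped.zeroConfig p a)).det ≠ 0)
    (V : Set ℝ) (hVc : IsCompact V) (hVpos : V ⊆ Ioi 0)
    (hgait : ∀ a ∈ V, ∃ b ∈ interior V, Biped.ZeroDynStep p a b) :
    ∃ δ₀ > 0, ∀ δ, 0 < δ → δ < δ₀ → ∃ K : Biped.Gains,
      ∀ q₀ v₀ : Fin 3 → ℝ,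
        (q₀, v₀) ∈ Biped.switchingSurface p ∩ Biped.Zdelta p δ → v₀ 0 ∈ V →
        (∃ (t : ℕ → ℝ) (q v : ℝ → Fin 3 → ℝ) (w : ℝ → Fin 2 → ℝ),
          Biped.IsHybridTrajectory p K lamC t q v w ∧ q (t 0) = q₀ ∧ v (t 0) = v₀ ∧
          Tendsto t atTop atTop) ∧
        (∀ (t : ℕ → ℝ) (q v : ℝ → Fin 3 → ℝ) (w : ℝ → Fin 2 → ℝ),
          Biped.IsHybridTrajectory p K lamC t q v w → q (t 0) = q₀ → v (t 0) = v₀ →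
          ∀ k, (q (t k), v (t k)) ∈ Biped.Zdelta p δ) := by
  -- The uniform bounds over V come from extrema, which need a point of V; for empty V there is no
  -- admissible initial state.
  rcases V.eq_empty_or_nonempty with rfl | hVne
  · exact ⟨1, one_pos, fun δ _ _ => ⟨Biped.highGains one_pos one_pos one_pos,
      fun q₀ v₀ _ hv => absurd hv (notMem_empty _)⟩⟩
  obtain ⟨δ₀, hδ₀, h⟩ := Biped.exists_swing p lamC hdec hVc hVne hgait
  refine ⟨δ₀, hδ₀, fun δ hδ hδδ => ?_⟩
  obtain ⟨K, S, ρ, Tmin, Tmax, hS, hgain, hρ, hTmin, hTmax, hret⟩ := h δ hδ hδδ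
  refine ⟨K, fun q₀ v₀ hmem hv => ?_⟩
  have h₀ : Biped.PreImpact p V δ ρ q₀ v₀ 0 := ⟨hmem, hv, fun i => by simpa using hρ.le⟩
  refine ⟨hret.exists_trajectory hS hgain hTmin hTmax h₀, ?_⟩
  rintro t q v w hx rfl rfl k
  exact (hret.preImpact hTmax hx h₀ k).mem.2
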